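/- Let $k$ be a field and let $A=\bigoplus_{i\in\mathbb Z}A^i$ be a unital associative differential graded $k$-algebra with differential of degree $+1$. For a DG $A$-bimodule $M$ let $C^p(A,M)=\operatorname{Hom}^p_k(T(s(A/k\cdot 1)),M)$ be the normalized Hochschild cochains of total degree $p$, where $|sa|=|a|-1$, with differential $$Df(a_1,\dots,a_n)=d_Mf(a_1,\dots,a_n)+\sum_{i=1}^n(-1)^{\epsilon_i}f(\dots,da_i,\dots)-(-1)^{|f||sa_1|}a_1f(a_2,\dots,a_n)-\sum_{i=2}^n(-1)^{\epsilon_i}f(\dots,a_{i-1}a_i,\dots)+(-1)^{\epsilon_n}f(a_1,\dots,a_{n-1})a_n,$$ $\epsilon_i=|f|+|sa_1|+\dots+|sa_{i-1}|$ (for $n=0$ only the first term occurs), and let $HH^*(A,M)$ be its cohomology. On $C^*(A,A)$ put $$(x\cup y)(a_1,\dots,a_n)=\sum_i(-1)^{|y|(|sa_1|+\dots+|sa_i|)}x(a_1,\dots,a_i)\,y(a_{i+1},\dots,a_n),$$ $$(x\circ y)(a_1,\dots,a_n)=\sum_{i,j}(-1)^{(|y|+1)(|sa_1|+\dots+|sa_i|)}x(a_1,\dots,a_i,y(a_{i+1},\dots,a_{i+j}),a_{i+j+1},\dots,a_n)$$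 and $[x,y]=x\circ y-(-1)^{(|x|+1)(|y|+1)}y\circ x$. Let $A^\vee=\operatorname{Hom}_k(A,k)$ be the graded dual bimodule, with $(a\varphi)(x)=(-1)^{|a|(|\varphi|+|x|)}\varphi(xa)$, $(\varphi a)(x)=\varphi(ax)$, $(d\varphi)(x)=-(-1)^{|\varphi|}\varphi(dx)$. For $n\in\mathbb Z$ let $A^\vee[n]$ be its shift, $A^\vee[n]^j=(A^\vee)^{j+n}$, with differential $(-1)^nd$, left action $(-1)^{n|a|}a\varphi$ and unchanged right action. Identify $C^*(A,A^\vee)$ with a space of functionals on $A\otimes T(s(A/k))$ by $\varphi(a_0[a_1,\dots,a_r])=(-1)^{|a_0|(|sa_1|+\dots+|sa_r|)}\varphi(a_1,\dots,a_r)(a_0)$, and let $B^\vee\varphi=(-1)^{|\varphi|}\varphi\circ B$ be the dual of the Connes operator $$B(a_0[a_1,\dots,a_r])=\sum_{i=0}^{r}(-1)^{(|sa_0|+\dots+|sa_i|)(|sa_{i+1}|+\dots+|sa_r|)}\,1[a_{i+1},\dots,a_r,a_0,\dots,a_i].$$ **Theorem.** Let $m:A\to A^\vee[n]$ be a quasi-isomorphism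 of DG $A$-bimodules. Then: 1. $f\mapsto(-1)^{(n+1)|f|}\,m\circ f$ induces isomorphisms $HH^p(A,A)\to HH^{p+n}(A,A^\vee)$ for all $p$; let $D:HH^{p+n}(A,A^\vee)\to HH^{p}(A,A)$ be their inverses. (With $t=m(1)$, the cochain on the right is $a_0[a_1,\dots,a_r]\mapsto(-1)^{|f|(|sa_1|+\dots+|sa_r|)}\,t(a_0f(a_1,\dots,a_r))$, the cap product of $f$ with the class of $t$.) 2. $B^\vee$ induces maps $HH^p(A,A^\vee)\to HH^{p-1}(A,A^\vee)$, and $\cup$, $[-,-]$ induce operations on $HH^*(A,A)$, of degrees $0$ and $-1$. 3. With these operations and $\Delta=DB^\vee D^{-1}$, which has degree $-1$, $HH^*(A,A)$ is a BV algebra. That is: $\cup$ is associative and graded commutative; $[x,y]=-(-1)^{(|x|-1)(|y|-1)}[y,x]$; $[x,y\cup z]=[x,y]\cup z+(-1)^{(|x|-1)|y|}y\cup[x,z]$; $[[x,y],z]=[x,[y,z]]-(-1)^{(|x|-1)(|y|-1)}[y,[x,z]]$; $\Delta^2=0$; and $$[x,y]=(-1)^{|x|}\Delta(x\cup y)-(-1)^{|x|}\Delta(x)\cup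 y-x\cup\Delta(y).$$ -/

import Mathlib

/-!
Conventions.  All gradings are by `ℤ`, all differentials have degree `+1`, the suspension `s` lowers
the degree by one (`|s a| = |a| - 1`), and signs follow the Koszul rule.
-/

universe u v w w'

noncomputable section

namespace HochschildBV

/-- The linear map which multiplies each homogeneous element `a` by the scalar `s |a|`. -/
def degreeScale {k : Type u} {A : Type v} [Field k] [Ring A] [Algebra k A]
    (gr : ℤ → Submodule k A) [GradedAlgebra gr] (s : ℤ → k) : A →ₗ[k] A :=
  DirectSum.coeLinearMap gr ∘ₗ DirectSum.lmap (fun i => s i • LinearMap.id) ∘ₗ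
    (DirectSum.decomposeLinearEquiv gr).toLinearMap

theorem degreeScale_of_mem {k : Type u} {A : Type v} [Field k] [Ring A] [Algebra k A]
    (gr : ℤ → Submodule k A) [GradedAlgebra gr] (s : ℤ → k) {i : ℤ} {a : A} (ha : a ∈ gr i) :
    degreeScale gr s a = s i • a := by
  have h : DirectSum.decomposeLinearEquiv gr a = DirectSum.lof k ℤ (fun i => gr i) i ⟨a, ha⟩ :=
    DirectSum.decompose_of_mem gr ha
  simp only [degreeScale, LinearMap.comp_apply, LinearEquiv.coe_coe]
  rw [h, DirectSum.lmap_lof, DirectSum.coeLinearMap_lof]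
  rfl

/-- A (unital, associative) differential `ℤ`-graded algebra over the field `k`. -/
structure DGAlgebra (k : Type u) [Field k] where
  carrier : Type v
  [ring : Ring carrier]
  [algebra : Algebra k carrier]
  gr : ℤ → Submodule k carrier
  [graded : GradedAlgebra gr]
  d : carrier →ₗ[k] carrier
  d_mem : ∀ {i : ℤ} {a : carrier}, a ∈ gr i → d a ∈ gr (i + 1)
  d_d : ∀ a : carrier, d (d a) = 0
  leibniz : ∀ {i : ℤ} {a : carrier}, a ∈ gr i → ∀ b : carrier,
    d (a * b) = d a * b + (-1 : k) ^ i • (a * d b)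

attribute [instance] DGAlgebra.ring DGAlgebra.algebra DGAlgebra.graded

/-- A differential graded bimodule over the differential graded algebra `A`. -/
structure DGBimodule {k : Type u} [Field k] (A : DGAlgebra.{u, v} k) where
  carrier : Type w
  [addCommGroup : AddCommGroup carrier]
  [module : Module k carrier]
  gr : ℤ → Submodule k carrier
  isInternal : DirectSum.IsInternal gr
  d : carrier →ₗ[k] carrier
  left : A.carrier →ₗ[k] carrier →ₗ[k] carrier
  right : carrier →ₗ[k] A.carrier →ₗ[k] carrier
  d_mem : ∀ {i : ℤ} {x : carrier}, x ∈ gr i → d x ∈ gr (i + 1)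
  left_mem : ∀ {i j : ℤ} {a : A.carrier} {x : carrier}, a ∈ A.gr i → x ∈ gr j →
    left a x ∈ gr (i + j)
  right_mem : ∀ {i j : ℤ} {x : carrier} {a : A.carrier}, x ∈ gr i → a ∈ A.gr j →
    right x a ∈ gr (i + j)
  one_left : ∀ x : carrier, left 1 x = x
  right_one : ∀ x : carrier, right x 1 = x
  mul_left : ∀ (a b : A.carrier) (x : carrier), left (a * b) x = left a (left b x)
  right_mul : ∀ (x : carrier) (a b : A.carrier), right x (a * b) = right (right x a) b
  left_right : ∀ (a : A.carrier) (x : carrier) (b : A.carrier),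
    right (left a x) b = left a (right x b)
  d_d : ∀ x : carrier, d (d x) = 0
  leibniz_left : ∀ {i : ℤ} {a : A.carrier}, a ∈ A.gr i → ∀ x : carrier,
    d (left a x) = left (A.d a) x + (-1 : k) ^ i • left a (d x)
  leibniz_right : ∀ {i : ℤ} {x : carrier}, x ∈ gr i → ∀ a : A.carrier,
    d (right x a) = right (d x) a + (-1 : k) ^ i • right x (A.d a)

attribute [instance] DGBimodule.addCommGroup DGBimodule.module

namespace DGAlgebra

variable {k : Type u} [Field k] (A : DGAlgebra.{u, v} k)

/-- `a ↦ (-1) ^ (p * |a|) a`. -/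
def parity (p : ℤ) : A.carrier →ₗ[k] A.carrier :=
  degreeScale A.gr fun i => (-1) ^ (p * i)

/-- `a ↦ (-1) ^ (p * (|a| - 1)) a`, the sign of moving a symbol of degree `p` past `s a`. -/
def shiftSign (p : ℤ) : A.carrier →ₗ[k] A.carrier :=
  degreeScale A.gr fun i => (-1) ^ (p * (i - 1))

variable {A}

theorem parity_of_mem (p : ℤ) {i : ℤ} {a : A.carrier} (ha : a ∈ A.gr i) :
    A.parity p a = (-1 : k) ^ (p * i) • a := degreeScale_of_mem _ _ ha

theorem shiftSign_of_mem (p : ℤ) {i : ℤ} {a : A.carrier} (ha : a ∈ A.gr i) :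
    A.shiftSign p a = (-1 : k) ^ (p * (i - 1)) • a := degreeScale_of_mem _ _ ha

theorem induction_homogeneous {P : A.carrier → Prop} (a : A.carrier)
    (h0 : P 0) (hom : ∀ i, ∀ a ∈ A.gr i, P a) (add : ∀ a b, P a → P b → P (a + b)) : P a :=
  DirectSum.Decomposition.inductionOn A.gr h0 (fun {i} m => hom i m m.2) add a

theorem parity_one (p : ℤ) : A.parity p 1 = 1 := by
  rw [parity_of_mem p (SetLike.GradedOne.one_mem : (1 : A.carrier) ∈ A.gr 0)]; simp

theorem parity_mul (p : ℤ) (a b : A.carrier) :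
    A.parity p (a * b) = A.parity p a * A.parity p b := by
  induction a using induction_homogeneous with
  | h0 => simp
  | add a a' h h' => simp [add_mul, h, h']
  | hom i a ha =>
    induction b using induction_homogeneous with
    | h0 => simp
    | add b b' h h' => simp [mul_add, h, h']
    | hom j b hb =>
      rw [parity_of_mem p (SetLike.GradedMul.mul_mem ha hb), parity_of_mem p ha,
        parity_of_mem p hb, smul_mul_smul_comm, ← zpow_add₀ (by simp), mul_add]

theorem parity_mem (p : ℤ) {i : ℤ} {a : A.carrier} (ha : a ∈ A.gr i) : A.parity p a ∈ A.gr i := by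
  rw [parity_of_mem p ha]; exact Submodule.smul_mem _ _ ha

theorem neg_one_zpow_mul_self (n : ℤ) : (-1 : k) ^ n * (-1 : k) ^ n = 1 := by
  rw [← mul_zpow]; simp

theorem parity_parity (p : ℤ) (a : A.carrier) : A.parity p (A.parity p a) = a := by
  induction a using induction_homogeneous with
  | h0 => simp
  | add a a' h h' => simp [h, h']
  | hom i a ha =>
    rw [parity_of_mem p ha, map_smul, parity_of_mem p ha, smul_smul, neg_one_zpow_mul_self,
      one_smul]

theorem parity_d (p : ℤ) (a : A.carrier) :
    A.parity p (A.d a) = (-1 : k) ^ p • A.d (A.parity p a) := by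
  induction a using induction_homogeneous with
  | h0 => simp
  | add a a' h h' => rw [map_add, map_add, map_add, map_add, h, h', smul_add]
  | hom i a ha =>
    rw [parity_of_mem p ha, map_smul, parity_of_mem p (A.d_mem ha), smul_smul,
      ← zpow_add₀ (by simp)]
    congr 2; ring

variable (A)

/-- `A` as a differential graded bimodule over itself. -/
def regular : DGBimodule.{u, v, v} A where
  carrier := A.carrier
  gr := A.gr
  isInternal := DirectSum.Decomposition.isInternal A.gr
  d := A.d
  left := LinearMap.mul k A.carrier
  right := LinearMap.mul k A.carrier
  d_mem := A.d_mem
  left_mem ha hx := SetLike.GradedMul.mul_mem ha hx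
  right_mem hx ha := SetLike.GradedMul.mul_mem hx ha
  one_left := one_mul
  right_one := mul_one
  mul_left := mul_assoc
  right_mul x a b := (mul_assoc x a b).symm
  left_right := mul_assoc
  d_d := A.d_d
  leibniz_left := A.leibniz
  leibniz_right := A.leibniz

/-- The linear functionals of degree `j`, i.e. those which vanish on `A ^ i` for all `i ≠ -j`. -/
def dualPiece (j : ℤ) : Submodule k (Module.Dual k A.carrier) where
  carrier := {φ | ∀ i : ℤ, i + j ≠ 0 → ∀ a ∈ A.gr i, φ a = 0}
  zero_mem' := by simp
  add_mem' := by
    intro φ ψ hφ hψ i hi a ha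
    simp [hφ i hi a ha, hψ i hi a ha]
  smul_mem' := by
    intro c φ hφ i hi a ha
    simp [hφ i hi a ha]

/-- The graded dual: the sum of all the spaces of homogeneous functionals. -/
def gradedDual : Submodule k (Module.Dual k A.carrier) := ⨆ j, A.dualPiece j

/-- The functionals of degree `j`, as a subspace of the graded dual. -/
def gradedDualPiece (j : ℤ) : Submodule k A.gradedDual :=
  (A.dualPiece j).comap A.gradedDual.subtype

variable {A}

theorem dual_ext {φ ψ : Module.Dual k A.carrier} (h : ∀ i, ∀ a ∈ A.gr i, φ a = ψ a) : φ = ψ := by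
  ext a
  induction a using induction_homogeneous with
  | h0 => simp
  | add a a' h h' => simp [h, h']
  | hom i a ha => exact h i a ha

theorem dualPiece_le (j : ℤ) : A.dualPiece j ≤ A.gradedDual := le_iSup A.dualPiece j

theorem gradedDualPiece_iSupIndep : iSupIndep A.gradedDualPiece := by
  intro j
  rw [Submodule.disjoint_def]
  intro x hx hx'
  have key : (⨆ l, ⨆ (_ : l ≠ j), A.gradedDualPiece l) ≤
      { carrier := {x | ∀ a ∈ A.gr (-j), x.1 a = 0}
        zero_mem' := by simp
        add_mem' := by
          intro x y hx hy a ha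
          simp [hx a ha, hy a ha]
        smul_mem' := by
          intro c x hx a ha
          simp [hx a ha] } :=
    iSup₂_le fun l hl x hx a ha => hx (-j) (by omega) a ha
  have h2 := key hx'
  apply Subtype.ext
  apply dual_ext
  intro i a ha
  by_cases hi : i + j = 0
  · obtain rfl : i = -j := by omega
    simpa using h2 a ha
  · simpa using hx i hi a ha

theorem gradedDualPiece_iSup : iSup A.gradedDualPiece = ⊤ := by
  rw [eq_top_iff]
  rintro ⟨x, hx⟩ -
  refine Submodule.iSup_induction' (p := A.dualPiece)
    (motive := fun x hx => (⟨x, hx⟩ : A.gradedDual) ∈ iSup A.gradedDualPiece) ?_ ?_ ?_ hx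
  · intro j x hx
    exact Submodule.mem_iSup_of_mem (p := A.gradedDualPiece) j hx
  · exact Submodule.zero_mem _
  · intro x y hx hy h1 h2
    exact Submodule.add_mem _ h1 h2

/-- `(a φ)(x) = (-1) ^ (|a| (|φ| + |x|)) φ (x a)`; the sign equals `(-1) ^ |a|`, because
`φ (x a) = 0` unless `|φ| + |x| + |a| = 0`. -/
def dualLeft : A.carrier →ₗ[k] Module.Dual k A.carrier →ₗ[k] Module.Dual k A.carrier :=
  LinearMap.mk₂ k (fun a φ => φ ∘ₗ (LinearMap.mul k A.carrier).flip (A.parity 1 a))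
    (by intro a b φ; ext x; simp) (by intro c a φ; ext x; simp)
    (by intro a φ ψ; ext x; simp) (by intro c a φ; ext x; simp)

/-- `(φ a)(x) = φ (a x)`. -/
def dualRight : Module.Dual k A.carrier →ₗ[k] A.carrier →ₗ[k] Module.Dual k A.carrier :=
  LinearMap.mk₂ k (fun φ a => φ ∘ₗ LinearMap.mul k A.carrier a)
    (by intro φ ψ a; ext x; simp) (by intro c φ a; ext x; simp)
    (by intro φ a b; ext x; simp) (by intro c φ a; ext x; simp)

/-- `(d φ)(x) = -(-1) ^ |φ| φ (d x)`; the sign equals `(-1) ^ |x|`, because `φ (d x) = 0` unless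
`|φ| + |x| + 1 = 0`. -/
def dualD : Module.Dual k A.carrier →ₗ[k] Module.Dual k A.carrier :=
  LinearMap.lcomp k k (A.d ∘ₗ A.parity 1)

theorem dualLeft_apply (a : A.carrier) (φ : Module.Dual k A.carrier) (x : A.carrier) :
    dualLeft a φ x = φ (x * A.parity 1 a) := rfl

theorem dualRight_apply (φ : Module.Dual k A.carrier) (a x : A.carrier) :
    dualRight φ a x = φ (a * x) := rfl

theorem dualD_apply (φ : Module.Dual k A.carrier) (x : A.carrier) :
    dualD φ x = φ (A.d (A.parity 1 x)) := rfl

theorem dual_leibniz_left {i : ℤ} {a : A.carrier} (ha : a ∈ A.gr i)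
    (φ : Module.Dual k A.carrier) :
    dualD (dualLeft a φ) = dualLeft (A.d a) φ + (-1 : k) ^ i • dualLeft a (dualD φ) := by
  apply dual_ext
  intro j x hx
  have h2 : (-1 : k) ^ j * (-1 : k) ^ j = 1 := neg_one_zpow_mul_self j
  have h3 : (-1 : k) ^ i * (-1 : k) ^ i = 1 := neg_one_zpow_mul_self i
  have hxa : x * a ∈ A.gr (j + i) := SetLike.GradedMul.mul_mem hx ha
  have hn : (-1 : k) ≠ 0 := by simp
  simp only [LinearMap.add_apply, LinearMap.smul_apply, dualLeft_apply, dualD_apply,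
    parity_of_mem 1 ha, parity_of_mem 1 hx, parity_of_mem 1 (A.d_mem ha), parity_of_mem 1 hxa,
    A.leibniz hx, zpow_add₀ hn, one_mul, map_smul, mul_smul_comm, map_add, smul_eq_mul, zpow_one]
  linear_combination (-((-1 : k) ^ i) ^ 3 * φ (x * A.d a)) * h2 -
    ((-1 : k) ^ i * φ (x * A.d a) + (-1 : k) ^ j * (-1 : k) ^ i * φ (A.d x * a)) * h3

theorem dual_leibniz_right {i : ℤ} {φ : Module.Dual k A.carrier} (hφ : φ ∈ A.dualPiece i)
    (a : A.carrier) :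
    dualD (dualRight φ a) = dualRight (dualD φ) a + (-1 : k) ^ i • dualRight φ (A.d a) := by
  induction a using induction_homogeneous with
  | h0 => simp
  | add a b h h' => 
    simp only [map_add, h, h', smul_add]
    abel
  | hom l a ha =>
    apply dual_ext
    intro j x hx
    have hax : a * x ∈ A.gr (l + j) := SetLike.GradedMul.mul_mem ha hx
    have hn : (-1 : k) ≠ 0 := by simp
    have h2 : (-1 : k) ^ l * (-1 : k) ^ l = 1 := neg_one_zpow_mul_self l
    have key : (-1 : k) ^ l * (-1 : k) ^ j * φ (A.d a * x) + (-1) ^ i * φ (A.d a * x) = 0 := by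
      by_cases h : l + 1 + j + i = 0
      · obtain rfl : i = -(l + j) - 1 := by omega
        rw [zpow_sub₀ hn, zpow_neg, ← zpow_add₀ hn]
        rcases Int.even_or_odd (l + j) with h | h <;> simp [h.neg_one_zpow]
      · rw [hφ _ h _ (SetLike.GradedMul.mul_mem (A.d_mem ha) hx)]; simp
    simp only [LinearMap.add_apply, LinearMap.smul_apply, dualRight_apply, dualD_apply,
      parity_of_mem 1 hx, parity_of_mem 1 hax, one_mul,
      A.leibniz ha, zpow_add₀ hn, map_smul, map_add, smul_eq_mul]
    linear_combination (-(-1 : k) ^ j * φ (a * A.d x)) * h2 - key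

theorem dualLeft_mem {i j : ℤ} {a : A.carrier} {φ : Module.Dual k A.carrier} (ha : a ∈ A.gr i)
    (hφ : φ ∈ A.dualPiece j) : dualLeft a φ ∈ A.dualPiece (i + j) := fun l hl x hx =>
  hφ (l + i) (by omega) _ (SetLike.GradedMul.mul_mem hx (parity_mem 1 ha))

theorem dualRight_mem {i j : ℤ} {a : A.carrier} {φ : Module.Dual k A.carrier}
    (hφ : φ ∈ A.dualPiece i) (ha : a ∈ A.gr j) : dualRight φ a ∈ A.dualPiece (i + j) :=
  fun l hl x hx => hφ (j + l) (by omega) _ (SetLike.GradedMul.mul_mem ha hx)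

theorem dualD_mem {i : ℤ} {φ : Module.Dual k A.carrier}
    (hφ : φ ∈ A.dualPiece i) : dualD φ ∈ A.dualPiece (i + 1) :=
  fun l hl x hx => hφ (l + 1) (by omega) _ (A.d_mem (parity_mem 1 hx))

theorem dualLeft_mem' (a : A.carrier) {φ : Module.Dual k A.carrier} (hφ : φ ∈ A.gradedDual) :
    dualLeft a φ ∈ A.gradedDual := by
  refine Submodule.iSup_induction A.dualPiece (motive := fun φ => dualLeft a φ ∈ A.gradedDual)
    hφ (fun j φ hφ => ?_) (by simp) (fun φ ψ h h' => by
      rw [map_add]; exact Submodule.add_mem _ h h')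
  induction a using induction_homogeneous with
  | h0 => simp
  | add a b h h' => rw [map_add]; exact Submodule.add_mem _ h h'
  | hom i a ha => exact dualPiece_le _ (dualLeft_mem ha hφ)

theorem dualRight_mem' {φ : Module.Dual k A.carrier} (hφ : φ ∈ A.gradedDual) (a : A.carrier) :
    dualRight φ a ∈ A.gradedDual := by
  refine Submodule.iSup_induction A.dualPiece (motive := fun φ => dualRight φ a ∈ A.gradedDual)
    hφ (fun j φ hφ => ?_) (by simp) (fun φ ψ h h' => by
      rw [map_add]; exact Submodule.add_mem _ h h')
  induction a using induction_homogeneous with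
  | h0 => simp
  | add a b h h' => rw [map_add]; exact Submodule.add_mem _ h h'
  | hom i a ha => exact dualPiece_le _ (dualRight_mem hφ ha)

theorem dualD_mem' {φ : Module.Dual k A.carrier} (hφ : φ ∈ A.gradedDual) :
    dualD φ ∈ A.gradedDual :=
  Submodule.iSup_induction A.dualPiece (motive := fun φ => dualD φ ∈ A.gradedDual)
    hφ (fun j φ hφ => dualPiece_le _ (dualD_mem hφ)) (by simp) (fun φ ψ h h' => by
      rw [map_add]; exact Submodule.add_mem _ h h')

variable (A)

/-- The dual bimodule `A^∨ = Hom(A, k)` (graded dual). -/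
def dual : DGBimodule.{u, v, max u v} A where
  carrier := A.gradedDual
  gr := A.gradedDualPiece
  isInternal := DirectSum.isInternal_submodule_of_iSupIndep_of_iSup_eq_top
    gradedDualPiece_iSupIndep gradedDualPiece_iSup
  d := dualD.restrict fun _ h => dualD_mem' h
  left := LinearMap.mk₂ k (fun a φ => ⟨dualLeft a φ.1, dualLeft_mem' a φ.2⟩)
    (by intro a b φ; ext x; simp) (by intro c a φ; ext x; simp)
    (by intro a φ ψ; ext x; simp) (by intro c a φ; ext x; simp)
  right := LinearMap.mk₂ k (fun φ a => ⟨dualRight φ.1 a, dualRight_mem' φ.2 a⟩)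
    (by intro φ ψ a; ext x; simp) (by intro c φ a; ext x; simp)
    (by intro φ a b; ext x; simp) (by intro c φ a; ext x; simp)
  d_mem h := dualD_mem h
  left_mem ha hx := dualLeft_mem ha hx
  right_mem hx ha := dualRight_mem hx ha
  one_left φ := by ext x; simp [dualLeft_apply, parity_one]
  right_one φ := by ext x; simp [dualRight_apply]
  mul_left a b φ := by ext x; simp [dualLeft_apply, parity_mul, mul_assoc]
  right_mul φ a b := by ext x; simp [dualRight_apply, mul_assoc]
  left_right a φ b := by ext x; simp [dualRight_apply, dualLeft_apply, mul_assoc]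
  d_d φ := by
    ext x
    simp [dualD_apply, parity_d, A.d_d]
  leibniz_left ha φ := Subtype.ext (dual_leibniz_left ha φ.1)
  leibniz_right hφ a := Subtype.ext (dual_leibniz_right hφ a)

end DGAlgebra

namespace DGBimodule

variable {k : Type u} [Field k] {A : DGAlgebra.{u, v} k}

/-- The shift `M[n]`, with `M[n] ^ j = M ^ (j + n)`, differential `(-1) ^ n d`, left action
`(-1) ^ (n |a|) a x` and unchanged right action. -/
def shift (M : DGBimodule.{u, v, w} A) (n : ℤ) : DGBimodule.{u, v, w} A where
  carrier := M.carrier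
  gr j := M.gr (j + n)
  isInternal := DirectSum.isInternal_submodule_of_iSupIndep_of_iSup_eq_top
    (M.isInternal.submodule_iSupIndep.comp (add_left_injective n))
    (((Equiv.addRight n).iSup_comp (g := M.gr)).trans M.isInternal.submodule_iSup_eq_top)
  d := (-1 : k) ^ n • M.d
  left := M.left ∘ₗ A.parity n
  right := M.right
  d_mem {i x} hx := by
    have h := M.d_mem hx
    rw [show i + n + 1 = i + 1 + n by ring] at h
    exact Submodule.smul_mem _ _ h
  left_mem {i j a x} ha hx := by
    have h := M.left_mem (DGAlgebra.parity_mem n ha) hx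
    rwa [show i + (j + n) = i + j + n by ring] at h
  right_mem {i j x a} hx ha := by
    have h := M.right_mem hx ha
    rwa [show i + n + j = i + j + n by ring] at h
  one_left x := by simp [DGAlgebra.parity_one, M.one_left]
  right_one := M.right_one
  mul_left a b x := by simp [DGAlgebra.parity_mul, M.mul_left]
  right_mul := M.right_mul
  left_right a x b := M.left_right _ x b
  d_d x := by simp [M.d_d]
  leibniz_left {i a} ha x := by
    have h := M.leibniz_left (DGAlgebra.parity_mem n ha) x
    have h2 := DGAlgebra.parity_d n a
    simp only [LinearMap.smul_apply, LinearMap.comp_apply, h, h2, map_smul, smul_add,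
      smul_smul]
    congr 2
    ring
  leibniz_right {i x} hx a := by
    have h := M.leibniz_right hx a
    simp only [LinearMap.smul_apply, h, map_smul, smul_add, smul_smul]
    rw [zpow_add₀ (by simp), mul_comm, mul_assoc, DGAlgebra.neg_one_zpow_mul_self, mul_one]

/-- A morphism of differential graded bimodules (of degree zero). -/
structure Hom (N : DGBimodule.{u, v, w} A) (M : DGBimodule.{u, v, w'} A) where
  toLinearMap : N.carrier →ₗ[k] M.carrier
  map_mem : ∀ {i : ℤ} {x : N.carrier}, x ∈ N.gr i → toLinearMap x ∈ M.gr i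
  map_d : ∀ x : N.carrier, toLinearMap (N.d x) = M.d (toLinearMap x)
  map_left : ∀ (a : A.carrier) (x : N.carrier),
    toLinearMap (N.left a x) = M.left a (toLinearMap x)
  map_right : ∀ (x : N.carrier) (a : A.carrier),
    toLinearMap (N.right x a) = M.right (toLinearMap x) a

/-- A morphism is a quasi-isomorphism if it is injective and surjective on cohomology. -/
def Hom.IsQuasiIso {N : DGBimodule.{u, v, w} A} {M : DGBimodule.{u, v, w'} A}
    (f : Hom N M) : Prop :=
  ∀ j : ℤ,
    (∀ x ∈ N.gr j, N.d x = 0 → (∃ z ∈ M.gr (j - 1), M.d z = f.toLinearMap x) →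
      ∃ z ∈ N.gr (j - 1), N.d z = x) ∧
    (∀ y ∈ M.gr j, M.d y = 0 →
      ∃ x ∈ N.gr j, N.d x = 0 ∧ ∃ z ∈ M.gr (j - 1), M.d z = y - f.toLinearMap x)

/-! ### The normalized Hochschild cochain complex `C^*(A, M) = Hom(T(s(A/k)), M)` -/

/-- `f` is a normalized Hochschild cochain of degree `p`.  The value of `f` on the list
`[a₁, …, aₙ]` is `f(a₁, …, aₙ)`; `f` is multilinear, vanishes when some `aᵢ` is a scalar, and has
degree `p` as a map from `T(s(A/k))` to `M`. -/
structure IsCochain (M : DGBimodule.{u, v, w} A) (p : ℤ) (f : List A.carrier → M.carrier) :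
    Prop where
  map_add : ∀ (l : List A.carrier) (a b : A.carrier) (r : List A.carrier),
    f (l ++ (a + b) :: r) = f (l ++ a :: r) + f (l ++ b :: r)
  map_smul : ∀ (l : List A.carrier) (c : k) (a : A.carrier) (r : List A.carrier),
    f (l ++ (c • a) :: r) = c • f (l ++ a :: r)
  normalized : ∀ l r : List A.carrier, f (l ++ 1 :: r) = 0
  homogeneous : ∀ (L : List A.carrier) (e : List ℤ), List.Forall₂ (fun a i => a ∈ A.gr i) L e →
    f L ∈ M.gr (p + (e.map fun i => i - 1).sum)

/-- The space `C^p(A, M)` of normalized Hochschild cochains of (total) degree `p`. -/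
def cochains (M : DGBimodule.{u, v, w} A) (p : ℤ) :
    Submodule k (List A.carrier → M.carrier) where
  carrier := {f | M.IsCochain p f}
  zero_mem' := ⟨by simp, by simp, by simp, by simp⟩
  add_mem' := by
    intro f g hf hg
    refine ⟨fun l a b r => ?_, fun l c a r => ?_, fun l r => ?_, fun L e h => ?_⟩
    · simp only [Pi.add_apply, hf.map_add, hg.map_add]; abel
    · simp only [Pi.add_apply, hf.map_smul, hg.map_smul, smul_add]
    · simp only [Pi.add_apply, hf.normalized, hg.normalized, add_zero]
    · exact Submodule.add_mem _ (hf.homogeneous L e h) (hg.homogeneous L e h)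
  smul_mem' := by
    intro s f hf
    refine ⟨fun l a b r => ?_, fun l c a r => ?_, fun l r => ?_, fun L e h => ?_⟩
    · simp only [Pi.smul_apply, hf.map_add, smul_add]
    · simp only [Pi.smul_apply, hf.map_smul, smul_comm s c]
    · simp only [Pi.smul_apply, hf.normalized, smul_zero]
    · exact Submodule.smul_mem _ _ (hf.homogeneous L e h)

/-- `(-1) ^ (|s a₁| + ⋯ + |s aᵢ|) f(a₁, …, aᵢ, d aᵢ₊₁, aᵢ₊₂, …, aₙ)` for `L = [a₁, …, aₙ]`. -/
def dAt (M : DGBimodule.{u, v, w} A) (f : List A.carrier → M.carrier) (L : List A.carrier)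
    (i : ℕ) : M.carrier :=
  match L.drop i with
  | [] => 0
  | a :: r => f ((L.take i).map (A.shiftSign 1) ++ A.d a :: r)

/-- `(-1) ^ (|s a₁| + ⋯ + |s aᵢ₊₁|) f(a₁, …, aᵢ, aᵢ₊₁ aᵢ₊₂, aᵢ₊₃, …, aₙ)` for
`L = [a₁, …, aₙ]`. -/
def mulAt (M : DGBimodule.{u, v, w} A) (f : List A.carrier → M.carrier) (L : List A.carrier)
    (i : ℕ) : M.carrier :=
  match L.drop i with
  | a :: b :: r => f ((L.take i).map (A.shiftSign 1) ++ (A.shiftSign 1 a * b) :: r)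
  | _ => 0

/-- `(-1) ^ (p |s a₁|) a₁ f(a₂, …, aₙ)` for `L = [a₁, …, aₙ]`. -/
def leftEnd (M : DGBimodule.{u, v, w} A) (p : ℤ) (f : List A.carrier → M.carrier)
    (L : List A.carrier) : M.carrier :=
  match L with
  | [] => 0
  | a :: r => M.left (A.shiftSign p a) (f r)

/-- `(-1) ^ (|s a₁| + ⋯ + |s aₙ₋₁|) f(a₁, …, aₙ₋₁) aₙ` for `L = [a₁, …, aₙ]`. -/
def rightEnd (M : DGBimodule.{u, v, w} A) (f : List A.carrier → M.carrier)
    (L : List A.carrier) : M.carrier :=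
  match L.getLast? with
  | none => 0
  | some b => M.right (f (L.dropLast.map (A.shiftSign 1))) b

/-- The Hochschild differential `D = d₀ + d₁` on cochains of degree `p`; the first two terms form
the internal differential `d₀`, the other three the external differential `d₁`. -/
def diff (M : DGBimodule.{u, v, w} A) (p : ℤ) :
    (List A.carrier → M.carrier) →ₗ[k] (List A.carrier → M.carrier) where
  toFun f L := M.d (f L) + (-1 : k) ^ p • (∑ i ∈ Finset.range L.length, M.dAt f L i) -
    M.leftEnd p f L - (-1 : k) ^ p • (∑ i ∈ Finset.range (L.length - 1), M.mulAt f L i) +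
    (-1 : k) ^ p • M.rightEnd f L
  map_add' f g := by
    have h1 : ∀ L i, M.dAt (f + g) L i = M.dAt f L i + M.dAt g L i := by
      intro L i; unfold dAt; split <;> simp
    have h2 : ∀ L i, M.mulAt (f + g) L i = M.mulAt f L i + M.mulAt g L i := by
      intro L i; unfold mulAt; split <;> simp
    have h3 : ∀ L, M.leftEnd p (f + g) L = M.leftEnd p f L + M.leftEnd p g L := by
      intro L; unfold leftEnd; split <;> simp
    have h4 : ∀ L, M.rightEnd (f + g) L = M.rightEnd f L + M.rightEnd g L := by
      intro L; unfold rightEnd; split <;> simp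
    funext L
    simp only [h1, h2, h3, h4, Pi.add_apply, _root_.map_add, Finset.sum_add_distrib, smul_add]
    abel
  map_smul' c f := by
    have h1 : ∀ L i, M.dAt (c • f) L i = c • M.dAt f L i := by
      intro L i; unfold dAt; split <;> simp
    have h2 : ∀ L i, M.mulAt (c • f) L i = c • M.mulAt f L i := by
      intro L i; unfold mulAt; split <;> simp
    have h3 : ∀ L, M.leftEnd p (c • f) L = c • M.leftEnd p f L := by
      intro L; unfold leftEnd; split <;> simp
    have h4 : ∀ L, M.rightEnd (c • f) L = c • M.rightEnd f L := by
      intro L; unfold rightEnd; split <;> simp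
    funext L
    simp only [h1, h2, h3, h4, Pi.smul_apply, _root_.map_smul, ← Finset.smul_sum, smul_add,
      smul_sub, smul_comm _ c, RingHom.id_apply]

/-- Hochschild cocycles of degree `p`. -/
def cocycles (M : DGBimodule.{u, v, w} A) (p : ℤ) : Submodule k (List A.carrier → M.carrier) :=
  M.cochains p ⊓ LinearMap.ker (M.diff p)

/-- Hochschild coboundaries of degree `p`. -/
def coboundaries (M : DGBimodule.{u, v, w} A) (p : ℤ) :
    Submodule k (List A.carrier → M.carrier) :=
  (M.cochains (p - 1)).map (M.diff (p - 1))

/-- The Hochschild cohomology `HH^p(A, M)`: cocycles modulo coboundaries. -/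
abbrev HH (M : DGBimodule.{u, v, w} A) (p : ℤ) : Type (max v w) :=
  M.cocycles p ⧸ (M.coboundaries p).comap (M.cocycles p).subtype

/-- The class of a cocycle. -/
def cls (M : DGBimodule.{u, v, w} A) {p : ℤ} (f : M.cocycles p) : M.HH p :=
  Submodule.Quotient.mk f

end DGBimodule

/-! ### Operations on Hochschild cochains -/

namespace DGAlgebra

variable {k : Type u} [Field k] (A : DGAlgebra.{u, v} k)

/-- The cup product with a cochain `y` of degree `q`: the value on `(a₁, …, aₙ)` is
`∑ᵢ (-1) ^ (q (|s a₁| + ⋯ + |s aᵢ|)) x(a₁, …, aᵢ) y(aᵢ₊₁, …, aₙ)`. -/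
def cup (q : ℤ) (x y : List A.carrier → A.carrier) : List A.carrier → A.carrier := fun L =>
  ∑ i ∈ Finset.range (L.length + 1), x ((L.take i).map (A.shiftSign q)) * y (L.drop i)

/-- The composition `x ∘ y` with a cochain `y` of degree `q`: the value on `(a₁, …, aₙ)` is
`∑ (-1) ^ ((q + 1) (|s a₁| + ⋯ + |s aᵢ|)) x(a₁, …, aᵢ, y(aᵢ₊₁, …, aᵢ₊ⱼ), aᵢ₊ⱼ₊₁, …, aₙ)`,
where the sum is over all `i, j ≥ 0` with `i + j ≤ n`. -/
def circ (q : ℤ) (x y : List A.carrier → A.carrier) : List A.carrier → A.carrier := fun L =>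
  ∑ i ∈ Finset.range (L.length + 1), ∑ j ∈ Finset.range (L.length - i + 1),
    x ((L.take i).map (A.shiftSign (q + 1)) ++ y ((L.drop i).take j) :: (L.drop i).drop j)

/-- The Gerstenhaber bracket of cochains `x`, `y` of degrees `p`, `q`. -/
def gerstenhaberBracket (p q : ℤ) (x y : List A.carrier → A.carrier) :
    List A.carrier → A.carrier :=
  A.circ q x y - (-1 : k) ^ ((p + 1) * (q + 1)) • A.circ p y x

/-- `C^*(A, A^∨) = Hom(T(s(A/k)), A^∨)` is identified with `Hom(A ⊗ T(s(A/k)), k)` by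
`φ(a₀[a₁, …, aₙ]) = (-1) ^ (|a₀| (|s a₁| + ⋯ + |s aₙ|)) φ(a₁, …, aₙ)(a₀)`.  This is the number
`φ(a₀[a₁, …, aₙ])` for homogeneous `a₀` of degree `e₀` and `aᵢ` of degree `eᵢ`. -/
def pairing (φ : List A.carrier → A.gradedDual) (e₀ : ℤ) (a₀ : A.carrier) (e : List ℤ)
    (L : List A.carrier) : k :=
  (-1 : k) ^ (e₀ * (e.map fun i => i - 1).sum) * (φ L).1 a₀

/-- `χ` is the image of the cochain `φ` of degree `p` under the dual Connes operator `B^∨`, i.e.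
`χ(a₀[a₁, …, aₙ]) = (-1) ^ p φ(B(a₀[a₁, …, aₙ]))`, where
`B(a₀[a₁, …, aₙ]) = ∑_{i = 0}^{n}
  (-1) ^ ((|s a₀| + ⋯ + |s aᵢ|) (|s aᵢ₊₁| + ⋯ + |s aₙ|)) 1[aᵢ₊₁, …, aₙ, a₀, a₁, …, aᵢ]`. -/
def IsConnesDual (p : ℤ) (φ χ : List A.carrier → A.gradedDual) : Prop :=
  ∀ (e₀ : ℤ) (a₀ : A.carrier) (e : List ℤ) (L : List A.carrier), a₀ ∈ A.gr e₀ →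
    List.Forall₂ (fun a i => a ∈ A.gr i) L e →
    A.pairing χ e₀ a₀ e L = (-1 : k) ^ p * ∑ i ∈ Finset.range (L.length + 1),
      (-1 : k) ^ (((e₀ - 1) + ((e.take i).map fun j => j - 1).sum) *
          ((e.drop i).map fun j => j - 1).sum) *
        A.pairing φ 0 1 (e.drop i ++ e₀ :: e.take i) (L.drop i ++ a₀ :: L.take i)

end DGAlgebra

/-! ### Gerstenhaber and Batalin–Vilkovisky algebras -/

/-- A Gerstenhaber algebra structure on the graded vector space `H`: an associative graded
commutative product of degree `0` and a bracket of degree `-1`. -/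
structure GerstenhaberAlgebra (k : Type u) [Field k] (H : ℤ → Type w) [∀ p, AddCommGroup (H p)]
    [∀ p, Module k (H p)] where
  mul : ∀ p q r : ℤ, p + q = r → (H p →ₗ[k] H q →ₗ[k] H r)
  bracket : ∀ p q r : ℤ, p + q = r + 1 → (H p →ₗ[k] H q →ₗ[k] H r)
  mul_assoc : ∀ (p q r pq qr pqr : ℤ) (h₁ : p + q = pq) (h₂ : pq + r = pqr) (h₃ : q + r = qr)
    (h₄ : p + qr = pqr) (x : H p) (y : H q) (z : H r),
    mul pq r pqr h₂ (mul p q pq h₁ x y) z = mul p qr pqr h₄ x (mul q r qr h₃ y z)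
  mul_comm : ∀ (p q r : ℤ) (h : p + q = r) (h' : q + p = r) (x : H p) (y : H q),
    mul p q r h x y = (-1 : k) ^ (p * q) • mul q p r h' y x
  bracket_mul : ∀ (p q r qr pq pr s : ℤ) (h₁ : q + r = qr) (h₂ : p + qr = s + 1)
    (h₃ : p + q = pq + 1) (h₄ : pq + r = s) (h₅ : p + r = pr + 1) (h₆ : q + pr = s)
    (x : H p) (y : H q) (z : H r),
    bracket p qr s h₂ x (mul q r qr h₁ y z) =
      mul pq r s h₄ (bracket p q pq h₃ x y) z +
        (-1 : k) ^ ((p - 1) * q) • mul q pr s h₆ y (bracket p r pr h₅ x z)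
  bracket_antisymm : ∀ (p q r : ℤ) (h : p + q = r + 1) (h' : q + p = r + 1) (x : H p) (y : H q),
    bracket p q r h x y = -((-1 : k) ^ ((p - 1) * (q - 1)) • bracket q p r h' y x)
  jacobi : ∀ (p q r pq qr pr s : ℤ) (h₁ : p + q = pq + 1) (h₂ : pq + r = s + 1)
    (h₃ : q + r = qr + 1) (h₄ : p + qr = s + 1) (h₅ : p + r = pr + 1) (h₆ : q + pr = s + 1)
    (x : H p) (y : H q) (z : H r),
    bracket pq r s h₂ (bracket p q pq h₁ x y) z =
      bracket p qr s h₄ x (bracket q r qr h₃ y z) -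
        (-1 : k) ^ ((p - 1) * (q - 1)) • bracket q pr s h₆ y (bracket p r pr h₅ x z)

/-- A Batalin–Vilkovisky algebra: a Gerstenhaber algebra with an operator `Δ` of square zero, of
the degree `-1` of the bracket, such that
`[a, b] = (-1) ^ |a| Δ(ab) - (-1) ^ |a| Δ(a) b - a Δ(b)`. -/
structure BVAlgebra (k : Type u) [Field k] (H : ℤ → Type w) [∀ p, AddCommGroup (H p)]
    [∀ p, Module k (H p)] extends GerstenhaberAlgebra k H where
  Δ : ∀ p q : ℤ, q + 1 = p → (H p →ₗ[k] H q)
  Δ_Δ : ∀ (p q r : ℤ) (h : q + 1 = p) (h' : r + 1 = q) (x : H p), Δ q r h' (Δ p q h x) = 0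
  bracket_eq : ∀ (p q pq p' q' r : ℤ) (h₁ : p + q = r + 1) (h₂ : p + q = pq) (h₃ : r + 1 = pq)
    (h₄ : p' + 1 = p) (h₅ : p' + q = r) (h₆ : q' + 1 = q) (h₇ : p + q' = r) (x : H p) (y : H q),
    bracket p q r h₁ x y =
      (-1 : k) ^ p • Δ pq r h₃ (mul p q pq h₂ x y) -
        (-1 : k) ^ p • mul p' q r h₅ (Δ p p' h₄ x) y - mul p q' r h₇ x (Δ q q' h₆ y)

/-- The product and the bracket of `G` are those which the cup product and the Gerstenhaber
bracket of cochains induce on `HH^*(A, A)`. -/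
def GerstenhaberAlgebra.IsHochschild {k : Type u} [Field k] {A : DGAlgebra.{u, v} k}
    (G : GerstenhaberAlgebra k A.regular.HH) : Prop :=
  (∀ (p q r : ℤ) (h : p + q = r) (x : A.regular.cocycles p) (y : A.regular.cocycles q),
    ∃ z : A.regular.cocycles r, z.1 = A.cup q x.1 y.1 ∧
      G.mul p q r h (A.regular.cls x) (A.regular.cls y) = A.regular.cls z) ∧
  (∀ (p q r : ℤ) (h : p + q = r + 1) (x : A.regular.cocycles p) (y : A.regular.cocycles q),
    ∃ z : A.regular.cocycles r, z.1 = A.gerstenhaberBracket p q x.1 y.1 ∧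
      G.bracket p q r h (A.regular.cls x) (A.regular.cls y) = A.regular.cls z)

/-- The maps `B : HH^p(A, A^∨) → HH^(p-1)(A, A^∨)` are induced by the dual Connes operator. -/
def IsConnesOnHH {k : Type u} [Field k] {A : DGAlgebra.{u, v} k}
    (B : ∀ p q : ℤ, q + 1 = p → (A.dual.HH p →ₗ[k] A.dual.HH q)) : Prop :=
  ∀ (p q : ℤ) (h : q + 1 = p) (φ : A.dual.cocycles p),
    ∃ χ : A.dual.cocycles q, A.IsConnesDual p φ.1 χ.1 ∧
      B p q h (A.dual.cls φ) = A.dual.cls χ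

/-- The isomorphisms `D : HH^(p+n)(A, A^∨) → HH^p(A, A)` are induced by the morphism
`m : A → A^∨[n]`, i.e. `D⁻¹[f] = (-1) ^ ((n + 1) p) [m ∘ f]`.  With `t = m(1)`, the cochain on the
right is `a₀[a₁, …, aᵣ] ↦ (-1) ^ (p (|s a₁| + ⋯ + |s aᵣ|)) t(a₀ f(a₁, …, aᵣ))`, the cap product of
`f` with the class of `t`. -/
def IsInducedBy {k : Type u} [Field k] {A : DGAlgebra.{u, v} k} {n : ℤ}
    (m : DGBimodule.Hom A.regular (A.dual.shift n))
    (D : ∀ p q : ℤ, p + n = q → (A.dual.HH q ≃ₗ[k] A.regular.HH p)) : Prop :=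
  ∀ (p q : ℤ) (h : p + n = q) (f : A.regular.cocycles p),
    ∃ φ : A.dual.cocycles q,
      φ.1 = (fun L => (-1 : k) ^ ((n + 1) * p) • m.toLinearMap (f.1 L)) ∧
      (D p q h).symm (A.regular.cls f) = A.dual.cls φ

end HochschildBV

end

/-! Combinatorics and signs are separated. Every formula is a sum over the cuts of a word
(`splitSum`, `split3`), and the Koszul sign of moving a symbol past letters is a linear operator on
those letters (`shiftSign`, `tw`), so that most identities need no homogeneous letters. The
differential and the product of A are merged into one function `mu` on words of length one and two,
with mu ∘ mu = 0 (`ins_mu_mu`). The Hochschild differential then consists of insertions of `mu` and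
cup products with the identity `iota`; on C(A, A) it is the bracket with `mu`.

Gerstenhaber structure. Insertion satisfies the pre-Lie identity (`ins_ins`), which yields the
Jacobi identity. The differential of x ∘ y contains the graded commutator of the cup product
(`hochschildDiff_ins`), so the product is commutative on cohomology and the bracket descends. The
double insertion x{y, z}, the sum of ± x(…, y(…), …, z(…), …), is the homotopy that makes the
bracket a derivation of the product (`hochschildDiff_insMid_insAfter`).

Duality. The cone of a quasi-isomorphism is acyclic, hence contractible over a field. Solving for a
primitive one word length at a time shows that the Hochschild complex of an acyclic bimodule is
acyclic (`exists_diff_eq_of_contraction`). Thus m induces isomorphisms on Hochschild cohomology.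

BV identity. The functional t = m(1) is a closed graded trace and m(a)(x) = t(ax). The dual Connes
operator is a cyclic sum. Applied to m(y ∪ x) it is a sum of two pairings, of the form t(y(U, b, V)
x(W)), according to whether the marked letter b falls into y or into x (`IsTrace.cycSum_cup`). The
cyclic sum of t(y(U, b, …, x(…), …)) has a coboundary which expresses such a pairing through m(y ∘
x) and x ∪ B(m y) (`Hom.exists_cycPair_eq`). Adding the two pairings gives the bracket and both
terms with B (`Hom.connes_cup`), and injectivity of m on cohomology carries the identity back to
HH(A, A). -/

set_option linter.unusedSectionVars false

noncomputable section

namespace HochschildBV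

/-! ### Sums over the decompositions of a list -/

section Splitting

variable {α : Type*} {V : Type*} [AddCommGroup V]

/-- The sum of `F P Q` over all decompositions `L = P ++ Q`. -/
def splitSum (F : List α → List α → V) : List α → V
  | [] => F [] []
  | a :: L => F [] (a :: L) + splitSum (fun P Q => F (a :: P) Q) L

/-- The sum of `F P Q R` over all decompositions `L = P ++ Q ++ R`. -/
def split3 (F : List α → List α → List α → V) (L : List α) : V :=
  splitSum (fun P M => splitSum (fun Q R => F P Q R) M) L

@[simp] theorem splitSum_nil (F : List α → List α → V) : splitSum F [] = F [] [] := rfl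

theorem splitSum_cons (F : List α → List α → V) (a : α) (L : List α) :
    splitSum F (a :: L) = F [] (a :: L) + splitSum (fun P Q => F (a :: P) Q) L := rfl

theorem splitSum_eq_sum (F : List α → List α → V) (L : List α) :
    splitSum F L = ∑ i ∈ Finset.range (L.length + 1), F (L.take i) (L.drop i) := by
  induction L generalizing F with
  | nil => simp
  | cons a L ih => rw [splitSum_cons, ih, List.length_cons, Finset.sum_range_succ' _ (L.length + 1)]; simp [add_comm]

theorem splitSum_congr {F G : List α → List α → V} {L : List α}
    (h : ∀ P Q, P ++ Q = L → F P Q = G P Q) : splitSum F L = splitSum G L := by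
  rw [splitSum_eq_sum, splitSum_eq_sum]
  exact Finset.sum_congr rfl fun i _ => h _ _ (List.take_append_drop i L)

theorem split3_congr {F G : List α → List α → List α → V} {L : List α}
    (h : ∀ P Q R, P ++ (Q ++ R) = L → F P Q R = G P Q R) : split3 F L = split3 G L :=
  splitSum_congr fun P M hM => splitSum_congr fun Q R hR => h P Q R (by rw [hR, hM])

theorem splitSum_mem {S : Type*} [SetLike S V] [AddSubmonoidClass S V] (W : S)
    {F : List α → List α → V} {L : List α}
    (h : ∀ P Q, P ++ Q = L → F P Q ∈ W) : splitSum F L ∈ W := by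
  rw [splitSum_eq_sum]
  exact sum_mem fun i _ => h _ _ (List.take_append_drop i L)

theorem splitSum_add (F G : List α → List α → V) (L : List α) :
    splitSum (fun P Q => F P Q + G P Q) L = splitSum F L + splitSum G L := by
  simp only [splitSum_eq_sum, Finset.sum_add_distrib]

theorem splitSum_sub (F G : List α → List α → V) (L : List α) :
    splitSum (fun P Q => F P Q - G P Q) L = splitSum F L - splitSum G L := by
  simp only [splitSum_eq_sum, Finset.sum_sub_distrib]

theorem splitSum_neg (F : List α → List α → V) (L : List α) :
    splitSum (fun P Q => -F P Q) L = -splitSum F L := by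
  simp only [splitSum_eq_sum, Finset.sum_neg_distrib]

@[simp] theorem splitSum_zero (L : List α) : splitSum (fun _ _ => (0 : V)) L = 0 := by
  simp [splitSum_eq_sum]

theorem splitSum_eq_zero {F : List α → List α → V} {L : List α}
    (h : ∀ P Q, P ++ Q = L → F P Q = 0) : splitSum F L = 0 :=
  (splitSum_congr h).trans (splitSum_zero L)

theorem map_splitSum {W : Type*} [AddCommGroup W] {H : Type*} [FunLike H V W]
    [AddMonoidHomClass H V W] (φ : H) (F : List α → List α → V) (L : List α) :
    φ (splitSum F L) = splitSum (fun P Q => φ (F P Q)) L := by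
  simp only [splitSum_eq_sum, map_sum]

theorem splitSum_smul {k : Type*} [Monoid k] [DistribMulAction k V] (c : k)
    (F : List α → List α → V) (L : List α) :
    splitSum (fun P Q => c • F P Q) L = c • splitSum F L := by
  simp only [splitSum_eq_sum, Finset.smul_sum]

theorem splitSum_comm (F : List α → List α → List α → List α → V) (L L' : List α) :
    splitSum (fun P Q => splitSum (fun P' Q' => F P Q P' Q') L') L =
      splitSum (fun P' Q' => splitSum (fun P Q => F P Q P' Q') L) L' := by
  simp only [splitSum_eq_sum]
  exact Finset.sum_comm

theorem splitSum_append_cons (F : List α → List α → V) (P : List α) (b : α) (Q : List α) :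
    splitSum F (P ++ b :: Q) = splitSum (fun P₁ P₂ => F P₁ (P₂ ++ b :: Q)) P +
      splitSum (fun Q₁ Q₂ => F (P ++ b :: Q₁) Q₂) Q := by
  induction P generalizing F with
  | nil => simp [splitSum_cons]
  | cons a P ih => simp [splitSum_cons, ih, add_assoc]

theorem splitSum_concat (F : List α → List α → V) (P : List α) (b : α) :
    splitSum F (P ++ [b]) = splitSum (fun P₁ P₂ => F P₁ (P₂ ++ [b])) P + F (P ++ [b]) [] := by
  simp [splitSum_append_cons]

theorem splitSum_map (φ : α → α) (F : List α → List α → V) (L : List α) :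
    splitSum F (L.map φ) = splitSum (fun P Q => F (P.map φ) (Q.map φ)) L := by
  induction L generalizing F with
  | nil => simp
  | cons a L ih => simp [splitSum_cons, ih]

/-- Coassociativity of deconcatenation: both sides run over the ways of cutting the word twice. -/
theorem splitSum_assoc (F : List α → List α → List α → V) (L : List α) :
    splitSum (fun M R => splitSum (fun P Q => F P Q R) M) L = split3 F L := by
  unfold split3
  induction L generalizing F with
  | nil => simp
  | cons a L ih =>
    simp only [splitSum_cons, splitSum_nil, splitSum_add, ih, add_assoc]

/-- Splitting off one letter at the left end. -/
theorem splitSum_head (F : List α → List α → V) (hF : ∀ P Q, P.length ≠ 1 → F P Q = 0)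
    (a : α) (L : List α) : splitSum F (a :: L) = F [a] L := by
  rw [splitSum_cons, hF [] _ (by simp), zero_add]
  cases L with
  | nil => rfl
  | cons b L =>
    rw [splitSum_cons, splitSum_eq_zero fun P Q _ => hF _ _ (by simp), add_zero]

/-- Splitting off one letter at the right end. -/
theorem splitSum_last (F : List α → List α → V) (hF : ∀ P Q, Q.length ≠ 1 → F P Q = 0)
    (L : List α) (a : α) : splitSum F (L ++ [a]) = F L [a] := by
  rw [splitSum_concat, hF _ [] (by simp), add_zero]
  induction L using List.reverseRecOn with
  | nil => rfl
  | append_singleton L b _ =>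
    rw [splitSum_concat, splitSum_eq_zero fun P Q _ => hF _ _ (by simp), zero_add,
      List.nil_append]

theorem split3_add (F G : List α → List α → List α → V) (L : List α) :
    split3 (fun P Q R => F P Q R + G P Q R) L = split3 F L + split3 G L := by
  simp only [split3, splitSum_add]

theorem split3_sub (F G : List α → List α → List α → V) (L : List α) :
    split3 (fun P Q R => F P Q R - G P Q R) L = split3 F L - split3 G L := by
  simp only [split3, splitSum_sub]

theorem split3_smul {k : Type*} [Monoid k] [DistribMulAction k V] (c : k)
    (F : List α → List α → List α → V) (L : List α) :
    split3 (fun P Q R => c • F P Q R) L = c • split3 F L := by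
  simp only [split3, splitSum_smul]

theorem map_split3 {W : Type*} [AddCommGroup W] {H : Type*} [FunLike H V W]
    [AddMonoidHomClass H V W] (φ : H) (F : List α → List α → List α → V) (L : List α) :
    φ (split3 F L) = split3 (fun P Q R => φ (F P Q R)) L := by
  simp only [split3, map_splitSum]

theorem split3_map (φ : α → α) (F : List α → List α → List α → V) (L : List α) :
    split3 F (L.map φ) = split3 (fun P Q R => F (P.map φ) (Q.map φ) (R.map φ)) L := by
  simp only [split3, splitSum_map]

/-- The three summands are the cases in which `b` lies in the third, the middle or the first part.
This separates the positions of an insertion relative to a marked letter. -/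
theorem split3_append_cons (F : List α → List α → List α → V) (P : List α) (b : α) (Q : List α) :
    split3 F (P ++ b :: Q) = split3 (fun P₁ P₂ P₃ => F P₁ P₂ (P₃ ++ b :: Q)) P +
      splitSum (fun P₁ P₂ => splitSum (fun Q₁ Q₂ => F P₁ (P₂ ++ b :: Q₁) Q₂) Q) P +
      split3 (fun Q₁ Q₂ Q₃ => F (P ++ b :: Q₁) Q₂ Q₃) Q := by
  simp only [split3, splitSum_append_cons, splitSum_add]

theorem splitSum_split3_comm (F : List α → List α → List α → List α → List α → V)
    (L L' : List α) :
    splitSum (fun P Q => split3 (fun P' Q' R' => F P Q P' Q' R') L') L =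
      split3 (fun P' Q' R' => splitSum (fun P Q => F P Q P' Q' R') L) L' :=
  (splitSum_comm _ _ _).trans (splitSum_congr fun _ _ _ => splitSum_comm _ _ _)

theorem split3_comm (F : List α → List α → List α → List α → List α → List α → V)
    (L L' : List α) :
    split3 (fun P Q R => split3 (fun P' Q' R' => F P Q R P' Q' R') L') L =
      split3 (fun P' Q' R' => split3 (fun P Q R => F P Q R P' Q' R') L) L' :=
  (splitSum_congr fun _ _ _ => splitSum_split3_comm _ _ _).trans (splitSum_split3_comm _ _ _)

/-- This and the following regroupings are iterated coassociativity. They match a double insertion,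
computed in one order, with the same insertion computed in another. -/
theorem split3_split_first (F : List α → List α → List α → List α → V) (L : List α) :
    split3 (fun P Q R => splitSum (fun P₁ P₂ => F P₁ P₂ Q R) P) L =
      splitSum (fun P₁ N => split3 (fun P₂ Q R => F P₁ P₂ Q R) N) L := by
  refine Eq.trans ?_ (splitSum_assoc (fun P₁ P₂ N => splitSum (fun Q R => F P₁ P₂ Q R) N) L)
  exact splitSum_congr fun P N _ => splitSum_comm _ _ _

theorem split3_split_last (F : List α → List α → List α → List α → V) (L : List α) :
    split3 (fun P Q R => splitSum (fun R₁ R₂ => F P Q R₁ R₂) R) L =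
      splitSum (fun N R₂ => split3 (fun P Q R₁ => F P Q R₁ R₂) N) L := by
  refine Eq.trans ?_ (splitSum_assoc (fun P N R₂ => splitSum (fun Q R₁ => F P Q R₁ R₂) N) L).symm
  exact splitSum_congr fun P N _ => (splitSum_assoc (fun Q R₁ R₂ => F P Q R₁ R₂) N).symm

theorem splitSum_eq_left (F : List α → List α → V)
    (h : ∀ P Q, Q ≠ [] → F P Q = 0) (L : List α) : splitSum F L = F L [] := by
  induction L using List.reverseRecOn with
  | nil => rfl
  | append_singleton M b _ =>
    rw [splitSum_concat, splitSum_eq_zero fun P Q _ => h _ _ (by simp), zero_add]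

theorem split3_split_right (F : List α → List α → List α → List α → V) (L : List α) :
    split3 (fun P Q R => splitSum (fun R₁ R₂ => F P Q R₁ R₂) R) L =
      split3 (fun P N R₂ => splitSum (fun Q R₁ => F P Q R₁ R₂) N) L :=
  splitSum_congr fun P N _ => (splitSum_assoc (fun Q R₁ R₂ => F P Q R₁ R₂) N).symm

theorem split3_eq_mid (F : List α → List α → List α → V)
    (h : ∀ P Q R, P ++ R ≠ [] → F P Q R = 0) (L : List α) : split3 F L = F [] L [] := by
  have h1 : ∀ M, splitSum (fun Q R => F [] Q R) M = F [] M [] := fun M =>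
    splitSum_eq_left _ (fun P Q hQ => h _ _ _ (by simpa using hQ)) M
  unfold split3
  cases L with
  | nil => rfl
  | cons a L =>
    rw [splitSum_cons, h1, splitSum_eq_zero fun P Q _ => splitSum_eq_zero fun _ _ _ =>
      h _ _ _ (by simp), add_zero]

/-- Both ways of decomposing a list into `P₁ P₂ Q R₁ R₂`, with `P₂ Q R₁` grouped or not. -/
theorem split3_split_ends (F : List α → List α → List α → List α → List α → V) (L : List α) :
    split3 (fun P Q R => splitSum (fun P₁ P₂ => splitSum (fun R₁ R₂ => F P₁ P₂ Q R₁ R₂) R) P) L =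
      split3 (fun P₁ N R₂ => split3 (fun P₂ Q R₁ => F P₁ P₂ Q R₁ R₂) N) L := by
  have h1 : ∀ Q R P, splitSum (fun P₁ P₂ => splitSum (fun R₁ R₂ => F P₁ P₂ Q R₁ R₂) R) P =
      splitSum (fun P₁ P₂ => splitSum (fun R₁ R₂ => F P₁ P₂ Q R₁ R₂) R) P := fun _ _ _ => rfl
  unfold split3
  have h2 : ∀ M P, splitSum (fun Q R => splitSum (fun P₁ P₂ =>
      splitSum (fun R₁ R₂ => F P₁ P₂ Q R₁ R₂) R) P) M =
      splitSum (fun P₁ P₂ => splitSum (fun N R₂ => splitSum (fun Q R₁ => F P₁ P₂ Q R₁ R₂) N) M)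
        P := by
    intro M P
    rw [splitSum_comm]
    refine splitSum_congr fun P₁ P₂ _ => ?_
    rw [splitSum_assoc (fun Q R₁ R₂ => F P₁ P₂ Q R₁ R₂)]
    rfl
  simp only [h2]
  rw [splitSum_assoc (fun P₁ P₂ M => splitSum (fun N R₂ => splitSum (fun Q R₁ =>
    F P₁ P₂ Q R₁ R₂) N) M)]
  unfold split3
  refine splitSum_congr fun P₁ M' _ => ?_
  rw [splitSum_assoc (fun P₂ N R₂ => splitSum (fun Q R₁ => F P₁ P₂ Q R₁ R₂) N)]
  rfl

/-- Decompositions into five parts, with the first or the last three grouped. -/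
theorem split3_split_left (F : List α → List α → List α → List α → List α → V) (L : List α) :
    split3 (fun P S T => split3 (fun P₁ P₂ P₃ => F P₁ P₂ P₃ S T) P) L =
      split3 (fun P₁ P₂ R => split3 (fun P₃ S T => F P₁ P₂ P₃ S T) R) L := by
  unfold split3
  have h2 : ∀ M P, splitSum (fun S T => splitSum (fun P₁ N =>
      splitSum (fun P₂ P₃ => F P₁ P₂ P₃ S T) N) P) M =
      splitSum (fun P₁ N => splitSum (fun P₂ P₃ => splitSum (fun S T => F P₁ P₂ P₃ S T) M) N)
        P := by
    intro M P
    rw [splitSum_comm]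
    exact splitSum_congr fun P₁ P₂ _ => splitSum_comm _ _ _
  simp only [h2]
  rw [splitSum_assoc (fun P₁ N M => splitSum (fun P₂ P₃ => splitSum (fun S T =>
    F P₁ P₂ P₃ S T) M) N)]
  unfold split3
  refine splitSum_congr fun P₁ M' _ => ?_
  rw [splitSum_assoc (fun P₂ P₃ M => splitSum (fun S T => F P₁ P₂ P₃ S T) M)]
  rfl

end Splitting

/-! ### Signs -/

section Signs

variable {k : Type u} [Field k]

theorem neg_one_zpow_congr {a b : ℤ} (h : Even (a - b)) : (-1 : k) ^ a = (-1 : k) ^ b := by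
  rw [← sub_add_cancel a b, zpow_add₀ (by simp), h.neg_one_zpow, one_mul]

theorem neg_one_zpow_mul (a b : ℤ) : (-1 : k) ^ a * (-1 : k) ^ b = (-1 : k) ^ (a + b) :=
  (zpow_add₀ (by simp) a b).symm

theorem neg_neg_one_zpow (a : ℤ) : -(-1 : k) ^ a = (-1 : k) ^ (a + 1) := by
  rw [zpow_add₀ (by simp)]; simp

end Signs

/-! ### Koszul signs as operators on letters and words. -/

namespace DGAlgebra

variable {k : Type u} [Field k] {A : DGAlgebra.{u, v} k}

theorem shiftSign_shiftSign (p q : ℤ) (a : A.carrier) :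
    A.shiftSign p (A.shiftSign q a) = A.shiftSign (p + q) a := by
  induction a using induction_homogeneous with
  | h0 => simp
  | add a a' h h' => simp [h, h']
  | hom i a ha =>
    rw [shiftSign_of_mem q ha, map_smul, shiftSign_of_mem p ha, shiftSign_of_mem _ ha, smul_smul,
      neg_one_zpow_mul]
    congr 2; ring

theorem shiftSign_congr {p q : ℤ} (h : Even (p - q)) (a : A.carrier) :
    A.shiftSign p a = A.shiftSign q a := by
  induction a using induction_homogeneous with
  | h0 => simp
  | add a a' h h' => simp [h, h']
  | hom i a ha =>
    rw [shiftSign_of_mem p ha, shiftSign_of_mem q ha, neg_one_zpow_congr]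
    rw [← sub_mul]
    exact h.mul_right _

theorem shiftSign_even {p : ℤ} (h : Even p) (a : A.carrier) : A.shiftSign p a = a := by
  rw [shiftSign_congr (q := 0) (by simpa using h)]
  induction a using induction_homogeneous with
  | h0 => simp
  | add a a' h h' => simp [h, h']
  | hom i a ha => rw [shiftSign_of_mem 0 ha]; simp

theorem parity_eq_shiftSign (p : ℤ) (a : A.carrier) :
    A.parity p a = (-1 : k) ^ p • A.shiftSign p a := by
  induction a using induction_homogeneous with
  | h0 => simp
  | add a a' h h' => simp [h, h']
  | hom i a ha =>
    rw [shiftSign_of_mem p ha, parity_of_mem p ha, smul_smul, neg_one_zpow_mul]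
    congr 2; ring

/-- On suspended letters the product has degree one, `|s(ab)| = |sa| + |sb| + 1`; the extra unit
gives the scalar. -/
theorem shiftSign_mul (p : ℤ) (a b : A.carrier) :
    A.shiftSign p (a * b) = (-1 : k) ^ p • (A.shiftSign p a * A.shiftSign p b) := by
  have h : ∀ a : A.carrier, A.shiftSign p a = (-1 : k) ^ p • A.parity p a := fun a => by
    rw [parity_eq_shiftSign, smul_smul, neg_one_zpow_mul_self, one_smul]
  rw [h, h a, h b, parity_mul, smul_mul_smul_comm, smul_smul, neg_one_zpow_mul_self, mul_one]

theorem shiftSign_one (p : ℤ) : A.shiftSign p 1 = (-1 : k) ^ p • 1 := by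
  rw [shiftSign_of_mem p (SetLike.GradedOne.one_mem : (1 : A.carrier) ∈ A.gr 0)]
  congr 1
  exact neg_one_zpow_congr (by rw [zero_sub, mul_neg_one, ← neg_add']; simp [← two_mul])

theorem shiftSign_d (p : ℤ) (a : A.carrier) :
    A.shiftSign p (A.d a) = (-1 : k) ^ p • A.d (A.shiftSign p a) := by
  induction a using induction_homogeneous with
  | h0 => simp
  | add a a' h h' => rw [map_add, map_add, map_add, map_add, h, h', smul_add]
  | hom i a ha =>
    rw [shiftSign_of_mem p ha, map_smul, shiftSign_of_mem p (A.d_mem ha), smul_smul,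
      neg_one_zpow_mul]
    congr 2; ring

theorem shiftSign_mem (p : ℤ) {i : ℤ} {a : A.carrier} (ha : a ∈ A.gr i) :
    A.shiftSign p a ∈ A.gr i := by
  rw [shiftSign_of_mem p ha]; exact Submodule.smul_mem _ _ ha

theorem d_one : A.d 1 = 0 := by
  have h := A.leibniz (SetLike.GradedOne.one_mem : (1 : A.carrier) ∈ A.gr 0) 1
  simpa using h

variable (A) in
/-- The sign of moving a symbol of degree `s` past the suspended letters of `L`. -/
def tw (s : ℤ) (L : List A.carrier) : List A.carrier := L.map (A.shiftSign s)

theorem tw_def (s : ℤ) (L : List A.carrier) : L.map (A.shiftSign s) = A.tw s L := rfl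

@[simp] theorem tw_nil (s : ℤ) : A.tw s [] = [] := rfl

@[simp] theorem tw_cons (s : ℤ) (a : A.carrier) (L : List A.carrier) :
    A.tw s (a :: L) = A.shiftSign s a :: A.tw s L := rfl

@[simp] theorem tw_append (s : ℤ) (L L' : List A.carrier) :
    A.tw s (L ++ L') = A.tw s L ++ A.tw s L' := List.map_append

@[simp] theorem tw_tw (s t : ℤ) (L : List A.carrier) : A.tw s (A.tw t L) = A.tw (s + t) L := by
  simp [tw, shiftSign_shiftSign]

theorem tw_congr {s t : ℤ} (h : Even (s - t)) (L : List A.carrier) : A.tw s L = A.tw t L := by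
  simp [tw, shiftSign_congr h]

theorem tw_even {s : ℤ} (h : Even s) (L : List A.carrier) : A.tw s L = L :=
  (List.map_congr_left fun a _ => shiftSign_even h a).trans (List.map_id _)

@[simp] theorem length_tw (s : ℤ) (L : List A.carrier) : (A.tw s L).length = L.length := by
  simp [tw]

theorem splitSum_tw {V : Type*} [AddCommGroup V] (F : List A.carrier → List A.carrier → V)
    (s : ℤ) (L : List A.carrier) :
    splitSum F (A.tw s L) = splitSum (fun P Q => F (A.tw s P) (A.tw s Q)) L :=
  splitSum_map _ _ _

theorem split3_tw {V : Type*} [AddCommGroup V]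
    (F : List A.carrier → List A.carrier → List A.carrier → V) (s : ℤ) (L : List A.carrier) :
    split3 F (A.tw s L) = split3 (fun P Q R => F (A.tw s P) (A.tw s Q) (A.tw s R)) L :=
  split3_map _ _ _

/-! ### Multilinear functions of lists -/

variable (A) in
/-- The letters of `L` are homogeneous, of degrees `e`. -/
def HasDegrees (L : List A.carrier) (e : List ℤ) : Prop :=
  List.Forall₂ (fun a i => a ∈ A.gr i) L e

/-- The total degree of suspended letters. -/
def shiftedDegree (e : List ℤ) : ℤ := (e.map fun i => i - 1).sum

@[simp] theorem shiftedDegree_nil : shiftedDegree [] = 0 := rfl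

@[simp] theorem shiftedDegree_cons (i : ℤ) (e : List ℤ) :
    shiftedDegree (i :: e) = i - 1 + shiftedDegree e := by simp [shiftedDegree]

@[simp] theorem shiftedDegree_append (e e' : List ℤ) :
    shiftedDegree (e ++ e') = shiftedDegree e + shiftedDegree e' := by simp [shiftedDegree]

theorem HasDegrees.append {L L' : List A.carrier} {e e' : List ℤ} (h : A.HasDegrees L e)
    (h' : A.HasDegrees L' e') : A.HasDegrees (L ++ L') (e ++ e') :=
  List.rel_append h h'

theorem HasDegrees.cons {a : A.carrier} {i : ℤ} {L : List A.carrier} {e : List ℤ}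
    (ha : a ∈ A.gr i) (h : A.HasDegrees L e) : A.HasDegrees (a :: L) (i :: e) :=
  List.Forall₂.cons ha h

theorem hasDegrees_nil : A.HasDegrees [] [] := List.Forall₂.nil

theorem HasDegrees.tw {L : List A.carrier} {e : List ℤ} (h : A.HasDegrees L e) (s : ℤ) :
    A.HasDegrees (A.tw s L) e := by
  unfold HasDegrees at *
  induction h with
  | nil => exact .nil
  | cons ha _ ih => exact .cons (shiftSign_mem s ha) ih

theorem HasDegrees.exists_append {P Q : List A.carrier} {e : List ℤ}
    (h : A.HasDegrees (P ++ Q) e) :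
    ∃ e₁ e₂, e = e₁ ++ e₂ ∧ A.HasDegrees P e₁ ∧ A.HasDegrees Q e₂ := by
  induction P generalizing e with
  | nil => exact ⟨[], e, rfl, hasDegrees_nil, h⟩
  | cons a P ih =>
    cases h with
    | cons ha h =>
      obtain ⟨e₁, e₂, rfl, h₁, h₂⟩ := ih h
      exact ⟨_ :: e₁, e₂, rfl, .cons ha h₁, h₂⟩

variable {V : Type*} [AddCommGroup V] [Module k V] {W : Type*} [AddCommGroup W] [Module k W]

variable (A) in
/-- `f` is linear in every letter and, if `N` holds, vanishes when some letter is `1`. -/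
def SlotLinear (N : Prop) (f : List A.carrier → V) : Prop :=
  ∀ l r : List A.carrier, ∃ g : A.carrier →ₗ[k] V, (N → g 1 = 0) ∧ ∀ a, f (l ++ a :: r) = g a

variable (A) in
/-- `f` has degree `p` as a map from the tensor coalgebra of the suspension of `A`. -/
def HasDegree (gr : ℤ → Submodule k V) (p : ℤ) (f : List A.carrier → V) : Prop :=
  ∀ (L : List A.carrier) (e : List ℤ), A.HasDegrees L e → f L ∈ gr (p + shiftedDegree e)

namespace SlotLinear

variable {N : Prop} {f g : List A.carrier → V}

/-- The linear map in one letter. -/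
def slot (h : A.SlotLinear N f) (l r : List A.carrier) : A.carrier →ₗ[k] V := (h l r).choose

theorem slot_apply (h : A.SlotLinear N f) (l r : List A.carrier) (a : A.carrier) :
    h.slot l r a = f (l ++ a :: r) := ((h l r).choose_spec.2 a).symm

theorem slot_one (h : A.SlotLinear N f) (l r : List A.carrier) (hN : N) :
    h.slot l r 1 = 0 := (h l r).choose_spec.1 hN

/-- Normalization is a parameter because `iota` and `mu` do not vanish on every word with a letter
`1`: a normalized cochain has to forget its normalization before it is combined with them. -/
theorem weaken (h : A.SlotLinear N f) {N' : Prop} (hN : N' → N) : A.SlotLinear N' f :=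
  fun l r => ⟨h.slot l r, fun h' => h.slot_one l r (hN h'), fun _ => (h.slot_apply l r _).symm⟩

theorem map_smul (h : A.SlotLinear N f) (l : List A.carrier) (c : k) (a : A.carrier)
    (r : List A.carrier) : f (l ++ (c • a) :: r) = c • f (l ++ a :: r) := by
  rw [← h.slot_apply, ← h.slot_apply, _root_.map_smul]

theorem map_add (h : A.SlotLinear N f) (l : List A.carrier) (a b : A.carrier)
    (r : List A.carrier) : f (l ++ (a + b) :: r) = f (l ++ a :: r) + f (l ++ b :: r) := by
  rw [← h.slot_apply, ← h.slot_apply, ← h.slot_apply, _root_.map_add]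

theorem map_neg (h : A.SlotLinear N f) (l : List A.carrier) (a : A.carrier)
    (r : List A.carrier) : f (l ++ (-a) :: r) = -f (l ++ a :: r) := by
  rw [← h.slot_apply, ← h.slot_apply, _root_.map_neg]

theorem map_zero (h : A.SlotLinear N f) (l r : List A.carrier) : f (l ++ 0 :: r) = 0 := by
  rw [← h.slot_apply, _root_.map_zero]

theorem map_split3 (h : A.SlotLinear N f) (l r : List A.carrier)
    (F : List A.carrier → List A.carrier → List A.carrier → A.carrier) (L : List A.carrier) :
    f (l ++ split3 F L :: r) = split3 (fun P Q R => f (l ++ F P Q R :: r)) L := by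
  simp only [← h.slot_apply, HochschildBV.map_split3]

theorem add (hf : A.SlotLinear N f) (hg : A.SlotLinear N g) :
    A.SlotLinear N (fun L => f L + g L) := fun l r =>
  ⟨hf.slot l r + hg.slot l r, fun hN => by simp [hf.slot_one l r hN, hg.slot_one l r hN],
    fun a => by simp [slot_apply]⟩

theorem comp (hf : A.SlotLinear N f) (φ : V →ₗ[k] W) : A.SlotLinear N (fun L => φ (f L)) :=
  fun l r => ⟨φ ∘ₗ hf.slot l r, fun hN => by simp [hf.slot_one l r hN],
    fun a => by simp [slot_apply]⟩

theorem smul (hf : A.SlotLinear N f) (c : k) : A.SlotLinear N (fun L => c • f L) :=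
  hf.comp (c • LinearMap.id)

theorem neg (hf : A.SlotLinear N f) : A.SlotLinear N (fun L => -f L) :=
  hf.comp (-LinearMap.id)

theorem sub (hf : A.SlotLinear N f) (hg : A.SlotLinear N g) :
    A.SlotLinear N (fun L => f L - g L) := by
  simpa only [sub_eq_add_neg] using hf.add hg.neg

theorem tw (hf : A.SlotLinear N f) (s : ℤ) : A.SlotLinear N (fun L => f (A.tw s L)) :=
  fun l r => ⟨hf.slot (A.tw s l) (A.tw s r) ∘ₗ A.shiftSign s,
    fun hN => by simp [shiftSign_one, hf.slot_one _ _ hN], fun a => by simp [slot_apply]⟩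

theorem append_left (hf : A.SlotLinear N f) (P : List A.carrier) :
    A.SlotLinear N (fun L => f (P ++ L)) :=
  fun l r => ⟨hf.slot (P ++ l) r, hf.slot_one _ _, fun a => by simp [slot_apply]⟩

theorem append_right (hf : A.SlotLinear N f) (R : List A.carrier) :
    A.SlotLinear N (fun L => f (L ++ R)) :=
  fun l r => ⟨hf.slot l (r ++ R), hf.slot_one _ _, fun a => by simp [slot_apply]⟩

theorem cons (hf : A.SlotLinear N f) (a : A.carrier) :
    A.SlotLinear N (fun L => f (a :: L)) := hf.append_left [a]

theorem letter (hf : A.SlotLinear N f) (P R : List A.carrier) {y : List A.carrier → A.carrier}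
    {N' : Prop} (hy : A.SlotLinear N' y) : A.SlotLinear N' (fun L => f (P ++ y L :: R)) :=
  fun l r => ⟨hf.slot P R ∘ₗ hy.slot l r, fun hN => by simp [hy.slot_one l r hN],
    fun a => by simp [slot_apply]⟩

theorem splitSum {F : List A.carrier → List A.carrier → V}
    (h₁ : ∀ Q, A.SlotLinear N fun P => F P Q) (h₂ : ∀ P, A.SlotLinear N fun Q => F P Q) :
    A.SlotLinear N (splitSum F) := by
  intro l r
  -- A cut inside `l` leaves the letter in the second part, a cut behind the letter leaves it in the
  -- first part; the witness adds both families.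
  refine ⟨∑ i ∈ Finset.range (l.length + 1), (h₂ (l.take i)).slot (l.drop i) r +
    ∑ i ∈ Finset.range (r.length + 1), (h₁ (r.drop i)).slot l (r.take i), fun hN => ?_, fun a => ?_⟩
  · simp [slot_one _ _ _ hN]
  · rw [splitSum_append_cons, splitSum_eq_sum, splitSum_eq_sum]
    simp [slot_apply]

theorem split3 {F : List A.carrier → List A.carrier → List A.carrier → V}
    (h₁ : ∀ Q R, A.SlotLinear N fun P => F P Q R) (h₂ : ∀ P R, A.SlotLinear N fun Q => F P Q R)
    (h₃ : ∀ P Q, A.SlotLinear N fun R => F P Q R) :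
    A.SlotLinear N (split3 F) := by
  refine SlotLinear.splitSum (fun M l r => ?_) (fun P => SlotLinear.splitSum (h₂ P) (h₃ P))
  refine ⟨∑ i ∈ Finset.range (M.length + 1), (h₁ (M.take i) (M.drop i)).slot l r,
    fun hN => ?_, fun a => ?_⟩
  · simp [slot_one _ _ _ hN]
  · simp [splitSum_eq_sum, slot_apply]

/-- Each letter is a sum of homogeneous ones, and `f` is additive in it. -/
theorem mem_of_homogeneous (hf : A.SlotLinear N f) (S : Submodule k V)
    (h : ∀ L e, A.HasDegrees L e → f L ∈ S) (L : List A.carrier) : f L ∈ S := by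
  -- The prefix `P` collects the letters that are already homogeneous.
  suffices ∀ (P : List A.carrier) (e : List ℤ), A.HasDegrees P e → f (P ++ L) ∈ S from
    this [] [] hasDegrees_nil
  induction L with
  | nil => intro P e hP; simpa using h P e hP
  | cons a L ih =>
    intro P e hP
    induction a using induction_homogeneous with
    | h0 => rw [hf.map_zero]; exact S.zero_mem
    | add a b ha hb => rw [hf.map_add]; exact S.add_mem ha hb
    | hom i a ha => simpa using ih (P ++ [a]) (e ++ [i]) (hP.append (.cons ha hasDegrees_nil))

theorem ext_homogeneous (hf : A.SlotLinear N f) (hg : A.SlotLinear N g)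
    (h : ∀ L e, A.HasDegrees L e → f L = g L) (L : List A.carrier) : f L = g L := by
  have := (hf.sub hg).mem_of_homogeneous ⊥ (fun L e hL => by simp [h L e hL]) L
  simpa [sub_eq_zero] using this

theorem apply_tw (hf : A.SlotLinear N f) (s : ℤ) {L : List A.carrier} {e : List ℤ}
    (hL : A.HasDegrees L e) : f (A.tw s L) = (-1 : k) ^ (s * shiftedDegree e) • f L := by
  suffices ∀ P, f (P ++ A.tw s L) = (-1 : k) ^ (s * shiftedDegree e) • f (P ++ L) from this []
  unfold HasDegrees at hL
  induction hL with
  | nil => simp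
  | @cons a i L e ha _ ih =>
    intro P
    rw [tw_cons, shiftSign_of_mem s ha, hf.map_smul,
      show P ++ a :: A.tw s L = (P ++ [a]) ++ A.tw s L by simp, ih, smul_smul, neg_one_zpow_mul,
      shiftedDegree_cons, mul_add]
    simp

/-- The sign rule for moving a symbol past the value of a function of degree `p`. -/
theorem sign_rule (hf : A.SlotLinear N f) {gr : ℤ → Submodule k V} {p : ℤ}
    (hp : A.HasDegree gr p f) (s c : ℤ) (τ τ' : V →ₗ[k] W)
    (hτ : ∀ i, ∀ x ∈ gr i, τ x = (-1 : k) ^ (s * (i - c)) • τ' x) (L : List A.carrier) :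
    τ (f L) = (-1 : k) ^ (s * (p - c)) • τ' (f (A.tw s L)) := by
  refine ext_homogeneous (hf.comp τ) (((hf.tw s).comp τ').smul _) (fun L e hL => ?_) L
  -- The value has degree `p` plus the degree of the word. The word's share of the sign is exactly
  -- the effect of `tw s`.
  rw [hτ _ _ (hp L e hL), hf.apply_tw s hL, _root_.map_smul, smul_smul, neg_one_zpow_mul]
  congr 2
  ring

end SlotLinear

theorem HasDegree.splitSum_mem {gr : ℤ → Submodule k V} {j : ℤ}
    {F : List A.carrier → List A.carrier → V} {L : List A.carrier} {e : List ℤ}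
    (hL : A.HasDegrees L e)
    (h : ∀ P Q e₁ e₂, A.HasDegrees P e₁ → A.HasDegrees Q e₂ → e = e₁ ++ e₂ → F P Q ∈ gr j) :
    splitSum F L ∈ gr j := by
  refine HochschildBV.splitSum_mem _ fun P Q hPQ => ?_
  subst hPQ
  obtain ⟨e₁, e₂, he, h₁, h₂⟩ := hL.exists_append
  exact h P Q e₁ e₂ h₁ h₂ he

theorem HasDegree.split3_mem {gr : ℤ → Submodule k V} {j : ℤ}
    {F : List A.carrier → List A.carrier → List A.carrier → V} {L : List A.carrier} {e : List ℤ}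
    (hL : A.HasDegrees L e)
    (h : ∀ P Q R e₁ e₂ e₃, A.HasDegrees P e₁ → A.HasDegrees Q e₂ → A.HasDegrees R e₃ →
      e = e₁ ++ (e₂ ++ e₃) → F P Q R ∈ gr j) :
    split3 F L ∈ gr j :=
  HasDegree.splitSum_mem hL fun P _ e₁ _ h₁ h₂ he => HasDegree.splitSum_mem h₂
    fun Q R _ _ h₃ h₄ he' => h P Q R e₁ _ _ h₁ h₃ h₄ (by rw [he, he'])

theorem HasDegree.add {gr : ℤ → Submodule k V} {p : ℤ} {f g : List A.carrier → V}
    (hf : A.HasDegree gr p f) (hg : A.HasDegree gr p g) :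
    A.HasDegree gr p (fun L => f L + g L) :=
  fun L e h => (gr _).add_mem (hf L e h) (hg L e h)

theorem HasDegree.smul {gr : ℤ → Submodule k V} {p : ℤ} {f : List A.carrier → V}
    (hf : A.HasDegree gr p f) (c : k) : A.HasDegree gr p (fun L => c • f L) :=
  fun L e h => (gr _).smul_mem c (hf L e h)

theorem HasDegree.sub {gr : ℤ → Submodule k V} {p : ℤ} {f g : List A.carrier → V}
    (hf : A.HasDegree gr p f) (hg : A.HasDegree gr p g) :
    A.HasDegree gr p (fun L => f L - g L) :=
  fun L e h => (gr _).sub_mem (hf L e h) (hg L e h)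

end DGAlgebra

theorem DGBimodule.isCochain_iff {k : Type u} [Field k] {A : DGAlgebra.{u, v} k}
    (M : DGBimodule.{u, v, w} A) (p : ℤ) (f : List A.carrier → M.carrier) :
    M.IsCochain p f ↔ A.SlotLinear True f ∧ A.HasDegree M.gr p f := by
  refine ⟨fun h => ⟨fun l r => ⟨⟨⟨fun a => f (l ++ a :: r), fun a b => h.map_add l a b r⟩,
    fun c a => h.map_smul l c a r⟩, fun _ => h.normalized l r, fun _ => rfl⟩, h.homogeneous⟩,
    fun ⟨h, h'⟩ => ⟨fun l a b r => h.map_add l a b r, fun l c a r => h.map_smul l c a r,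
      fun l r => ?_, h'⟩⟩
  rw [← h.slot_apply, h.slot_one _ _ trivial]

namespace DGAlgebra

variable {k : Type u} [Field k] {A : DGAlgebra.{u, v} k}
variable {U : Type*} [AddCommGroup U] [Module k U] {V : Type*} [AddCommGroup V] [Module k V]
  {W : Type*} [AddCommGroup W] [Module k W]

/-! ### Insertions -/

/-- The insertion of `y` into `x`: the value on `L` is the sum of `± x(P, y(Q), R)` over all
decompositions `L = P Q R`. -/
def ins (s : ℤ) (x : List A.carrier → V) (y : List A.carrier → A.carrier) :
    List A.carrier → V :=
  split3 fun P Q R => x (A.tw s P ++ y Q :: R)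

/-- The insertion of `y` into the middle argument of `h`. -/
def insMid (s : ℤ) (h : List A.carrier → A.carrier → List A.carrier → V)
    (y : List A.carrier → A.carrier) : List A.carrier → V :=
  split3 fun P Q R => h (A.tw s P) (y Q) R

/-- The insertion of `w` into the word `U b M`. -/
def star (r : ℤ) (h : List A.carrier → A.carrier → List A.carrier → V)
    (w : List A.carrier → A.carrier) (U : List A.carrier) (b : A.carrier) (M : List A.carrier) :
    V :=
  split3 (fun U₁ U₂ U₃ => h (A.tw r U₁ ++ w U₂ :: U₃) b M) U +
    splitSum (fun U₁ U₂ => splitSum (fun M₁ M₂ => h (A.tw r U₁) (w (U₂ ++ b :: M₁)) M₂) M) U +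
    split3 (fun M₁ M₂ M₃ => h (A.tw r U) (A.shiftSign r b) (A.tw r M₁ ++ w M₂ :: M₃)) M

variable (A) in
/-- `h U b M` is linear in `b` and in every letter of `U` and `M`. -/
structure TriLinear (h : List A.carrier → A.carrier → List A.carrier → V) : Prop where
  left : ∀ b M, A.SlotLinear False fun U => h U b M
  mid : ∀ U M, ∃ g : A.carrier →ₗ[k] V, ∀ b, h U b M = g b
  right : ∀ U b, A.SlotLinear False fun M => h U b M

variable (A) in
/-- The Koszul sign rule for a function `y` of shifted degree `c`. -/
def Twists (c : ℤ) (y : List A.carrier → A.carrier) : Prop :=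
  ∀ s L, A.shiftSign s (y L) = (-1 : k) ^ (s * c) • y (A.tw s L)

theorem Twists.congr {c c' : ℤ} {y : List A.carrier → A.carrier} (hy : A.Twists c y)
    (h : Even (c - c')) : A.Twists c' y := fun s L => by
  rw [hy s L, neg_one_zpow_congr (b := s * c')]
  rw [← mul_sub]; exact h.mul_left s

theorem SlotLinear.twists {N : Prop} {y : List A.carrier → A.carrier} (hy : A.SlotLinear N y)
    {q : ℤ} (hq : A.HasDegree A.gr q y) : A.Twists (q - 1) y := fun s L =>
  hy.sign_rule hq s 1 (A.shiftSign s) LinearMap.id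
    (fun i a ha => by rw [shiftSign_of_mem s ha, LinearMap.id_apply]) L

theorem TriLinear.of_append {N : Prop} {g : List A.carrier → V} (hg : A.SlotLinear N g) :
    A.TriLinear fun U b M => g (U ++ b :: M) where
  left b M := (hg.append_right (b :: M)).weaken (by simp)
  mid U M := ⟨hg.slot U M, fun b => (hg.slot_apply U M b).symm⟩
  right U b := ((hg.append_left U).cons b).weaken (by simp)

theorem TriLinear.mid_smul {h : List A.carrier → A.carrier → List A.carrier → V}
    (hh : A.TriLinear h) (U : List A.carrier) (c : k) (b : A.carrier) (M : List A.carrier) :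
    h U (c • b) M = c • h U b M := by
  obtain ⟨g, hg⟩ := hh.mid U M
  simp [hg]

theorem TriLinear.mid_split3 {h : List A.carrier → A.carrier → List A.carrier → V}
    (hh : A.TriLinear h) (U : List A.carrier)
    (F : List A.carrier → List A.carrier → List A.carrier → A.carrier) (L M : List A.carrier) :
    h U (split3 F L) M = split3 (fun P Q R => h U (F P Q R) M) L := by
  obtain ⟨g, hg⟩ := hh.mid U M
  simp only [hg, map_split3]

theorem star_append (r : ℤ) (g : List A.carrier → V) (w : List A.carrier → A.carrier)
    (U : List A.carrier) (b : A.carrier) (M : List A.carrier) :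
    star r (fun U b M => g (U ++ b :: M)) w U b M = ins r g w (U ++ b :: M) := by
  simp [star, ins, split3_append_cons]

/-- The pre-Lie identity. -/
theorem insMid_star {h : List A.carrier → A.carrier → List A.carrier → V} (hh : A.TriLinear h)
    {s r : ℤ} {y w : List A.carrier → A.carrier} (hy : A.Twists s y) (hw : A.Twists r w)
    (L : List A.carrier) :
    insMid s (star r h w) y L = (-1 : k) ^ (s * r) •
        (ins r (insMid s h y) w L - insMid (s + r) h (ins r y w) L) +
      insMid (r + s) h (ins s w y) L := by
  -- In `e1` and `e3` the value of `w` lies to the left or to the right of that of `y`. These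
  -- disjoint insertions also occur in `ins r (insMid s h y) w`; exchanging the two symbols costs
  -- `(-1) ^ (s * r)`.
  have e1 : split3 (fun P Q R => split3 (fun U₁ U₂ U₃ =>
      h (A.tw (r + s) U₁ ++ w (A.tw s U₂) :: A.tw s U₃) (y Q) R) P) L =
      (-1 : k) ^ (s * r) • split3 (fun P Q R => split3 (fun R₁ R₂ R₃ =>
        h (A.tw (s + r) P ++ A.shiftSign s (w Q) :: A.tw s R₁) (y R₂) R₃) R) L := by
    rw [split3_split_left]
    simp only [hw s, (hh.left _ _).map_smul, split3_smul, smul_smul, neg_one_zpow_mul_self,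
      one_smul, add_comm s r]
  have e3 : split3 (fun P Q R => split3 (fun R₁ R₂ R₃ =>
      h (A.tw (r + s) P) (A.shiftSign r (y Q)) (A.tw r R₁ ++ w R₂ :: R₃)) R) L =
      (-1 : k) ^ (s * r) • split3 (fun P Q R => split3 (fun P₁ P₂ P₃ =>
        h (A.tw (s + r) P₁) (y (A.tw r P₂)) (A.tw r P₃ ++ w Q :: R)) P) L := by
    rw [split3_split_left]
    simp only [hy r, hh.mid_smul, split3_smul, add_comm s r, mul_comm s r]
  -- Here `w` encloses the value of `y`.
  have e2 : split3 (fun P Q R => splitSum (fun U₁ U₂ => splitSum (fun M₁ M₂ =>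
      h (A.tw (r + s) U₁) (w (A.tw s U₂ ++ y Q :: M₁)) M₂) R) P) L =
      insMid (r + s) h (ins s w y) L := by
    rw [split3_split_ends]
    simp only [insMid, ins, hh.mid_split3]
  -- Here `y` encloses the value of `w`. This occurs in `ins r (insMid s h y) w` only, and is
  -- therefore subtracted there.
  have e4 : split3 (fun P Q R => splitSum (fun P₁ P₂ => splitSum (fun R₁ R₂ =>
      h (A.tw (s + r) P₁) (y (A.tw r P₂ ++ w Q :: R₁)) R₂) R) P) L =
      insMid (s + r) h (ins r y w) L := by
    rw [split3_split_ends]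
    simp only [insMid, ins, hh.mid_split3]
  unfold insMid star
  simp only [splitSum_tw, split3_tw, tw_tw, split3_add]
  rw [e1, e2, e3]
  conv_rhs => enter [1, 2, 1]; unfold ins
  simp only [split3_append_cons, splitSum_tw, split3_tw, tw_tw, tw_append, tw_cons, split3_add]
  rw [e4]
  simp only [insMid]
  module

/-- The pre-Lie identity. -/
theorem ins_ins {N : Prop} {g : List A.carrier → V} (hg : A.SlotLinear N g)
    {s r : ℤ} {y w : List A.carrier → A.carrier} (hy : A.Twists s y) (hw : A.Twists r w)
    (L : List A.carrier) :
    ins s (ins r g w) y L = (-1 : k) ^ (s * r) •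
        (ins r (ins s g y) w L - ins (s + r) g (ins r y w) L) + ins (r + s) g (ins s w y) L := by
  have h := insMid_star (TriLinear.of_append hg) hy hw L
  rwa [show star r (fun U b M => g (U ++ b :: M)) w = fun U b M => ins r g w (U ++ b :: M) from
    funext fun U => funext fun b => funext fun M => star_append r g w U b M] at h

/-- The case `y = w` of `ins_ins` gives this only after multiplication by two, so characteristic two
requires a direct argument: the two orders of a disjoint pair of insertions cancel because `w` is
odd. -/
theorem ins_ins_self {N : Prop} {g : List A.carrier → V} (hg : A.SlotLinear N g)
    {r : ℤ} (hr : Odd r) {w : List A.carrier → A.carrier} (hw : A.Twists r w)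
    (L : List A.carrier) :
    ins r (ins r g w) w L = ins (r + r) g (ins r w w) L := by
  have e4 : split3 (fun P Q R => splitSum (fun P₁ P₂ => splitSum (fun R₁ R₂ =>
      g (A.tw (r + r) P₁ ++ w (A.tw r P₂ ++ w Q :: R₁) :: R₂)) R) P) L =
      ins (r + r) g (ins r w w) L := by
    rw [split3_split_ends]
    simp only [ins, hg.map_split3]
  have hs : (-1 : k) ^ (r * r) = -1 := (hr.mul hr).neg_one_zpow
  conv_lhs => unfold ins
  simp only [split3_append_cons, splitSum_tw, split3_tw, tw_tw, tw_append, tw_cons, split3_add,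
    hw r, hs, hg.map_smul, split3_smul, List.append_assoc, List.cons_append]
  rw [e4, split3_split_left]
  module

/-! ### The partial insertion `y(U, b, …, x(…), …)` -/

/-- The sum of `± y(U, b, P, x(Q), R)` over all decompositions `M = P Q R`. -/
def insAfter (s : ℤ) (x : List A.carrier → A.carrier) (y : List A.carrier → V)
    (U : List A.carrier) (b : A.carrier) (M : List A.carrier) : V :=
  ins s (fun N => y (A.tw s U ++ A.shiftSign s b :: N)) x M

theorem SlotLinear.ins {N : Prop} {x : List A.carrier → V} (hx : A.SlotLinear N x)
    {y : List A.carrier → A.carrier} (hy : A.SlotLinear N y) (s : ℤ) :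
    A.SlotLinear N (ins s x y) :=
  SlotLinear.split3 (fun Q R => (hx.append_right (y Q :: R)).tw s)
    (fun P R => hx.letter (A.tw s P) R hy)
    (fun P Q => (hx.append_left (A.tw s P)).cons (y Q))

theorem SlotLinear.insAfter_left {N : Prop} (x : List A.carrier → A.carrier)
    {y : List A.carrier → V} (hy : A.SlotLinear N y) (s : ℤ) (b : A.carrier)
    (M : List A.carrier) : A.SlotLinear N fun U => insAfter s x y U b M := fun l r => by
  refine ⟨∑ i ∈ Finset.range (M.length + 1), ∑ j ∈ Finset.range ((M.drop i).length + 1),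
    hy.slot (A.tw s l) (A.tw s r ++ A.shiftSign s b :: (A.tw s (M.take i) ++
      x ((M.drop i).take j) :: (M.drop i).drop j)) ∘ₗ A.shiftSign s, fun hN => ?_, fun a => ?_⟩
  · simp [shiftSign_one, hy.slot_one _ _ hN]
  · simp only [DGAlgebra.insAfter, DGAlgebra.ins, HochschildBV.split3, HochschildBV.splitSum_eq_sum, LinearMap.sum_apply,
      LinearMap.comp_apply, SlotLinear.slot_apply, tw_append, tw_cons, List.append_assoc,
      List.cons_append]

theorem TriLinear.insAfter {N N' : Prop} {x : List A.carrier → A.carrier}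
    {y : List A.carrier → V} (hx : A.SlotLinear N' x) (hy : A.SlotLinear N y) (s : ℤ) :
    A.TriLinear (insAfter s x y) where
  left b M := (hy.insAfter_left x s b M).weaken (by simp)
  mid U M := by
    refine ⟨∑ i ∈ Finset.range (M.length + 1), ∑ j ∈ Finset.range ((M.drop i).length + 1),
      hy.slot (A.tw s U) (A.tw s (M.take i) ++
        x ((M.drop i).take j) :: (M.drop i).drop j) ∘ₗ A.shiftSign s, fun a => ?_⟩
    simp only [DGAlgebra.insAfter, DGAlgebra.ins, split3, splitSum_eq_sum, LinearMap.sum_apply,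
      LinearMap.comp_apply, SlotLinear.slot_apply]
  right U b := SlotLinear.ins (((hy.append_left _).cons _).weaken (by simp))
    (hx.weaken (by simp)) s

/-- The part of `insAfter x (ins y w)` in which `w` contains both `b` and `x(…)`. -/
def insAround (s r : ℤ) (x w : List A.carrier → A.carrier) (y : List A.carrier → V)
    (U : List A.carrier) (b : A.carrier) (M : List A.carrier) : V :=
  splitSum (fun U₁ U₂ => splitSum (fun M₁ M₂ =>
    y (A.tw (r + s) U₁ ++ insAfter s x w U₂ b M₁ :: M₂)) M) U

/-- On the left, `w` is disjoint from `x` or inside `x`. The term `insAfter s x (ins r y w)` has the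
disjoint positions and also those in which `w` encloses `x`, with or without `b`; `insAround` and
the last term remove these. Behind `b` the comparison is the pre-Lie identity. -/
theorem star_insAfter {N : Prop} {y : List A.carrier → V} (hy : A.SlotLinear N y)
    {s r : ℤ} {x w : List A.carrier → A.carrier} (hx : A.Twists s x) (hw : A.Twists r w)
    (U : List A.carrier) (b : A.carrier) (M : List A.carrier) :
    star r (insAfter s x y) w U b M = (-1 : k) ^ (s * r) •
        (insAfter s x (ins r y w) U b M - insAround s r x w y U b M) +
      insAfter (s + r) (ins r x w) y U b M -
      (-1 : k) ^ (s * r) • insAfter (r + s) (ins s w x) y U b M := by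
  -- The function `y` with the prefix up to `b` frozen, to which the pre-Lie identity is applied.
  set g : List A.carrier → V := fun N =>
    y (A.tw (r + s) U ++ A.shiftSign (r + s) b :: N) with hgdef
  have hg : A.SlotLinear N g := (hy.append_left _).cons _
  have key := ins_ins hg hx hw M
  have c1 : split3 (fun M₁ M₂ M₃ => insAfter s x y (A.tw r U) (A.shiftSign r b)
      (A.tw r M₁ ++ w M₂ :: M₃)) M = ins r (ins s g x) w M := by
    simp only [insAfter, hgdef, tw_tw, shiftSign_shiftSign, add_comm r s]
    rfl
  have a1 : split3 (fun U₁ U₂ U₃ => insAfter s x y (A.tw r U₁ ++ w U₂ :: U₃) b M) U =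
      (-1 : k) ^ (s * r) • split3 (fun P Q R => split3 (fun U₁ U₂ U₃ =>
        y (A.tw (r + s) U₁ ++ w (A.tw s U₂) :: (A.tw s U₃ ++ A.shiftSign s b ::
          (A.tw s P ++ x Q :: R)))) U) M := by
    simp only [insAfter, ins, tw_append, tw_tw, tw_cons, hw s, add_comm s r,
      List.append_assoc, List.cons_append, hy.map_smul, split3_smul]
    rw [split3_comm]
  have b1 : splitSum (fun U₁ U₂ => splitSum (fun M₁ M₂ =>
      insAfter s x y (A.tw r U₁) (w (U₂ ++ b :: M₁)) M₂) M) U =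
      (-1 : k) ^ (s * r) • splitSum (fun U₁ U₂ => split3 (fun P Q R =>
        splitSum (fun P₁ P₂ => y (A.tw (r + s) U₁ ++
          w (A.tw s U₂ ++ A.shiftSign s b :: A.tw s P₁) :: (A.tw s P₂ ++ x Q :: R))) P) M) U := by
    simp only [insAfter, ins, tw_append, tw_tw, tw_cons, hw s, add_comm s r, hy.map_smul,
      split3_smul, splitSum_smul]
    congr 1
    refine splitSum_congr fun U₁ U₂ _ => ?_
    exact (split3_split_first _ _).symm
  have b2 : insAround s r x w y U b M = splitSum (fun U₁ U₂ => split3 (fun P Q R =>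
        splitSum (fun R₁ R₂ => y (A.tw (r + s) U₁ ++
          w (A.tw s U₂ ++ A.shiftSign s b :: (A.tw s P ++ x Q :: R₁)) :: R₂)) R) M) U := by
    refine splitSum_congr fun U₁ U₂ _ => ?_
    simp only [insAfter, ins, hy.map_split3]
    exact (split3_split_last _ _).symm
  have hR : insAfter s x (ins r y w) U b M = split3 (fun P Q R => split3 (fun U₁ U₂ U₃ =>
        y (A.tw (r + s) U₁ ++ w (A.tw s U₂) :: (A.tw s U₃ ++ A.shiftSign s b ::
          (A.tw s P ++ x Q :: R)))) U) M +
      (splitSum (fun U₁ U₂ => split3 (fun P Q R =>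
        splitSum (fun P₁ P₂ => y (A.tw (r + s) U₁ ++
          w (A.tw s U₂ ++ A.shiftSign s b :: A.tw s P₁) :: (A.tw s P₂ ++ x Q :: R))) P) M) U +
       splitSum (fun U₁ U₂ => split3 (fun P Q R =>
        splitSum (fun R₁ R₂ => y (A.tw (r + s) U₁ ++
          w (A.tw s U₂ ++ A.shiftSign s b :: (A.tw s P ++ x Q :: R₁)) :: R₂)) R) M) U) +
      ins s (ins r g w) x M := by
    rw [splitSum_split3_comm, splitSum_split3_comm, insAfter, ins]
    simp only [ins, hgdef, split3_append_cons, splitSum_append_cons, splitSum_tw, split3_tw,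
      tw_tw, tw_append, tw_cons, split3_add, splitSum_add, shiftSign_shiftSign, List.append_assoc,
      List.cons_append]
  rw [star, a1, b1, c1, hR, b2, key]
  have d1 : insAfter (s + r) (ins r x w) y U b M = ins (s + r) g (ins r x w) M := by
    rw [insAfter, hgdef, add_comm]
  have d2 : insAfter (r + s) (ins s w x) y U b M = ins (r + s) g (ins s w x) M := rfl
  rw [d1, d2]
  simp only [smul_add, smul_sub, smul_smul, neg_one_zpow_mul_self, one_smul]
  abel

end DGAlgebra

/-! ### Linearity of insertions. -/

namespace DGAlgebra

variable {k : Type u} [Field k] {A : DGAlgebra.{u, v} k}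
variable {U : Type*} [AddCommGroup U] [Module k U] {V : Type*} [AddCommGroup V] [Module k V]
  {W : Type*} [AddCommGroup W] [Module k W] {X : Type*} [AddCommGroup X] [Module k X]
  {Y : Type*} [AddCommGroup Y] [Module k Y] {Z : Type*} [AddCommGroup Z] [Module k Z]

theorem splitSum_linearMap_apply (F : List A.carrier → List A.carrier → V →ₗ[k] W)
    (L : List A.carrier) (x : V) : splitSum F L x = splitSum (fun P Q => F P Q x) L :=
  map_splitSum (LinearMap.applyₗ x) F L

theorem split3_linearMap_apply (F : List A.carrier → List A.carrier → List A.carrier → V →ₗ[k] W)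
    (L : List A.carrier) (x : V) : split3 F L x = split3 (fun P Q R => F P Q R x) L :=
  map_split3 (LinearMap.applyₗ x) F L

theorem ins_add (s : ℤ) (x x' : List A.carrier → V) (y : List A.carrier → A.carrier) :
    ins s (x + x') y = ins s x y + ins s x' y := funext fun _ => split3_add _ _ _

theorem ins_sub (s : ℤ) (x x' : List A.carrier → V) (y : List A.carrier → A.carrier) :
    ins s (x - x') y = ins s x y - ins s x' y := funext fun _ => split3_sub _ _ _

theorem ins_smul (s : ℤ) (c : k) (x : List A.carrier → V) (y : List A.carrier → A.carrier) :
    ins s (c • x) y = c • ins s x y := funext fun _ => split3_smul _ _ _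

theorem ins_compLeft (s : ℤ) (φ : V →ₗ[k] W) (x : List A.carrier → V)
    (y : List A.carrier → A.carrier) :
    ins s (φ.compLeft _ x) y = φ.compLeft _ (ins s x y) :=
  funext fun _ => (map_split3 φ _ _).symm

theorem ins_congr {s t : ℤ} (h : Even (s - t)) (x : List A.carrier → V)
    (y : List A.carrier → A.carrier) : ins s x y = ins t x y := by
  unfold ins
  simp only [tw_congr h]

theorem SlotLinear.ins_add_right {N : Prop} {x : List A.carrier → V} (hx : A.SlotLinear N x)
    (s : ℤ) (y y' : List A.carrier → A.carrier) :
    DGAlgebra.ins s x (y + y') = DGAlgebra.ins s x y + DGAlgebra.ins s x y' := by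
  funext L
  simp only [DGAlgebra.ins, Pi.add_apply, hx.map_add, split3_add]

theorem SlotLinear.ins_smul_right {N : Prop} {x : List A.carrier → V} (hx : A.SlotLinear N x)
    (s : ℤ) (c : k) (y : List A.carrier → A.carrier) :
    DGAlgebra.ins s x (c • y) = c • DGAlgebra.ins s x y := by
  funext L
  simp only [DGAlgebra.ins, Pi.smul_apply, hx.map_smul, split3_smul]

theorem SlotLinear.ins_sub_right {N : Prop} {x : List A.carrier → V} (hx : A.SlotLinear N x)
    (s : ℤ) (y y' : List A.carrier → A.carrier) :
    DGAlgebra.ins s x (y - y') = DGAlgebra.ins s x y - DGAlgebra.ins s x y' := by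
  rw [sub_eq_add_neg, ← neg_one_smul k y', hx.ins_add_right, hx.ins_smul_right, neg_one_smul,
    ← sub_eq_add_neg]

/-! ### Cup products -/

variable (A) in
/-- The cup product of functions with values in `U` and `V`, with respect to a bilinear map. -/
def cupWith (β : U →ₗ[k] V →ₗ[k] W) (q : ℤ) :
    (List A.carrier → U) →ₗ[k] (List A.carrier → V) →ₗ[k] (List A.carrier → W) :=
  LinearMap.mk₂ k (fun x y => splitSum fun P Q => β (x (A.tw q P)) (y Q))
    (fun x x' y => by funext L; simp [splitSum_add])
    (fun c x y => by funext L; simp [splitSum_smul])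
    (fun x y y' => by funext L; simp [splitSum_add])
    (fun c x y => by funext L; simp [splitSum_smul])

theorem cupWith_apply (β : U →ₗ[k] V →ₗ[k] W) (q : ℤ) (x : List A.carrier → U)
    (y : List A.carrier → V) (L : List A.carrier) :
    A.cupWith β q x y L = splitSum (fun P Q => β (x (A.tw q P)) (y Q)) L := rfl

theorem cupWith_congr (β : U →ₗ[k] V →ₗ[k] W) {q r : ℤ} (h : Even (q - r)) :
    A.cupWith β q = A.cupWith β r := by
  ext x y L
  simp only [cupWith_apply, tw_congr h]

theorem cup_eq (q : ℤ) (x y : List A.carrier → A.carrier) :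
    A.cup q x y = A.cupWith (LinearMap.mul k A.carrier) q x y := by
  funext L
  rw [cupWith_apply, splitSum_eq_sum]
  rfl

theorem circ_eq (q : ℤ) (x y : List A.carrier → A.carrier) :
    A.circ q x y = ins (q + 1) x y := by
  funext L
  simp only [ins, split3, splitSum_eq_sum, circ, tw, List.length_drop]

/-- Four bilinear maps are allowed so that the associativity of A and the three compatibilities of
the bimodule actions are all instances. -/
theorem cupWith_assoc (β : U →ₗ[k] V →ₗ[k] X) (γ : X →ₗ[k] W →ₗ[k] Y) (β' : V →ₗ[k] W →ₗ[k] Z)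
    (γ' : U →ₗ[k] Z →ₗ[k] Y) (h : ∀ x y z, γ (β x y) z = γ' x (β' y z)) (q r : ℤ)
    (x : List A.carrier → U) (y : List A.carrier → V) (z : List A.carrier → W) :
    A.cupWith γ r (A.cupWith β q x y) z = A.cupWith γ' (q + r) x (A.cupWith β' r y z) := by
  funext L
  simp only [cupWith_apply, splitSum_tw, tw_tw, map_splitSum, splitSum_linearMap_apply, ← h]
  exact splitSum_assoc (fun P Q R => γ (β (x (A.tw (q + r) P)) (y (A.tw r Q))) (z R)) L

/-- An insertion into a product takes place in one factor. In the second factor the inserted symbol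
has passed the letters of `x`; in the first factor the symbol of degree `q` passes `z`, whence `(-1)
^ (q * c)`. -/
theorem ins_cupWith (β : U →ₗ[k] V →ₗ[k] W) (q s : ℤ) {c : ℤ} {N : Prop}
    {x : List A.carrier → U} (hx : A.SlotLinear N x) (y : List A.carrier → V)
    {z : List A.carrier → A.carrier} (hz : A.Twists c z) :
    ins s (A.cupWith β q x y) z = A.cupWith β (q + s) x (ins s y z) +
      (-1 : k) ^ (q * c) • A.cupWith β q (ins s x z) y := by
  funext L
  simp only [Pi.add_apply, Pi.smul_apply, cupWith_apply, ins, splitSum_append_cons, splitSum_tw,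
    split3_add, tw_append, tw_cons, tw_tw, map_split3, split3_tw,
    split3_linearMap_apply, add_comm s q]
  congr 1
  · exact split3_split_first (fun P₁ P₂ Q R => β (x (A.tw (q + s) P₁)) (y (A.tw s P₂ ++ z Q :: R))) L
  · rw [split3_split_last (fun P Q R₁ R₂ => β
      (x (A.tw (q + s) P ++ A.shiftSign q (z Q) :: A.tw q R₁)) (y R₂))]
    simp only [hz q, hx.map_smul, map_smul, LinearMap.smul_apply, split3_smul, splitSum_smul]

theorem SlotLinear.cupWith {N : Prop} (β : U →ₗ[k] V →ₗ[k] W) (q : ℤ) {x : List A.carrier → U}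
    (hx : A.SlotLinear N x) {y : List A.carrier → V} (hy : A.SlotLinear N y) :
    A.SlotLinear N (A.cupWith β q x y) :=
  SlotLinear.splitSum (fun Q => (hx.tw q).comp (β.flip (y Q))) (fun _ => hy.comp (β _))

theorem HasDegree.cupWith {β : U →ₗ[k] V →ₗ[k] W} {grU : ℤ → Submodule k U}
    {grV : ℤ → Submodule k V} {grW : ℤ → Submodule k W}
    (hβ : ∀ {i j x y}, x ∈ grU i → y ∈ grV j → β x y ∈ grW (i + j))
    {p q : ℤ} {x : List A.carrier → U} (hx : A.HasDegree grU p x)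
    {y : List A.carrier → V} (hy : A.HasDegree grV q y) (r : ℤ) :
    A.HasDegree grW (p + q) (A.cupWith β r x y) := fun L e hL =>
  HasDegree.splitSum_mem hL fun _ _ e₁ e₂ h₁ h₂ he => by
    have := hβ (hx _ _ (h₁.tw r)) (hy _ _ h₂)
    rw [he, shiftedDegree_append]
    convert this using 2
    ring

theorem HasDegree.ins {gr : ℤ → Submodule k V} {p q : ℤ} {x : List A.carrier → V}
    (hx : A.HasDegree gr p x) {y : List A.carrier → A.carrier} (hy : A.HasDegree A.gr q y)
    (s : ℤ) : A.HasDegree gr (p + q - 1) (ins s x y) := fun L e hL =>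
  HasDegree.split3_mem hL fun _ _ _ e₁ e₂ e₃ h₁ h₂ h₃ he => by
    have := hx _ _ ((h₁.tw s).append (.cons (hy _ _ h₂) h₃))
    rw [he]
    convert this using 2
    simp only [shiftedDegree_append, shiftedDegree_cons]
    ring

/-! ### The structure maps as functions of lists -/

variable (A) in
/-- The identity of `A`, as a function on words of length one. -/
def iota : List A.carrier → A.carrier
  | [a] => a
  | _ => 0

variable (A) in
/-- The differential and the product of `A`, as a function on words of length one and two. -/
def mu : List A.carrier → A.carrier :=
  A.d.compLeft _ A.iota - A.cupWith (LinearMap.mul k A.carrier) 1 A.iota A.iota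

theorem iota_eq_zero {L : List A.carrier} (h : L.length ≠ 1) : A.iota L = 0 := by
  match L with
  | [] => rfl
  | [a] => simp at h
  | _ :: _ :: _ => rfl

theorem iota_tw (s : ℤ) (L : List A.carrier) : A.iota (A.tw s L) = A.shiftSign s (A.iota L) := by
  match L with
  | [] => simp [iota]
  | [a] => rfl
  | _ :: _ :: _ => simp [iota]

theorem slotLinear_iota : A.SlotLinear False A.iota := by
  intro l r
  match l, r with
  | [], [] => exact ⟨LinearMap.id, by simp, fun _ => rfl⟩
  | _ :: _, _ => exact ⟨0, by simp, fun _ => iota_eq_zero (by simp)⟩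
  | _, _ :: _ => exact ⟨0, by simp, fun _ => iota_eq_zero (by
      simp only [List.length_append, List.length_cons]; omega)⟩

theorem hasDegree_iota : A.HasDegree A.gr 1 A.iota := by
  intro L e h
  cases h with
  | nil => exact Submodule.zero_mem _
  | cons ha h =>
    cases h with
    | nil => simpa [iota] using ha
    | cons _ _ => exact Submodule.zero_mem _

theorem cupWith_iota_nil (β : A.carrier →ₗ[k] V →ₗ[k] W) (p : ℤ) (f : List A.carrier → V) :
    A.cupWith β p A.iota f [] = 0 := by simp [cupWith_apply, iota]

theorem cupWith_iota_cons (β : A.carrier →ₗ[k] V →ₗ[k] W) (p : ℤ) (f : List A.carrier → V)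
    (a : A.carrier) (L : List A.carrier) :
    A.cupWith β p A.iota f (a :: L) = β (A.shiftSign p a) (f L) := by
  rw [cupWith_apply, splitSum_head _ fun P Q h => by rw [iota_eq_zero (by simpa using h)]; simp]
  rfl

theorem cupWith_iota_right_nil (β : V →ₗ[k] A.carrier →ₗ[k] W) (p : ℤ)
    (f : List A.carrier → V) : A.cupWith β p f A.iota [] = 0 := by simp [cupWith_apply, iota]

theorem cupWith_iota_concat (β : V →ₗ[k] A.carrier →ₗ[k] W) (p : ℤ) (f : List A.carrier → V)
    (L : List A.carrier) (a : A.carrier) :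
    A.cupWith β p f A.iota (L ++ [a]) = β (f (A.tw p L)) a := by
  rw [cupWith_apply, splitSum_last _ fun P Q h => by rw [iota_eq_zero h]; simp]
  rfl

@[simp] theorem mu_nil : A.mu [] = 0 := by simp [mu, cupWith_iota_nil, iota]

@[simp] theorem mu_one (a : A.carrier) : A.mu [a] = A.d a := by
  simp [mu, cupWith_iota_cons, iota]

@[simp] theorem mu_two (a b : A.carrier) : A.mu [a, b] = -(A.shiftSign 1 a * b) := by
  simp [mu, cupWith_iota_cons, iota]

theorem mu_eq_zero {L : List A.carrier} (h : 3 ≤ L.length) : A.mu L = 0 := by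
  match L with
  | a :: b :: c :: L => simp [mu, cupWith_iota_cons, iota]

theorem ins_iota (s : ℤ) (y : List A.carrier → A.carrier) : ins s A.iota y = y := by
  funext L
  rw [ins, split3_eq_mid]
  · rfl
  · intro P Q R h
    refine iota_eq_zero fun h' => h ?_
    simp only [List.length_append, length_tw, List.length_cons] at h'
    exact List.eq_nil_of_length_eq_zero (by rw [List.length_append]; omega)

theorem slotLinear_mu : A.SlotLinear False A.mu :=
  (slotLinear_iota.comp A.d).sub (slotLinear_iota.cupWith _ 1 slotLinear_iota)

theorem hasDegree_mu : A.HasDegree A.gr 2 A.mu := by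
  refine HasDegree.sub (f := fun L => A.d (A.iota L)) (fun L e h => ?_)
    (hasDegree_iota.cupWith (fun h h' => SetLike.GradedMul.mul_mem h h') hasDegree_iota 1)
  have := A.d_mem (hasDegree_iota L e h)
  convert this using 2; ring

theorem twists_mu : A.Twists 1 A.mu := slotLinear_mu.twists hasDegree_mu

end DGAlgebra

namespace DGBimodule

variable {k : Type u} [Field k] {A : DGAlgebra.{u, v} k} (M : DGBimodule.{u, v, w} A)

open DGAlgebra

/-! ### The Hochschild differential in terms of insertions and cup products -/

theorem leftEnd_eq (p : ℤ) (f : List A.carrier → M.carrier) :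
    M.leftEnd p f = A.cupWith M.left p A.iota f := by
  funext L
  cases L with
  | nil => rw [cupWith_iota_nil]; rfl
  | cons a L => rw [cupWith_iota_cons]; rfl

theorem rightEnd_eq (f : List A.carrier → M.carrier) :
    M.rightEnd f = A.cupWith M.right 1 f A.iota := by
  funext L
  induction L using List.reverseRecOn with
  | nil => rw [cupWith_iota_right_nil]; rfl
  | append_singleton L a _ =>
    rw [cupWith_iota_concat]
    simp [rightEnd, tw]

/-- Since `mu` vanishes on words of length zero and of length at least three, each position
contributes only the differential of one letter and the product of two neighbours. -/
theorem ins_mu_eq {N : Prop} {f : List A.carrier → M.carrier} (hf : A.SlotLinear N f)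
    (L : List A.carrier) :
    ins 1 f A.mu L = (∑ i ∈ Finset.range L.length, M.dAt f L i) -
      ∑ i ∈ Finset.range (L.length - 1), M.mulAt f L i := by
  have h1 : ∀ i, i < L.length → splitSum (fun Q R => f (A.tw 1 (L.take i) ++ A.mu Q :: R))
      (L.drop i) = M.dAt f L i - M.mulAt f L i := by
    intro i hi
    unfold dAt mulAt
    rcases L.drop i with _ | ⟨a, _ | ⟨b, r⟩⟩
    · simp [hf.map_zero]
    · simp only [splitSum_cons, splitSum_nil, mu_nil, hf.map_zero, mu_one, zero_add, tw_def,
        sub_zero]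
    · rw [splitSum_cons, splitSum_cons]
      rw [mu_nil, hf.map_zero, mu_one, zero_add]
      have h3 : splitSum (fun P Q => f (A.tw 1 (L.take i) ++ A.mu (a :: b :: P) :: Q)) r =
          f (A.tw 1 (L.take i) ++ A.mu [a, b] :: r) := by
        cases r with
        | nil => rfl
        | cons c r =>
          rw [splitSum_cons, splitSum_eq_zero fun P Q _ => ?_, add_zero]
          rw [mu_eq_zero (by simp), hf.map_zero]
      rw [h3, mu_two, ← neg_one_smul k, hf.map_smul, neg_one_smul, ← sub_eq_add_neg]
      rfl
  -- The last letter has no right neighbour, so the sum of products may be extended by a zero term.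
  have h2 : ∀ i ∈ Finset.range L.length, i ∉ Finset.range (L.length - 1) →
      M.mulAt f L i = 0 := by
    intro i hi hi'
    simp only [Finset.mem_range] at hi hi'
    have h3 : (L.drop i).length = 1 := by simp; omega
    obtain ⟨a, ha⟩ := List.length_eq_one_iff.1 h3
    rw [mulAt, ha]
  rw [Finset.sum_subset (Finset.range_mono (Nat.sub_le L.length 1)) h2, ← Finset.sum_sub_distrib]
  unfold ins split3
  rw [splitSum_eq_sum, Finset.sum_range_succ]
  simp only [List.drop_length, splitSum_nil, mu_nil, hf.map_zero, add_zero]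
  exact Finset.sum_congr rfl fun i hi => h1 i (Finset.mem_range.1 hi)

/-- Translates the differential into insertions and cup products, the language of all later
computations. -/
theorem diff_eq {N : Prop} {f : List A.carrier → M.carrier} (hf : A.SlotLinear N f) (p : ℤ) :
    M.diff p f = M.d.compLeft _ f + (-1 : k) ^ p • ins 1 f A.mu - A.cupWith M.left p A.iota f +
      (-1 : k) ^ p • A.cupWith M.right 1 f A.iota := by
  funext L
  simp only [Pi.add_apply, Pi.sub_apply, Pi.smul_apply, M.ins_mu_eq hf, ← leftEnd_eq,
    ← rightEnd_eq]
  simp only [diff, LinearMap.coe_mk, AddHom.coe_mk, LinearMap.compLeft_apply, smul_sub]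
  have h : (M.d ∘ f) L = M.d (f L) := rfl
  rw [h]
  abel

/-- The Leibniz rule of `M` has a sign depending on the degree of the value of `x`; `sign_rule`
converts it into `(-1) ^ q` and a twist of the letters. -/
theorem compLeft_d_cupWith_left {N : Prop} {q : ℤ} {x : List A.carrier → A.carrier}
    (hx : A.SlotLinear N x) (hq : A.HasDegree A.gr q x) (p : ℤ) (f : List A.carrier → M.carrier) :
    M.d.compLeft _ (A.cupWith M.left p x f) = A.cupWith M.left p (A.d.compLeft _ x) f +
      (-1 : k) ^ q • A.cupWith M.left (p + 1) x (M.d.compLeft _ f) := by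
  funext L
  simp only [Pi.add_apply, Pi.smul_apply, cupWith_apply, LinearMap.compLeft_apply,
    Function.comp_apply, map_splitSum, ← splitSum_smul, ← splitSum_add]
  refine splitSum_congr fun P Q _ => ?_
  have := hx.sign_rule hq 1 0 (M.d ∘ₗ M.left.flip (f Q) - M.left.flip (f Q) ∘ₗ A.d)
    (M.left.flip (M.d (f Q))) (fun i a ha => by simp [M.leibniz_left ha]) (A.tw p P)
  simp only [LinearMap.sub_apply, LinearMap.comp_apply, LinearMap.flip_apply, one_mul,
    sub_zero, tw_tw] at this
  rw [sub_eq_iff_eq_add'.1 this, add_comm 1 p]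

theorem compLeft_d_cupWith_right {N : Prop} {p : ℤ} {f : List A.carrier → M.carrier}
    (hf : A.SlotLinear N f) (hp : A.HasDegree M.gr p f) (r : ℤ) (y : List A.carrier → A.carrier) :
    M.d.compLeft _ (A.cupWith M.right r f y) = A.cupWith M.right r (M.d.compLeft _ f) y +
      (-1 : k) ^ p • A.cupWith M.right (r + 1) f (A.d.compLeft _ y) := by
  funext L
  simp only [Pi.add_apply, Pi.smul_apply, cupWith_apply, LinearMap.compLeft_apply,
    Function.comp_apply, map_splitSum, ← splitSum_smul, ← splitSum_add]
  refine splitSum_congr fun P Q _ => ?_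
  have := hf.sign_rule hp 1 0 (M.d ∘ₗ M.right.flip (y Q) - M.right.flip (y Q) ∘ₗ M.d)
    (M.right.flip (A.d (y Q))) (fun i a ha => by simp [M.leibniz_right ha]) (A.tw r P)
  simp only [LinearMap.sub_apply, LinearMap.comp_apply, LinearMap.flip_apply, one_mul,
    sub_zero, tw_tw] at this
  rw [sub_eq_iff_eq_add'.1 this, add_comm 1 r]

theorem compLeft_d_d (f : List A.carrier → M.carrier) :
    M.d.compLeft _ (M.d.compLeft _ f) = 0 := funext fun _ => M.d_d _

end DGBimodule

/-! ### The equation mu ∘ mu = 0. -/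

namespace DGAlgebra

variable {k : Type u} [Field k] {A : DGAlgebra.{u, v} k}

theorem compLeft_d_cupWith {N : Prop} {q : ℤ} {x : List A.carrier → A.carrier}
    (hx : A.SlotLinear N x) (hq : A.HasDegree A.gr q x) (p : ℤ) (y : List A.carrier → A.carrier) :
    A.d.compLeft _ (A.cupWith (LinearMap.mul k _) p x y) =
      A.cupWith (LinearMap.mul k _) p (A.d.compLeft _ x) y +
      (-1 : k) ^ q • A.cupWith (LinearMap.mul k _) (p + 1) x (A.d.compLeft _ y) :=
  A.regular.compLeft_d_cupWith_left hx hq p y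

variable (A) in
/-- The Hochschild differential of cochains with values in `A`. -/
def hochschildDiff (p : ℤ) : (List A.carrier → A.carrier) →ₗ[k] (List A.carrier → A.carrier) :=
  A.regular.diff p

theorem hochschildDiff_eq {N : Prop} {f : List A.carrier → A.carrier} (hf : A.SlotLinear N f)
    (p : ℤ) :
    A.hochschildDiff p f = A.d.compLeft _ f + (-1 : k) ^ p • ins 1 f A.mu -
      A.cupWith (LinearMap.mul k _) p A.iota f +
      (-1 : k) ^ p • A.cupWith (LinearMap.mul k _) 1 f A.iota :=
  A.regular.diff_eq hf p

/-- On words of length one, two and three this is d² = 0, the Leibniz rule and associativity. -/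
theorem ins_mu_mu : ins 1 A.mu A.mu = 0 := by
  have hsl := slotLinear_iota (A := A)
  have hdd : A.d.compLeft (List A.carrier) (A.d.compLeft _ A.iota) = 0 := funext fun _ => A.d_d _
  have h1 : A.d.compLeft (List A.carrier) A.mu = - A.cupWith (LinearMap.mul k _) 1
      (A.d.compLeft _ A.iota) A.iota + A.cupWith (LinearMap.mul k _) (1 + 1) A.iota
        (A.d.compLeft _ A.iota) := by
    rw [mu, map_sub, hdd, compLeft_d_cupWith hsl hasDegree_iota, zpow_one, neg_one_smul]
    abel
  have h2 := cupWith_assoc (LinearMap.mul k A.carrier) (LinearMap.mul k A.carrier)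
    (LinearMap.mul k A.carrier) (LinearMap.mul k A.carrier) (fun a b c => mul_assoc a b c) 1 1
    A.iota A.iota A.iota
  have h3 := ins_cupWith (LinearMap.mul k A.carrier) 1 1 hsl A.iota (twists_mu (A := A))
  nth_rw 1 [mu]
  rw [ins_sub, ins_compLeft, ins_iota, h3, ins_iota, h1]
  have e1 : A.cupWith (LinearMap.mul k A.carrier) (1 + 1) A.iota A.mu =
      A.cupWith (LinearMap.mul k _) (1 + 1) A.iota (A.d.compLeft _ A.iota) -
      A.cupWith (LinearMap.mul k A.carrier) (1 + 1) A.iota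
        (A.cupWith (LinearMap.mul k A.carrier) 1 A.iota A.iota) := by
    rw [mu, map_sub]
  have e2 : A.cupWith (LinearMap.mul k A.carrier) 1 A.mu A.iota =
      A.cupWith (LinearMap.mul k _) 1 (A.d.compLeft _ A.iota) A.iota -
      A.cupWith (LinearMap.mul k A.carrier) 1
        (A.cupWith (LinearMap.mul k A.carrier) 1 A.iota A.iota) A.iota := by
    rw [mu, map_sub]; rfl
  rw [e1, e2, h2]
  simp only [mul_one, zpow_one, neg_one_smul]
  abel

theorem ins_mu_ins_mu {V : Type*} [AddCommGroup V] [Module k V] {N : Prop}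
    {f : List A.carrier → V} (hf : A.SlotLinear N f) : ins 1 (ins 1 f A.mu) A.mu = 0 := by
  funext L
  rw [ins_ins_self hf odd_one twists_mu, ins_mu_mu]
  simp [ins, hf.map_zero, split3]

end DGAlgebra

/-! ### The Hochschild differential squares to zero and is a derivation of cup products. -/

namespace DGBimodule

variable {k : Type u} [Field k] {A : DGAlgebra.{u, v} k} (M : DGBimodule.{u, v, w} A)

open DGAlgebra

theorem slotLinear_diff {N : Prop} {f : List A.carrier → M.carrier} (hf : A.SlotLinear N f)
    (p : ℤ) : A.SlotLinear False (M.diff p f) := by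
  have hf := hf.weaken (N' := False) (by simp)
  rw [M.diff_eq hf]
  exact (((hf.comp M.d).add ((hf.ins slotLinear_mu 1).smul _)).sub
    (slotLinear_iota.cupWith M.left p hf)).add ((hf.cupWith M.right 1 slotLinear_iota).smul _)

theorem hasDegree_diff {N : Prop} {f : List A.carrier → M.carrier} (hf : A.SlotLinear N f) {p : ℤ}
    (hp : A.HasDegree M.gr p f) : A.HasDegree M.gr (p + 1) (M.diff p f) := by
  rw [M.diff_eq hf]
  have h1 : A.HasDegree M.gr (p + 1) (M.d.compLeft _ f) := fun L e hL => by
    have := M.d_mem (hp L e hL)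
    rwa [add_right_comm] at this
  have h2 := hp.ins hasDegree_mu 1
  rw [show p + 2 - 1 = p + 1 by ring] at h2
  have h3 := hasDegree_iota.cupWith (β := M.left) M.left_mem hp p
  rw [add_comm 1 p] at h3
  exact ((h1.add (h2.smul _)).sub h3).add ((hp.cupWith M.right_mem hasDegree_iota 1).smul _)

/-- The double insertion of `mu` vanishes. The terms with actions cancel by the Leibniz rules and
associativity, after `mu` has been inserted into the products by `ins_cupWith`. -/
theorem diff_diff {N : Prop} {f : List A.carrier → M.carrier} (hf : A.SlotLinear N f) {p : ℤ}
    (hp : A.HasDegree M.gr p f) : M.diff (p + 1) (M.diff p f) = 0 := by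
  rw [M.diff_eq (M.slotLinear_diff hf p), M.diff_eq hf]
  have hι := slotLinear_iota (A := A)
  have hz : (-1 : k) ^ p * (-1 : k) ^ p = 1 := neg_one_zpow_mul_self p
  have a1 := M.compLeft_d_cupWith_left hι hasDegree_iota p f
  have a2 := M.compLeft_d_cupWith_right hf hp 1 A.iota
  have a3 := ins_cupWith M.left p 1 hι f twists_mu
  have a4 := ins_cupWith M.right 1 1 hf A.iota twists_mu
  have a5 := ins_mu_ins_mu hf
  have a6 := cupWith_assoc (LinearMap.mul k _) M.left M.left M.left M.mul_left 1 p A.iota A.iota f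
  have a7 := cupWith_assoc M.right M.right (LinearMap.mul k _) M.right
    (fun x a b => (M.right_mul x a b).symm) 1 1 f A.iota A.iota
  have a8 := cupWith_assoc M.left M.right M.right M.left M.left_right p 1 A.iota f A.iota
  have a9 : A.cupWith M.left p A.mu f = A.cupWith M.left p (A.d.compLeft _ A.iota) f -
      A.cupWith M.left p (A.cupWith (LinearMap.mul k _) 1 A.iota A.iota) f := by
    rw [mu, map_sub, LinearMap.sub_apply]
  have a10 : A.cupWith M.right 2 f A.mu = A.cupWith M.right 2 f (A.d.compLeft _ A.iota) -
      A.cupWith M.right 2 f (A.cupWith (LinearMap.mul k _) 1 A.iota A.iota) := by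
    rw [mu, map_sub]
  rw [ins_iota, mul_one] at a3
  rw [ins_iota] at a4
  rw [add_comm 1 p] at a6
  simp only [show (1 : ℤ) + 1 = 2 by norm_num] at a2 a4 a7
  simp only [map_add, map_sub, map_smul, LinearMap.add_apply, LinearMap.sub_apply,
    LinearMap.smul_apply, ins_add, ins_sub, ins_smul, ins_compLeft, M.compLeft_d_d, a1, a2, a3,
    a4, a5, a7, a8, a9, a10, ← a6, smul_add, smul_sub, smul_smul, ← neg_neg_one_zpow, hz, neg_smul,
    zpow_one, one_smul, neg_mul, mul_one, smul_zero, neg_neg]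
  abel

/-- The Leibniz rule for the cup product with a cochain with values in a bimodule. -/
theorem diff_cupWith {N : Prop} {q p : ℤ} {x : List A.carrier → A.carrier}
    (hx : A.SlotLinear N x) (hq : A.HasDegree A.gr q x) {f : List A.carrier → M.carrier}
    (hf : A.SlotLinear N f) :
    M.diff (q + p) (A.cupWith M.left p x f) =
      A.cupWith M.left p (A.hochschildDiff q x) f +
        (-1 : k) ^ q • A.cupWith M.left (p + 1) x (M.diff p f) := by
  rw [M.diff_eq (hx.cupWith M.left p hf), M.diff_eq hf,
    hochschildDiff_eq hx]
  have a1 := M.compLeft_d_cupWith_left hx hq p f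
  have a2 := ins_cupWith M.left p 1 hx f twists_mu
  have a3 := cupWith_assoc (LinearMap.mul k _) M.left M.left M.left M.mul_left q p A.iota x f
  have a4 := cupWith_assoc M.left M.right M.right M.left M.left_right p 1 x f A.iota
  -- A letter between `x` and `f` can multiply `x` from the right or act on `f` from the left; these
  -- two terms, one from each differential, cancel.
  have a5 := cupWith_assoc (LinearMap.mul k _) M.left M.left M.left M.mul_left 1 p x A.iota f
  rw [mul_one] at a2
  rw [add_comm 1 p] at a5
  have hz : (-1 : k) ^ p * (-1 : k) ^ p = 1 := neg_one_zpow_mul_self p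
  have hz' : (-1 : k) ^ q * (-1 : k) ^ p * (-1 : k) ^ p = (-1 : k) ^ q := by rw [mul_assoc, hz, mul_one]
  simp only [map_add, map_sub, map_smul, LinearMap.add_apply, LinearMap.sub_apply,
    LinearMap.smul_apply]
  rw [a1, a2, a4, a5, ← a3]
  simp only [smul_add, smul_sub, smul_smul, ← neg_one_zpow_mul, hz']
  abel

end DGBimodule

namespace DGAlgebra

variable {k : Type u} [Field k] {A : DGAlgebra.{u, v} k}

/-! ### Identities between cochains with values in `A` -/

theorem ins_mu_left {N : Prop} {f : List A.carrier → A.carrier} (hf : A.SlotLinear N f) {p : ℤ}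
    (hp : A.HasDegree A.gr p f) (s : ℤ) (hs : Even (s - (p + 1))) :
    ins s A.mu f = A.d.compLeft _ f - A.cupWith (LinearMap.mul k _) p A.iota f +
      (-1 : k) ^ p • A.cupWith (LinearMap.mul k _) 1 f A.iota := by
  have h := ins_cupWith (LinearMap.mul k A.carrier) 1 s slotLinear_iota A.iota (hf.twists hp)
  have e : Even (1 + s - p) := by
    rw [Int.even_iff] at *; omega
  rw [mu, ins_sub, ins_compLeft, ins_iota, h, ins_iota, cupWith_congr _ e, one_mul,
    ← sub_sub, sub_eq_add_neg (_ - _), ← neg_smul, neg_neg_one_zpow, sub_add_cancel]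

/-- With values in A the actions are products, so the outer terms of the differential are the
insertion of `f` into `mu`: the differential is the bracket with `mu`. -/
theorem hochschildDiff_eq_ins {N : Prop} {f : List A.carrier → A.carrier}
    (hf : A.SlotLinear N f) {p : ℤ} (hp : A.HasDegree A.gr p f) (s : ℤ)
    (hs : Even (s - (p + 1))) :
    A.hochschildDiff p f = ins s A.mu f + (-1 : k) ^ p • ins 1 f A.mu := by
  rw [ins_mu_left hf hp s hs, hochschildDiff_eq hf]
  abel

theorem SlotLinear.twists' {N : Prop} {y : List A.carrier → A.carrier} (hy : A.SlotLinear N y)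
    {q : ℤ} (hq : A.HasDegree A.gr q y) : A.Twists (q + 1) y :=
  (hy.twists hq).congr (by rw [show q - 1 - (q + 1) = -2 by ring]; decide)

/-- The homotopy for the commutativity of the cup product. -/
theorem hochschildDiff_ins {N : Prop} {x y : List A.carrier → A.carrier}
    (hx : A.SlotLinear N x) (hy : A.SlotLinear N y)
    {p q : ℤ} (hq : A.HasDegree A.gr q y) :
    A.hochschildDiff (p + q - 1) (ins (q + 1) x y) =
      ins (q + 1) (A.hochschildDiff p x) y -
      (-1 : k) ^ p • ins (q + 1 + 1) x (A.hochschildDiff q y) +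
      (-1 : k) ^ (p * (q + 1)) • A.cupWith (LinearMap.mul k _) p y x -
      (-1 : k) ^ p • A.cupWith (LinearMap.mul k _) q x y := by
  have hx' := hx.weaken (N' := False) (by simp)
  have hy' := hy.weaken (N' := False) (by simp)
  -- The nested terms of the pre-Lie identity combine to the insertion of the differential of `y`
  -- into `x`, by `k2`.
  have key : ins (q + 1) (ins 1 x A.mu) y = _ := funext (ins_ins hx (hy.twists' hq) twists_mu)
  have k2 : ins (q + 1 + 1) x (A.hochschildDiff q y) = ins (q + 1 + 1) x (ins (q + 1) A.mu y) +
      (-1 : k) ^ q • ins (q + 1 + 1) x (ins 1 y A.mu) := by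
    rw [hochschildDiff_eq_ins hy hq (q + 1) (by simp), hx.ins_add_right, hx.ins_smul_right]
  -- Inserting `y` into the separate letter of `iota` ∪ x and of x ∪ `iota` produces y ∪ x and x ∪
  -- y; these have no counterpart in the differential of the insertion.
  have k3 := ins_cupWith (LinearMap.mul k A.carrier) p (q + 1) slotLinear_iota x (hy.twists' hq)
  have k4 := ins_cupWith (LinearMap.mul k A.carrier) 1 (q + 1) hx A.iota (hy.twists' hq)
  rw [ins_iota] at k3 k4
  rw [hochschildDiff_eq (hx.ins hy _), hochschildDiff_eq hx, k2]
  simp only [ins_add, ins_sub, ins_smul, ins_compLeft, key, k3, k4]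
  rw [cupWith_congr _ (show Even (p + q - 1 - (p + (q + 1))) by
    rw [show p + q - 1 - (p + (q + 1)) = -2 by ring]; decide),
    cupWith_congr _ (show Even (1 + (q + 1) - q) by
      rw [show 1 + (q + 1) - q = 2 by ring]; decide), add_comm 1 (q + 1)]
  funext L
  simp only [Pi.add_apply, Pi.sub_apply, Pi.smul_apply, mul_one]
  rcases Int.even_or_odd p with hp | hp <;> rcases Int.even_or_odd q with hq | hq <;>
  simp [hp.neg_one_zpow, hq.neg_one_zpow, zpow_add₀, zpow_sub₀, zpow_mul] <;> abel

theorem gerstenhaberBracket_eq (p q : ℤ) (x y : List A.carrier → A.carrier) :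
    A.gerstenhaberBracket p q x y =
      ins (q + 1) x y - (-1 : k) ^ ((p + 1) * (q + 1)) • ins (p + 1) y x := by
  rw [gerstenhaberBracket, circ_eq, circ_eq]

/-- The cup products in the two instances of `hochschildDiff_ins` cancel under antisymmetrization.
-/
theorem hochschildDiff_gerstenhaberBracket {N : Prop} {x y : List A.carrier → A.carrier}
    (hx : A.SlotLinear N x) (hy : A.SlotLinear N y)
    {p q : ℤ} (hp : A.HasDegree A.gr p x) (hq : A.HasDegree A.gr q y) :
    A.hochschildDiff (p + q - 1) (A.gerstenhaberBracket p q x y) =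
      A.gerstenhaberBracket (p + 1) q (A.hochschildDiff p x) y -
      (-1 : k) ^ p • A.gerstenhaberBracket p (q + 1) x (A.hochschildDiff q y) := by
  have h := hochschildDiff_ins hy hx (p := q) hp
  rw [add_comm q p] at h
  simp only [gerstenhaberBracket_eq, map_sub, map_smul, hochschildDiff_ins hx hy (p := p) hq, h]
  funext L
  simp only [Pi.add_apply, Pi.sub_apply, Pi.smul_apply]
  rcases Int.even_or_odd p with hp | hp <;> rcases Int.even_or_odd q with hq | hq <;>
  simp [hp.neg_one_zpow, hq.neg_one_zpow, zpow_add₀, zpow_mul] <;> abel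

theorem SlotLinear.gerstenhaberBracket {N : Prop} {x y : List A.carrier → A.carrier}
    (hx : A.SlotLinear N x) (hy : A.SlotLinear N y) (p q : ℤ) :
    A.SlotLinear N (A.gerstenhaberBracket p q x y) := by
  rw [gerstenhaberBracket_eq]
  exact (hx.ins hy _).sub ((hy.ins hx _).smul _)

theorem HasDegree.gerstenhaberBracket {x y : List A.carrier → A.carrier}
    {p q : ℤ} (hp : A.HasDegree A.gr p x) (hq : A.HasDegree A.gr q y) :
    A.HasDegree A.gr (p + q - 1) (A.gerstenhaberBracket p q x y) := by
  rw [gerstenhaberBracket_eq]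
  refine (hp.ins hq _).sub (HasDegree.smul ?_ _)
  rw [add_comm p q]
  exact hq.ins hp _

theorem gerstenhaberBracket_antisymm (p q : ℤ) (x y : List A.carrier → A.carrier) :
    A.gerstenhaberBracket p q x y =
      -((-1 : k) ^ ((p - 1) * (q - 1)) • A.gerstenhaberBracket q p y x) := by
  rw [gerstenhaberBracket_eq, gerstenhaberBracket_eq, smul_sub, smul_smul, neg_one_zpow_mul,
    neg_one_zpow_congr (k := k) (a := (p - 1) * (q - 1) + (q + 1) * (p + 1)) (b := 0),
    neg_one_zpow_congr (k := k) (a := (p - 1) * (q - 1)) (b := (p + 1) * (q + 1)), zpow_zero,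
    one_smul, neg_sub]
  · rw [show (p - 1) * (q - 1) - (p + 1) * (q + 1) = 2 * (-(p + q)) by ring]
    exact even_two_mul _
  · rw [show (p - 1) * (q - 1) + (q + 1) * (p + 1) - 0 = 2 * (p * q + 1) by ring]
    exact even_two_mul _

/-- By the pre-Lie identity the associator of insertion is graded symmetric in the two inserted
functions; three instances give the Jacobi identity. -/
theorem gerstenhaberBracket_jacobi {N : Prop} {x y z : List A.carrier → A.carrier}
    (hx : A.SlotLinear N x) (hy : A.SlotLinear N y) (hz : A.SlotLinear N z) {p q r : ℤ}
    (hp : A.HasDegree A.gr p x) (hq : A.HasDegree A.gr q y) (hr : A.HasDegree A.gr r z) :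
    A.gerstenhaberBracket (p + q - 1) r (A.gerstenhaberBracket p q x y) z =
      A.gerstenhaberBracket p (q + r - 1) x (A.gerstenhaberBracket q r y z) -
      (-1 : k) ^ ((p - 1) * (q - 1)) •
        A.gerstenhaberBracket q (p + r - 1) y (A.gerstenhaberBracket p r x z) := by
  have h1 : ins (q + 1) (ins (r + 1) x z) y = _ :=
    funext (ins_ins hx (hy.twists' hq) (hz.twists' hr))
  have h2 : ins (p + 1) (ins (r + 1) y z) x = _ :=
    funext (ins_ins hy (hx.twists' hp) (hz.twists' hr))
  have h3 : ins (q + 1) (ins (p + 1) z x) y = _ :=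
    funext (ins_ins hz (hy.twists' hq) (hx.twists' hp))
  simp only [gerstenhaberBracket_eq, ins_sub, ins_smul, hx.ins_sub_right, hy.ins_sub_right,
    hz.ins_sub_right, hx.ins_smul_right, hy.ins_smul_right, hz.ins_smul_right]
  -- The shifted degree of a bracket has the parity of the sum of the shifted degrees of its
  -- arguments.
  rw [ins_congr (t := p + 1 + (q + 1)) (show Even (p + q - 1 + 1 - (p + 1 + (q + 1))) by
      rw [show p + q - 1 + 1 - (p + 1 + (q + 1)) = -2 by ring]; decide),
    ins_congr (t := p + 1 + (q + 1)) (show Even (p + q - 1 + 1 - (p + 1 + (q + 1))) by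
      rw [show p + q - 1 + 1 - (p + 1 + (q + 1)) = -2 by ring]; decide),
    ins_congr (t := q + 1 + (r + 1)) (show Even (q + r - 1 + 1 - (q + 1 + (r + 1))) by
      rw [show q + r - 1 + 1 - (q + 1 + (r + 1)) = -2 by ring]; decide),
    ins_congr (t := q + 1 + (r + 1)) (show Even (q + r - 1 + 1 - (q + 1 + (r + 1))) by
      rw [show q + r - 1 + 1 - (q + 1 + (r + 1)) = -2 by ring]; decide),
    ins_congr (t := p + 1 + (r + 1)) (show Even (p + r - 1 + 1 - (p + 1 + (r + 1))) by
      rw [show p + r - 1 + 1 - (p + 1 + (r + 1)) = -2 by ring]; decide),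
    ins_congr (t := p + 1 + (r + 1)) (show Even (p + r - 1 + 1 - (p + 1 + (r + 1))) by
      rw [show p + r - 1 + 1 - (p + 1 + (r + 1)) = -2 by ring]; decide), h1, h2, h3]
  funext L
  simp only [Pi.sub_apply, Pi.smul_apply, add_comm (r + 1), add_comm (q + 1) (p + 1)]
  rcases Int.even_or_odd p with hp | hp <;> rcases Int.even_or_odd q with hq | hq <;>
    rcases Int.even_or_odd r with hr | hr <;>
  simp [hp.neg_one_zpow, hq.neg_one_zpow, hr.neg_one_zpow, zpow_add₀, zpow_sub₀, zpow_mul] <;> abel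

/-! ### The homotopy for the Leibniz rule -/

theorem insMid_cons {V : Type*} [AddCommGroup V] [Module k V] (s : ℤ)
    (h : List A.carrier → A.carrier → List A.carrier → V)
    (y : List A.carrier → A.carrier) (a : A.carrier) (L : List A.carrier) :
    insMid s h y (a :: L) = splitSum (fun Q R => h [] (y Q) R) (a :: L) +
      insMid s (fun U b M => h (A.shiftSign s a :: U) b M) y L := rfl

/-- An insertion evaluates the outer function only on words that contain the inserted letter, hence
never on the empty word. -/
theorem ins_congr_left {V : Type*} [AddCommGroup V] [Module k V] {s : ℤ}
    {x x' : List A.carrier → V} (h : ∀ L, L ≠ [] → x L = x' L)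
    (y : List A.carrier → A.carrier) : ins s x y = ins s x' y :=
  funext fun _ => split3_congr fun _ _ _ _ => h _ (by simp)

theorem insAfter_iota_cup_nil (s p : ℤ) (x z : List A.carrier → A.carrier) (b : A.carrier)
    (M : List A.carrier) :
    insAfter s z (A.cupWith (LinearMap.mul k _) p A.iota x) [] b M =
      A.shiftSign (p + s) b * ins s x z M := by
  simp only [insAfter, ins, tw_nil, List.nil_append, cupWith_iota_cons, shiftSign_shiftSign]
  exact (map_split3 (LinearMap.mul k A.carrier _) _ _).symm

theorem insAfter_iota_cup_cons (s p : ℤ) (x z : List A.carrier → A.carrier) (u b : A.carrier)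
    (U M : List A.carrier) :
    insAfter s z (A.cupWith (LinearMap.mul k _) p A.iota x) (u :: U) b M =
      A.shiftSign (p + s) u * insAfter s z x U b M := by
  simp only [insAfter, ins, tw_cons, List.cons_append, cupWith_iota_cons, shiftSign_shiftSign]
  exact (map_split3 (LinearMap.mul k A.carrier _) _ _).symm

/-- The factor `iota` takes the last letter of the outer word, which is either the value of `z` or
an original letter behind it. -/
theorem insAfter_cup_iota {N : Prop} (s : ℤ) {c : ℤ} {x z : List A.carrier → A.carrier}
    (hx : A.SlotLinear N x) (hc : A.Twists c z) (U : List A.carrier) (b : A.carrier)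
    (M : List A.carrier) :
    insAfter s z (A.cupWith (LinearMap.mul k _) 1 x A.iota) U b M =
      A.cupWith (LinearMap.mul k _) (1 + s) (fun N => x (A.tw (1 + s) U ++
        A.shiftSign (1 + s) b :: N)) z M +
      (-1 : k) ^ c • A.cupWith (LinearMap.mul k _) 1 (fun M => insAfter s z x (A.tw 1 U)
        (A.shiftSign 1 b) M) A.iota M := by
  have h0 : A.SlotLinear N (fun L => x (A.tw (1 + s) U ++ A.shiftSign (1 + s) b :: L)) :=
    (hx.append_left (A.tw (1 + s) U)).cons (A.shiftSign (1 + s) b)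
  have h1 := ins_cupWith (LinearMap.mul k A.carrier) 1 s h0 A.iota hc
  rw [ins_iota, one_mul] at h1
  have h2 : insAfter s z (A.cupWith (LinearMap.mul k _) 1 x A.iota) U b M =
      ins s (A.cupWith (LinearMap.mul k _) 1 (fun L => x (A.tw (1 + s) U ++
        A.shiftSign (1 + s) b :: L)) A.iota) z M := by
    -- The word behind `b` is nonempty, so the last letter split off is never `b` itself.
    refine congrFun (ins_congr_left (V := A.carrier) (fun L hL => ?_) z) M
    induction L using List.reverseRecOn with
    | nil => exact absurd rfl hL
    | append_singleton L a _ =>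
      rw [cupWith_iota_concat, ← List.cons_append, ← List.append_assoc, cupWith_iota_concat]
      simp [shiftSign_shiftSign]
  rw [h2, h1]
  simp only [Pi.add_apply, Pi.smul_apply, insAfter, tw_tw, shiftSign_shiftSign, add_comm s 1]

/-- The first letter of the outer word is an original one or the value of `y`; the latter case is y
∪ (x ∘ z). -/
theorem insMid_iota_cup (s t p : ℤ) {c : ℤ} {x y z : List A.carrier → A.carrier}
    (hc : A.Twists c y) :
    insMid s (insAfter t z (A.cupWith (LinearMap.mul k _) p A.iota x)) y =
      A.cupWith (LinearMap.mul k _) (p + t + s) A.iota (insMid s (insAfter t z x) y) +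
      (-1 : k) ^ ((p + t) * c) • A.cupWith (LinearMap.mul k _) (p + t) y (ins t x z) := by
  funext L
  have h1 : ∀ L, splitSum (fun Q R => insAfter t z (A.cupWith (LinearMap.mul k _) p A.iota x)
      [] (y Q) R) L =
      (-1 : k) ^ ((p + t) * c) • A.cupWith (LinearMap.mul k _) (p + t) y (ins t x z) L := by
    intro L
    simp only [insAfter_iota_cup_nil, hc (p + t), smul_mul_assoc, splitSum_smul]
    rfl
  cases L with
  | nil =>
    rw [Pi.add_apply, Pi.smul_apply, cupWith_iota_nil, zero_add, ← h1]
    rfl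
  | cons a L =>
    rw [insMid_cons, h1, Pi.add_apply, Pi.smul_apply, cupWith_iota_cons, add_comm]
    congr 1
    simp only [insMid, insAfter_iota_cup_cons, shiftSign_shiftSign]
    exact (map_split3 (LinearMap.mul k A.carrier _) _ _).symm

/-- The mirror case: the last letter is the value of `z`, which gives (x ∘ y) ∪ z, or an original
one. -/
theorem insMid_cup_iota {N N' : Prop} (s t : ℤ) {c c' : ℤ} {x y z : List A.carrier → A.carrier}
    (hx : A.SlotLinear N x) (hz : A.SlotLinear N' z) (hc : A.Twists c y) (hc' : A.Twists c' z) :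
    insMid s (insAfter t z (A.cupWith (LinearMap.mul k _) 1 x A.iota)) y =
      (-1 : k) ^ ((1 + t) * c) • A.cupWith (LinearMap.mul k _) (1 + t) (ins s x y) z +
      (-1 : k) ^ (c + c') • A.cupWith (LinearMap.mul k _) 1 (insMid s (insAfter t z x) y) A.iota := by
  funext L
  have hT := TriLinear.insAfter hz hx t
  simp only [insMid, insAfter_cup_iota t hx hc', split3_add, split3_smul, cupWith_apply,
    Pi.add_apply, Pi.smul_apply]
  rw [split3_split_last (fun P Q R₁ R₂ => LinearMap.mul k A.carrier (x (A.tw (1 + t) (A.tw s P) ++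
    A.shiftSign (1 + t) (y Q) :: A.tw (1 + t) R₁)) (z R₂)),
    split3_split_last (fun P Q R₁ R₂ => LinearMap.mul k A.carrier (insAfter t z x
      (A.tw 1 (A.tw s P)) (A.shiftSign 1 (y Q)) (A.tw 1 R₁)) (A.iota R₂))]
  simp only [hc (1 + t), hc 1, hx.map_smul, hT.mid_smul, map_smul, LinearMap.smul_apply,
    split3_smul, splitSum_smul, ins, split3_tw, map_split3, split3_linearMap_apply, tw_tw,
    add_comm s, smul_smul, neg_one_zpow_mul, one_mul, add_comm c c']

/-- As `mu` takes at most two letters, these must be `b` and the value of `z` on the whole of `M`.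
-/
theorem insAfter_mu_nil (s : ℤ) (z : List A.carrier → A.carrier) (b : A.carrier)
    (M : List A.carrier) :
    insAfter s z A.mu [] b M = -(A.shiftSign (1 + s) b * z M) := by
  rw [insAfter, ins, split3_eq_mid]
  · simp [shiftSign_shiftSign]
  · intro P Q R h
    refine mu_eq_zero ?_
    have := List.length_pos_iff.2 h
    simp only [List.length_append] at this
    simp only [tw_nil, List.nil_append, List.length_cons, List.length_append, length_tw]
    omega

theorem insAfter_mu_of_ne_nil (s : ℤ) (z : List A.carrier → A.carrier) {U : List A.carrier}
    (hU : U ≠ []) (b : A.carrier) (M : List A.carrier) :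
    insAfter s z A.mu U b M = 0 := by
  rw [insAfter, ins]
  refine splitSum_eq_zero fun P Q _ => splitSum_eq_zero fun Q R _ => mu_eq_zero ?_
  have := List.length_pos_iff.2 hU
  simp only [List.length_cons, List.length_append, length_tw]
  omega

theorem insAround_mu {V : Type*} [AddCommGroup V] [Module k V] {N : Prop} (t : ℤ)
    {x : List A.carrier → V} {z : List A.carrier → A.carrier}
    (hx : A.SlotLinear N x) (U : List A.carrier) (b : A.carrier) (M : List A.carrier) :
    insAround t 1 z A.mu x U b M = -splitSum (fun M₁ M₂ =>
      x (A.tw (1 + t) U ++ (A.shiftSign (1 + t) b * z M₁) :: M₂)) M := by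
  rw [insAround, splitSum_eq_left, ← splitSum_neg]
  · simp only [insAfter_mu_nil, hx.map_neg]
  · intro P Q hQ
    refine splitSum_eq_zero fun _ _ _ => ?_
    rw [insAfter_mu_of_ne_nil _ _ hQ, hx.map_zero]

/-- When `mu` multiplies the values of `y` and `z`, these are adjacent and form one letter y ∪ z of
`x`. This is the source of x ∘ (y ∪ z) in the Leibniz rule. -/
theorem insMid_insAround_mu {N : Prop} (s t : ℤ) {c : ℤ} {x y z : List A.carrier → A.carrier}
    (hx : A.SlotLinear N x) (hc : A.Twists c y) :
    insMid s (insAround t 1 z A.mu x) y =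
      -((-1 : k) ^ ((1 + t) * c) •
        ins (1 + t + s) x (A.cupWith (LinearMap.mul k _) (1 + t) y z)) := by
  funext L
  have h : ∀ P R L, x (P ++ splitSum (fun Q R₁ => y (A.tw (1 + t) Q) * z R₁) L :: R) =
      splitSum (fun Q R₁ => x (P ++ (y (A.tw (1 + t) Q) * z R₁) :: R)) L := by
    intro P R L
    simp only [← hx.slot_apply, map_splitSum]
  simp only [insMid, insAround_mu t hx, Pi.neg_apply, Pi.smul_apply, ins, cupWith_apply,
    LinearMap.mul_apply', h, ← splitSum_neg, ← split3_smul, ← splitSum_smul]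
  rw [split3_split_right (fun P Q R₁ R₂ => -x (A.tw (1 + t) (A.tw s P) ++
    (A.shiftSign (1 + t) (y Q) * z R₁) :: R₂))]
  simp only [hc (1 + t), smul_mul_assoc, hx.map_smul, tw_tw, split3, splitSum_neg, splitSum_smul]

section Linearity

variable {V : Type*} [AddCommGroup V] [Module k V] {W : Type*} [AddCommGroup W] [Module k W]

theorem insMid_sub (s : ℤ) (h h' : List A.carrier → A.carrier → List A.carrier → V)
    (y : List A.carrier → A.carrier) : insMid s (h - h') y = insMid s h y - insMid s h' y :=
  funext fun _ => split3_sub _ _ _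

theorem insMid_smul (s : ℤ) (c : k) (h : List A.carrier → A.carrier → List A.carrier → V)
    (y : List A.carrier → A.carrier) : insMid s (c • h) y = c • insMid s h y :=
  funext fun _ => split3_smul _ _ _

theorem TriLinear.insMid_smul_right {h : List A.carrier → A.carrier → List A.carrier → V}
    (hh : A.TriLinear h) (s : ℤ) (c : k) (y : List A.carrier → A.carrier) :
    insMid s h (c • y) = c • insMid s h y := by
  funext L
  simp only [insMid, Pi.smul_apply, hh.mid_smul, split3_smul]

theorem insAfter_sub (s : ℤ) (z : List A.carrier → A.carrier) (x x' : List A.carrier → V) :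
    insAfter s z (x - x') = insAfter s z x - insAfter s z x' :=
  funext fun _ => funext fun _ => funext fun _ => split3_sub _ _ _

theorem insAfter_smul (s : ℤ) (z : List A.carrier → A.carrier) (c : k) (x : List A.carrier → V) :
    insAfter s z (c • x) = c • insAfter s z x :=
  funext fun _ => funext fun _ => funext fun _ => split3_smul _ _ _

theorem insAfter_compLeft (s : ℤ) (φ : V →ₗ[k] W) (z : List A.carrier → A.carrier)
    (x : List A.carrier → V) :
    insAfter s z (φ.compLeft _ x) = fun U b M => φ (insAfter s z x U b M) :=
  funext fun _ => funext fun _ => funext fun _ => (map_split3 φ _ _).symm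

theorem SlotLinear.insAfter_smul_left {N : Prop} {x : List A.carrier → V}
    (hx : A.SlotLinear N x) (s : ℤ) (c : k) (z : List A.carrier → A.carrier) :
    insAfter s (c • z) x = c • insAfter s z x :=
  funext fun U => funext fun b => congrArg (· : _ → List A.carrier → V) (
    ((hx.append_left (A.tw s U)).cons (A.shiftSign s b)).ins_smul_right s c z)

/-- Insertion of the structure maps after that of a cocycle `z`. -/
theorem star_insAfter_mu {N N' : Prop} {x : List A.carrier → V} {z : List A.carrier → A.carrier}
    (hx : A.SlotLinear N x) (hz : A.SlotLinear N' z) {r : ℤ} (hr : A.HasDegree A.gr r z)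
    (dz : A.hochschildDiff r z = 0) :
    star 1 (insAfter (r + 1) z x) A.mu =
      (-1 : k) ^ (r + 1) • (insAfter (r + 1) z (ins 1 x A.mu) - insAround (r + 1) 1 z A.mu x) := by
  -- For a cocycle, inserting `mu` into `z` and `z` into `mu` agree up to sign, so the last two
  -- terms of `star_insAfter` cancel.
  have h : ins 1 z A.mu = -((-1 : k) ^ r • ins (r + 1) A.mu z) := by
    rw [hochschildDiff_eq_ins hz hr (r + 1) (by simp), add_eq_zero_iff_eq_neg] at dz
    rw [dz, smul_neg, smul_smul, neg_one_zpow_mul_self, one_smul, neg_neg]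
  funext U b M
  rw [star_insAfter hx (hz.twists' hr) twists_mu, h, ← neg_smul, hx.insAfter_smul_left,
    mul_one, add_comm 1 (r + 1), neg_neg_one_zpow]
  simp only [Pi.smul_apply, Pi.sub_apply, add_sub_cancel_right]

/-- Insertion of a cocycle `y` after that of the structure maps. -/
theorem insMid_star_mu {N : Prop} {h : List A.carrier → A.carrier → List A.carrier → V}
    (hh : A.TriLinear h) {y : List A.carrier → A.carrier} (hy : A.SlotLinear N y) {q : ℤ}
    (hq : A.HasDegree A.gr q y) (dy : A.hochschildDiff q y = 0) :
    insMid (q + 1) (star 1 h A.mu) y = (-1 : k) ^ (q + 1) • ins 1 (insMid (q + 1) h y) A.mu := by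
  have h : ins (q + 1) A.mu y = -((-1 : k) ^ q • ins 1 y A.mu) := by
    rwa [hochschildDiff_eq_ins hy hq (q + 1) (by simp), add_eq_zero_iff_eq_neg] at dy
  funext L
  rw [insMid_star hh (hy.twists' hq) twists_mu, h, ← neg_smul, hh.insMid_smul_right,
    mul_one, add_comm 1 (q + 1), neg_neg_one_zpow]
  simp only [Pi.smul_apply, smul_sub, sub_add_cancel]

end Linearity

theorem SlotLinear.insMid_insAfter {V : Type*} [AddCommGroup V] [Module k V] {N : Prop}
    {x : List A.carrier → V} {y z : List A.carrier → A.carrier} (hx : A.SlotLinear N x)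
    (hy : A.SlotLinear N y) (hz : A.SlotLinear N z) (s t : ℤ) :
    A.SlotLinear N (insMid s (insAfter t z x) y) := by
  refine SlotLinear.split3 (fun Q R => ?_) (fun P R l r => ?_) (fun P Q => ?_)
  · exact (hx.insAfter_left z t (y Q) R).tw s
  · obtain ⟨g, hg⟩ := (TriLinear.insAfter hz hx t).mid (A.tw s P) R
    exact ⟨g ∘ₗ hy.slot l r, fun hN => by simp [hy.slot_one l r hN],
      fun a => by simp [hg, hy.slot_apply]⟩
  · exact (((hx.append_left _).cons _)).ins hz t

theorem HasDegree.insMid_insAfter {V : Type*} [AddCommGroup V] [Module k V]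
    {gr : ℤ → Submodule k V} {p q r : ℤ}
    {x : List A.carrier → V} {y z : List A.carrier → A.carrier} (hx : A.HasDegree gr p x)
    (hy : A.HasDegree A.gr q y) (hz : A.HasDegree A.gr r z) (s t : ℤ) :
    A.HasDegree gr (p + q + r - 2) (insMid s (insAfter t z x) y) := by
  intro L e hL
  refine HasDegree.split3_mem hL fun P Q R e₁ e₂ e₃ h₁ h₂ h₃ he => ?_
  refine HasDegree.split3_mem h₃ fun P' Q' R' e₄ e₅ e₆ h₄ h₅ h₆ he' => ?_
  have := hx _ _ (((h₁.tw s).tw t).append (.cons (shiftSign_mem t (hy _ _ h₂))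
    ((h₄.tw t).append (.cons (hz _ _ h₅) h₆))))
  rw [he, he']
  convert this using 2
  simp only [shiftedDegree_append, shiftedDegree_cons]
  ring

/-- The homotopy for the Leibniz rule of the bracket, on cocycles. -/
theorem hochschildDiff_insMid_insAfter {N : Prop} {x y z : List A.carrier → A.carrier}
    (hx : A.SlotLinear N x) (hy : A.SlotLinear N y) (hz : A.SlotLinear N z) {p q r : ℤ}
    (hq : A.HasDegree A.gr q y) (hr : A.HasDegree A.gr r z)
    (dx : A.hochschildDiff p x = 0) (dy : A.hochschildDiff q y = 0)
    (dz : A.hochschildDiff r z = 0) :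
    A.hochschildDiff (p + q + r - 2) (insMid (q + 1) (insAfter (r + 1) z x) y) =
      (-1 : k) ^ ((p + r + 1) * (q + 1)) •
        A.cupWith (LinearMap.mul k _) (p + r + 1) y (ins (r + 1) x z) +
      (-1 : k) ^ (p + r * (q + 1)) • (ins (q + r + 1) x (A.cupWith (LinearMap.mul k _) r y z) -
        A.cupWith (LinearMap.mul k _) r (ins (q + 1) x y) z) := by
  have hS := hx.insMid_insAfter hy hz (q + 1) (r + 1)
  have hT := TriLinear.insAfter hz hx (r + 1)
  have k1 := insMid_star_mu hT hy hq dy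
  -- The cocycle condition for `x`, solved for the insertion of `mu`.
  have k2 : ins 1 x A.mu = (-1 : k) ^ p • (A.cupWith (LinearMap.mul k _) p A.iota x -
      A.d.compLeft _ x) - A.cupWith (LinearMap.mul k _) 1 x A.iota := by
    rw [hochschildDiff_eq hx] at dx
    have : ins 1 x A.mu = (-1 : k) ^ p • (-1 : k) ^ p • ins 1 x A.mu := by
      rw [smul_smul, neg_one_zpow_mul_self, one_smul]
    rw [this, show (-1 : k) ^ p • ins 1 x A.mu = A.cupWith (LinearMap.mul k _) p A.iota x -
      A.d.compLeft _ x - (-1 : k) ^ p • A.cupWith (LinearMap.mul k _) 1 x A.iota by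
        rw [← sub_eq_zero, ← dx]; abel, smul_sub, smul_smul, neg_one_zpow_mul_self, one_smul]
  have k3 : ins 1 (insMid (q + 1) (insAfter (r + 1) z x) y) A.mu = (-1 : k) ^ (q + 1) •
      insMid (q + 1) (star 1 (insAfter (r + 1) z x) A.mu) y := by
    rw [k1, smul_smul, neg_one_zpow_mul_self, one_smul]
  have k4 : insMid (q + 1) (insAfter (r + 1) z (A.d.compLeft _ x)) y =
      A.d.compLeft _ (insMid (q + 1) (insAfter (r + 1) z x) y) := by
    rw [insAfter_compLeft]
    exact funext fun _ => (map_split3 A.d _ _).symm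
  -- What results are the outer terms of the differential of x{y, z}, with opposite sign, and the
  -- three products y ∪ (x ∘ z), (x ∘ y) ∪ z and x ∘ (y ∪ z).
  rw [star_insAfter_mu hx hz hr dz, k2] at k3
  simp only [insAfter_sub, insAfter_smul, insMid_sub, insMid_smul, k4,
    insMid_iota_cup (q + 1) (r + 1) p (hy.twists' hq),
    insMid_cup_iota (q + 1) (r + 1) hx hz (hy.twists' hq) (hz.twists' hr),
    insMid_insAround_mu (q + 1) (r + 1) hx (hy.twists' hq)] at k3
  rw [hochschildDiff_eq hS, k3,
    cupWith_congr _ (show Even (p + q + r - 2 - (p + (r + 1) + (q + 1))) by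
      rw [Int.even_iff]; omega), ← add_assoc,
    cupWith_congr _ (show Even (1 + (r + 1) - r) by rw [Int.even_iff]; omega),
    ins_congr (show Even (1 + (r + 1) + (q + 1) - (q + r + 1)) by rw [Int.even_iff]; omega)]
  funext L
  simp only [Pi.add_apply, Pi.sub_apply, Pi.smul_apply]
  rcases Int.even_or_odd p with hp | hp <;> rcases Int.even_or_odd q with hq | hq <;>
    rcases Int.even_or_odd r with hr | hr <;>
  simp [hp.neg_one_zpow, hq.neg_one_zpow, hr.neg_one_zpow, zpow_add₀, zpow_sub₀, zpow_mul] <;> abel_nf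

end DGAlgebra

namespace DGAlgebra

variable {k : Type u} [Field k] {A : DGAlgebra.{u, v} k}

/-! ### Functions with values in the dual -/

theorem SlotLinear.of_dual {N : Prop} {F : List A.carrier → Module.Dual k A.carrier}
    (h : ∀ b, A.SlotLinear N fun L => F L b) : A.SlotLinear N F := fun l r =>
  ⟨⟨⟨fun a => F (l ++ a :: r), fun a a' => LinearMap.ext fun b => (h b).map_add l a a' r⟩,
    fun c a => LinearMap.ext fun b => (h b).map_smul l c a r⟩,
    fun hN => LinearMap.ext fun b => by
      have := (h b).slot_one l r hN
      rwa [(h b).slot_apply] at this, fun _ => rfl⟩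

/-- The evaluation at `b` on the graded dual. -/
def evalDual (b : A.carrier) : A.dual.carrier →ₗ[k] k :=
  LinearMap.applyₗ b ∘ₗ A.gradedDual.subtype

theorem evalDual_ext {φ ψ : A.dual.carrier} (h : ∀ b, evalDual b φ = evalDual b ψ) : φ = ψ :=
  Subtype.ext (LinearMap.ext h)

theorem evalDual_zero (φ : A.dual.carrier) : evalDual 0 φ = 0 := φ.1.map_zero

theorem evalDual_smul (c : k) (b : A.carrier) (φ : A.dual.carrier) :
    evalDual (c • b) φ = c * evalDual b φ := φ.1.map_smul c b

theorem evalDual_eq_zero {j i : ℤ} {φ : A.dual.carrier} (hφ : φ ∈ A.dual.gr j) {b : A.carrier}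
    (hb : b ∈ A.gr i) (h : i + j ≠ 0) : evalDual b φ = 0 := hφ i h b hb

theorem evalDual_left (a b : A.carrier) (φ : A.dual.carrier) :
    evalDual b (A.dual.left a φ) = evalDual (b * A.parity 1 a) φ := rfl

theorem evalDual_right (a b : A.carrier) (φ : A.dual.carrier) :
    evalDual b (A.dual.right φ a) = evalDual (a * b) φ := rfl

theorem evalDual_d (b : A.carrier) (φ : A.dual.carrier) :
    evalDual b (A.dual.d φ) = evalDual (A.d (A.parity 1 b)) φ := rfl

theorem SlotLinear.of_evalDual {N : Prop} {F : List A.carrier → A.dual.carrier}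
    (h : ∀ b, A.SlotLinear N fun L => evalDual b (F L)) : A.SlotLinear N F := fun l r =>
  ⟨⟨⟨fun a => F (l ++ a :: r), fun a a' => evalDual_ext fun b => by
      rw [_root_.map_add]; exact (h b).map_add l a a' r⟩,
    fun c a => evalDual_ext fun b => by
      rw [RingHom.id_apply, _root_.map_smul]; exact (h b).map_smul l c a r⟩,
    fun hN => evalDual_ext fun b => by
      have := (h b).slot_one l r hN
      rw [(h b).slot_apply] at this
      rw [_root_.map_zero]; exact this, fun _ => rfl⟩

theorem TriLinear.ext_homogeneous {V : Type*} [AddCommGroup V] [Module k V]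
    {h h' : List A.carrier → A.carrier → List A.carrier → V} (hh : A.TriLinear h)
    (hh' : A.TriLinear h')
    (H : ∀ U e b i M e', A.HasDegrees U e → b ∈ A.gr i → A.HasDegrees M e' → h U b M = h' U b M)
    (U : List A.carrier) (b : A.carrier) (M : List A.carrier) : h U b M = h' U b M := by
  refine (hh.left b M).ext_homogeneous (hh'.left b M) (fun U e hU => ?_) U
  obtain ⟨g, hg⟩ := hh.mid U M
  obtain ⟨g', hg'⟩ := hh'.mid U M
  rw [hg, hg']
  induction b using induction_homogeneous with
  | h0 => simp
  | add a b ha hb => simp [ha, hb]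
  | hom i b hb =>
    rw [← hg, ← hg']
    exact (hh.right U b).ext_homogeneous (hh'.right U b) (fun M e' hM => H U e b i M e' hU hb hM) M

variable (A) in
/-- `h` is a functional of degree `p`, where `U`, `b` and `M` are suspended. -/
def HasTriDegree (p : ℤ) (h : List A.carrier → A.carrier → List A.carrier → k) : Prop :=
  ∀ U e b i M e', A.HasDegrees U e → b ∈ A.gr i → A.HasDegrees M e' →
    p + shiftedDegree e + (i - 1) + shiftedDegree e' ≠ 0 → h U b M = 0

/-- A nonzero value forces the degrees to add up to zero, so twisting all letters at once is a
constant sign. -/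
theorem HasTriDegree.apply_tw {p : ℤ} {h : List A.carrier → A.carrier → List A.carrier → k}
    (hp : A.HasTriDegree p h) (hh : A.TriLinear h) (s : ℤ) (U : List A.carrier) (b : A.carrier)
    (M : List A.carrier) :
    h (A.tw s U) (A.shiftSign s b) (A.tw s M) = (-1 : k) ^ (s * p) * h U b M := by
  have h1 : A.TriLinear fun U b M => h (A.tw s U) (A.shiftSign s b) (A.tw s M) :=
    ⟨fun b M => (hh.left _ _).tw s, fun U M => by
      obtain ⟨g, hg⟩ := hh.mid (A.tw s U) (A.tw s M)
      exact ⟨g ∘ₗ A.shiftSign s, fun b => hg _⟩, fun U b => (hh.right _ _).tw s⟩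
  have h2 : A.TriLinear fun U b M => (-1 : k) ^ (s * p) * h U b M :=
    ⟨fun b M => (hh.left _ _).smul _, fun U M => by
      obtain ⟨g, hg⟩ := hh.mid U M
      exact ⟨(-1 : k) ^ (s * p) • g, fun b => by simp [hg]⟩, fun U b => (hh.right _ _).smul _⟩
  refine h1.ext_homogeneous h2 (fun U e b i M e' hU hb hM => ?_) U b M
  rw [(hh.left _ _).apply_tw s hU, (hh.right _ _).apply_tw s hM, shiftSign_of_mem s hb,
    hh.mid_smul, smul_smul, smul_smul, neg_one_zpow_mul, neg_one_zpow_mul, smul_eq_mul]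
  by_cases h0 : p + shiftedDegree e + (i - 1) + shiftedDegree e' = 0
  · congr 1
    apply neg_one_zpow_congr
    rw [show s * shiftedDegree e + s * shiftedDegree e' + s * (i - 1) - s * p =
      s * (p + shiftedDegree e + (i - 1) + shiftedDegree e') - 2 * (s * p) by ring, h0]
    simp
  · rw [hp U e b i M e' hU hb hM h0, mul_zero, mul_zero]

/-! ### Cyclic sums -/

/-- The cyclic sum `∑ ± h(U, b, M)` over all decompositions `L = M U`. -/
def cycSum (p : ℤ) (h : List A.carrier → A.carrier → List A.carrier → k) (b : A.carrier)
    (L : List A.carrier) : k :=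
  splitSum (fun M U => h (A.tw (p + 1) U) (A.shiftSign p b) M) L

theorem mul_splitSum {α : Type*} (c : k) (F : List α → List α → k) (L : List α) :
    c * splitSum F L = splitSum (fun P Q => c * F P Q) L := (splitSum_smul c F L).symm

theorem mul_split3 {α : Type*} (c : k) (F : List α → List α → List α → k) (L : List α) :
    c * split3 F L = split3 (fun P Q R => c * F P Q R) L := (split3_smul c F L).symm

theorem mu_append_cons (U : List A.carrier) (b : A.carrier) (M : List A.carrier) :
    A.mu (U ++ b :: M) = (if U = [] then if M = [] then A.d b else 0 else 0) -
      (if U = [] then A.shiftSign 1 b * A.iota M else 0) -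
      (if M = [] then A.shiftSign 1 (A.iota U) * b else 0) := by
  match U, M with
  | [], [] => simp [iota]
  | [], [a] => simp [iota]
  | [], _ :: _ :: _ => simp [iota, mu_eq_zero]
  | [u], [] => simp [iota]
  | _ :: _ :: _, [] => simp [iota, mu_eq_zero]
  | [_], _ :: _ => simp [mu_eq_zero]
  | _ :: _ :: _, _ :: _ => rw [mu_eq_zero (by simp; omega)]; simp

theorem splitSum_eq_right {α V : Type*} [AddCommGroup V] (F : List α → List α → V)
    (h : ∀ P Q, P ≠ [] → F P Q = 0) (L : List α) : splitSum F L = F [] L := by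
  cases L with
  | nil => rfl
  | cons a L =>
    rw [splitSum_cons, splitSum_eq_zero fun P Q _ => h _ _ (by simp), add_zero]

/-- The contribution of the insertions of the structure maps around the letter `b`. -/
theorem TriLinear.sum_mu {V : Type*} [AddCommGroup V] [Module k V]
    {h : List A.carrier → A.carrier → List A.carrier → V}
    (hh : A.TriLinear h) (s : ℤ) (U : List A.carrier) (b : A.carrier) (M : List A.carrier) :
    splitSum (fun U₁ U₂ => splitSum (fun M₁ M₂ => h (A.tw s U₁) (A.mu (U₂ ++ b :: M₁)) M₂) M) U =
      h (A.tw s U) (A.d b) M -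
      splitSum (fun M₁ M₂ => h (A.tw s U) (A.shiftSign 1 b * A.iota M₁) M₂) M -
      splitSum (fun U₁ U₂ => h (A.tw s U₁) (A.shiftSign 1 (A.iota U₂) * b) M) U := by
  choose g hg using hh.mid
  simp only [hg, mu_append_cons, map_sub, splitSum_sub]
  congr 1
  · congr 1
    · rw [splitSum_eq_left, splitSum_eq_right]
      · simp
      · intro P Q hP; simp [hP]
      · intro P Q hQ; simp [hQ]
    · rw [splitSum_eq_left]
      · simp
      · intro P Q hQ; simp [hQ]
  · refine splitSum_congr fun P Q _ => ?_
    rw [splitSum_eq_right]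
    · simp
    · intro P Q hP; simp [hP]

/-- The cyclic sum of the insertions of the structure maps. -/
theorem cycSum_star {p : ℤ} {h : List A.carrier → A.carrier → List A.carrier → k}
    (hp : A.HasTriDegree p h) (hh : A.TriLinear h) (b : A.carrier) (L : List A.carrier) :
    cycSum (p + 1) (star 1 h A.mu) b L =
      cycSum p h (A.d (A.shiftSign 1 b)) L * (-1 : k) ^ p + ins 1 (cycSum p h b) A.mu L -
      (-1 : k) ^ p * splitSum (fun P Q => cycSum p h (b * A.shiftSign p (A.iota P)) Q) L +
      splitSum (fun P Q => cycSum p h (A.iota Q * b) (A.tw 1 P)) L := by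
  have hz : (-1 : k) ^ p * (-1 : k) ^ p = 1 := neg_one_zpow_mul_self p
  have ev : Even (p + 1 + 1 - p) := by rw [Int.even_iff]; omega
  have ev' : Even (1 + (p + 1) - p) := by rw [Int.even_iff]; omega
  have c0 : ∀ X, A.tw (p + 1 + 1) X = A.tw p X := tw_congr ev
  have c1 : ∀ X, A.tw 1 (A.tw (p + 1) X) = A.tw p X := fun X => by rw [tw_tw, tw_congr ev']
  have c2 : ∀ X, A.shiftSign 1 (A.shiftSign (p + 1) X) = A.shiftSign p X := fun X => by
    rw [shiftSign_shiftSign, shiftSign_congr ev']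
  have c3 : ∀ X, A.tw 1 (A.tw p X) = A.tw (p + 1) X := fun X => by rw [tw_tw, add_comm]
  have c4 : ∀ X, A.shiftSign 1 (A.shiftSign p X) = A.shiftSign (p + 1) X := fun X => by
    rw [shiftSign_shiftSign, add_comm]
  have c5 : ∀ X : List A.carrier, A.tw 1 (A.tw 1 X) = X := fun X => by
    rw [tw_tw, tw_even (by decide)]
  have c6 : ∀ X, A.tw (p + 1) (A.tw 1 X) = A.tw p X := fun X => by rw [tw_tw, c0]
  have c7 : ∀ X, A.shiftSign p (A.shiftSign 1 X) = A.shiftSign (p + 1) X := fun X => by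
    rw [shiftSign_shiftSign]
  have c8 : ∀ X, A.shiftSign p (A.shiftSign p X) = X := fun X => by
    rw [shiftSign_shiftSign, shiftSign_even ⟨p, rfl⟩]
  -- All letters may be twisted simultaneously because `h` has total degree `p`.
  have hpar : ∀ U b M, h U b M = (-1 : k) ^ p * h (A.tw 1 U) (A.shiftSign 1 b) (A.tw 1 M) :=
    fun U b M => by rw [hp.apply_tw hh 1, one_mul, ← mul_assoc, hz, one_mul]
  have s1 : ∀ M U, split3 (fun U₁ U₂ U₃ => h (A.tw 1 U₁ ++ A.mu U₂ :: U₃)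
      (A.shiftSign (p + 1) b) M) (A.tw p U) =
      split3 (fun U₁ U₂ U₃ => h (A.tw (p + 1) (A.tw 1 U₁ ++ A.mu U₂ :: U₃))
        (A.shiftSign p b) (A.tw 1 M)) U := fun M U => by
    rw [split3_tw]
    refine split3_congr fun U₁ U₂ U₃ _ => ?_
    rw [hpar _ _ (A.tw 1 M)]
    simp only [tw_append, tw_cons, c1, c2, c3, c4, c5, c6, twists_mu p, mul_one,
      (hh.left _ _).map_smul, smul_eq_mul]
    rw [← mul_assoc, hz, one_mul]
  have s2 : ∀ P Q R, cycSum p h b (A.tw 1 P ++ A.mu Q :: R) =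
      splitSum (fun M U => h (A.tw (p + 1) (A.tw 1 U ++ A.mu Q :: R)) (A.shiftSign p b)
        (A.tw 1 M)) P +
      splitSum (fun N U => h (A.tw (p + 1) U) (A.shiftSign p b) (A.tw 1 P ++ A.mu Q :: N)) R :=
    fun P Q R => by rw [cycSum, splitSum_append_cons, splitSum_tw]
  -- In the word U b M the left neighbour of `b` is the last letter of `L` and the right neighbour
  -- is the first one, when they exist. Their products with `b` are the two actions on the dual, in
  -- `s3` and `s4`.
  have s3 : splitSum (fun P Q => cycSum p h (A.iota Q * b) (A.tw 1 P)) L =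
      -splitSum (fun M U => splitSum (fun U₁ U₂ => h (A.tw (p + 1) U₁)
        (A.shiftSign (p + 1) (A.iota U₂) * A.shiftSign (p + 1) b) M) U) L := by
    simp only [← splitSum_neg, cycSum, splitSum_tw]
    rw [splitSum_assoc, split3]
    refine splitSum_congr fun M U _ => splitSum_congr fun U₁ U₂ _ => ?_
    rw [shiftSign_mul, hh.mid_smul, smul_eq_mul, hpar (A.tw (p + 1) U₁), shiftSign_mul,
      hh.mid_smul]
    simp only [c1, c2, c6]
    simp
  have s4 : splitSum (fun P Q => cycSum p h (b * A.shiftSign p (A.iota P)) Q) L =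
      (-1 : k) ^ p * splitSum (fun M U => splitSum (fun M₁ M₂ => h (A.tw (p + 1) U)
        (A.shiftSign p b * A.iota M₁) M₂) M) L := by
    simp only [cycSum, shiftSign_mul, c8, hh.mid_smul, smul_eq_mul, mul_splitSum]
    exact (splitSum_assoc (fun P M U => (-1 : k) ^ p * h (A.tw (p + 1) U)
      (A.shiftSign p b * A.iota P) M) L).symm
  have s5 : cycSum p h (A.d (A.shiftSign 1 b)) L =
      (-1 : k) ^ p * splitSum (fun M U => h (A.tw (p + 1) U) (A.d (A.shiftSign (p + 1) b)) M) L := by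
    simp only [cycSum, shiftSign_d, c7, hh.mid_smul, mul_splitSum, smul_eq_mul]
  -- Insertions avoiding `b` stay inside `U` or inside `M`; they match the insertions into `L`
  -- followed by a cut on either side of the new letter.
  have s6 : ins 1 (cycSum p h b) A.mu L =
      splitSum (fun M U => split3 (fun U₁ U₂ U₃ => h (A.tw (p + 1) (A.tw 1 U₁ ++ A.mu U₂ :: U₃))
        (A.shiftSign p b) (A.tw 1 M)) U) L +
      splitSum (fun M U => split3 (fun M₁ M₂ M₃ => h (A.tw (p + 1) U) (A.shiftSign p b)
        (A.tw 1 M₁ ++ A.mu M₂ :: M₃)) M) L := by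
    rw [ins]
    simp only [s2, split3_add]
    rw [split3_split_first, split3_split_last]
  rw [s3, s4, s5, s6]
  simp only [cycSum, star, splitSum_add]
  simp only [hh.sum_mu, c0, s1, splitSum_sub, c2, c3, c4, splitSum_tw, iota_tw]
  rw [mul_assoc, mul_comm _ ((-1 : k) ^ p), ← mul_assoc, hz, ← mul_assoc, hz, one_mul, one_mul]
  ring

theorem dual_diff_apply {N : Prop} {f : List A.carrier → A.dual.carrier} (hf : A.SlotLinear N f)
    (q : ℤ) (L : List A.carrier) (b : A.carrier) :
    evalDual b (A.dual.diff q f L) = -evalDual (A.d (A.shiftSign 1 b)) (f L) +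
      (-1 : k) ^ q * ins 1 (fun L => evalDual b (f L)) A.mu L +
      splitSum (fun P Q => evalDual (b * A.shiftSign (q + 1) (A.iota P)) (f Q)) L +
      (-1 : k) ^ q * splitSum (fun P Q => evalDual (A.iota Q * b) (f (A.tw 1 P))) L := by
  have h1 : ∀ φ : A.dual.carrier, evalDual (A.d (A.parity 1 b)) φ =
      -evalDual (A.d (A.shiftSign 1 b)) φ := fun φ => by
    rw [parity_eq_shiftSign, map_smul, evalDual_smul]; simp
  have h2 : ∀ P Q, evalDual (b * A.parity 1 (A.iota (A.tw q P))) (f Q) =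
      -evalDual (b * A.shiftSign (q + 1) (A.iota P)) (f Q) := fun P Q => by
    rw [parity_eq_shiftSign, iota_tw, shiftSign_shiftSign, add_comm, mul_smul_comm,
      evalDual_smul]
    simp
  rw [A.dual.diff_eq hf q]
  simp only [Pi.add_apply, Pi.sub_apply, Pi.smul_apply, map_add, map_sub, map_smul, smul_eq_mul,
    cupWith_apply, map_splitSum, ins, map_split3, LinearMap.compLeft_apply, Function.comp_apply,
    evalDual_left, evalDual_right, evalDual_d, h1, h2, splitSum_neg, sub_neg_eq_add]

/-- The cyclic sum as a functional of `b`. -/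
def cycDual {h : List A.carrier → A.carrier → List A.carrier → k} (hh : A.TriLinear h)
    (p : ℤ) (L : List A.carrier) : Module.Dual k A.carrier where
  toFun b := cycSum p h b L
  map_add' b b' := by
    choose g hg using hh.mid
    simp only [cycSum, hg, map_add, splitSum_add]
  map_smul' c b := by
    choose g hg using hh.mid
    simp only [cycSum, hg, map_smul, splitSum_smul, RingHom.id_apply]

theorem cycDual_mem {p : ℤ} {h : List A.carrier → A.carrier → List A.carrier → k}
    (hh : A.TriLinear h) (hp : A.HasTriDegree p h) {L : List A.carrier} {e : List ℤ}
    (hL : A.HasDegrees L e) : cycDual hh p L ∈ A.dualPiece (p - 1 + shiftedDegree e) :=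
  fun i hi b hb => splitSum_eq_zero fun M U hMU => by
    subst hMU
    obtain ⟨e₁, e₂, rfl, h₁, h₂⟩ := hL.exists_append
    refine hp _ e₂ _ i _ e₁ (h₂.tw _) (shiftSign_mem _ hb) h₁ ?_
    rw [shiftedDegree_append] at hi
    omega

/-- The cyclic sum of a functional of degree `p`, as a function with values in the dual. -/
def cyc {p : ℤ} {h : List A.carrier → A.carrier → List A.carrier → k} (hh : A.TriLinear h)
    (hp : A.HasTriDegree p h) (L : List A.carrier) : A.dual.carrier :=
  ⟨cycDual hh p L, (show A.SlotLinear False (cycDual hh p) from .of_dual fun _ =>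
      .splitSum (fun _ => hh.right _ _) (fun _ => (hh.left _ _).tw _)).mem_of_homogeneous _
    (fun _ _ hL => dualPiece_le _ (cycDual_mem hh hp hL)) L⟩

theorem cyc_apply {p : ℤ} {h : List A.carrier → A.carrier → List A.carrier → k}
    (hh : A.TriLinear h) (hp : A.HasTriDegree p h) (L : List A.carrier) (b : A.carrier) :
    evalDual b (cyc hh hp L) = cycSum p h b L := rfl

theorem SlotLinear.cyc {p : ℤ} {h : List A.carrier → A.carrier → List A.carrier → k}
    (hh : A.TriLinear h) (hp : A.HasTriDegree p h) {N : Prop}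
    (h₁ : ∀ b M, A.SlotLinear N fun U => h U b M) (h₂ : ∀ U b, A.SlotLinear N fun M => h U b M) :
    A.SlotLinear N (cyc hh hp) :=
  .of_evalDual fun b => by
    simp only [cyc_apply]
    exact .splitSum (fun U => h₂ _ _) (fun M => (h₁ _ _).tw _)

theorem HasDegree.cyc {p : ℤ} {h : List A.carrier → A.carrier → List A.carrier → k}
    (hh : A.TriLinear h) (hp : A.HasTriDegree p h) :
    A.HasDegree A.dual.gr (p - 1) (cyc hh hp) := fun _ _ hL =>
  cycDual_mem hh hp hL

/-- Cyclic summation commutes with the differentials up to sign; the products of `b` with its cyclic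
neighbours supply the bimodule actions on the dual. -/
theorem dual_diff_cyc {p : ℤ} {h : List A.carrier → A.carrier → List A.carrier → k}
    (hh : A.TriLinear h) (hp : A.HasTriDegree p h) (L : List A.carrier) (b : A.carrier) :
    evalDual b (A.dual.diff (p - 1) (cyc hh hp) L) =
      (-1 : k) ^ (p - 1) * cycSum (p + 1) (star 1 h A.mu) b L := by
  have hz : (-1 : k) ^ p * (-1 : k) ^ p = 1 := neg_one_zpow_mul_self p
  have e : (-1 : k) ^ (p - 1) = -(-1 : k) ^ p := by
    rw [neg_neg_one_zpow]; exact neg_one_zpow_congr (by rw [Int.even_iff]; omega)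
  rw [dual_diff_apply (SlotLinear.cyc hh hp hh.left hh.right), cycSum_star hp hh, e]
  simp only [cyc_apply, sub_add_cancel]
  linear_combination (-cycSum p h (A.d (A.shiftSign 1 b)) L +
    splitSum (fun P Q => cycSum p h (b * A.shiftSign p (A.iota P)) Q) L) * (-hz)

end DGAlgebra

namespace DGAlgebra

variable {k : Type u} [Field k] {A : DGAlgebra.{u, v} k}

/-! ### The Connes operator -/

/-- The exponent contains `p + 1` because `z` is counted as a suspended letter. -/
theorem evalDual_tw {N : Prop} {φ : List A.carrier → A.dual.carrier} (hφ : A.SlotLinear N φ)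
    {p : ℤ} (hp : A.HasDegree A.dual.gr p φ) (s : ℤ) (z : A.carrier) (L : List A.carrier) :
    evalDual (A.shiftSign s z) (φ (A.tw s L)) = (-1 : k) ^ (s * (p + 1)) * evalDual z (φ L) := by
  refine HasTriDegree.apply_tw (p := p + 1) (h := fun U b M => evalDual b (φ (U ++ M))) ?_ ?_
    s [] z L
  · intro U e b i M e' hU hb hM h
    refine evalDual_eq_zero (hp _ _ (hU.append hM)) hb ?_
    rw [shiftedDegree_append]
    omega
  · have hφ' := hφ.weaken (N' := False) False.elim
    exact ⟨fun b M => (hφ'.append_right M).comp _, fun U M => ⟨(φ (U ++ M)).1, fun _ => rfl⟩,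
      fun U b => (hφ'.append_left U).comp _⟩

@[simp] theorem tw_eq_nil {s : ℤ} {L : List A.carrier} : A.tw s L = [] ↔ L = [] :=
  List.map_eq_nil_iff

theorem iota_append_cons (U : List A.carrier) (b : A.carrier) (M : List A.carrier) :
    A.iota (U ++ b :: M) = if U = [] then if M = [] then b else 0 else 0 := by
  match U, M with
  | [], [] => rfl
  | [], _ :: _ => rfl
  | _ :: _, M => rw [iota_eq_zero (by simp)]; simp

/-- The terms of the cyclic sum in which a module action is evaluated at `1` cancel. -/
theorem cycSum_ends {N : Prop} {φ : List A.carrier → A.dual.carrier} (hφ : A.SlotLinear N φ)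
    {p : ℤ} (hp : A.HasDegree A.dual.gr p φ) (b : A.carrier) (L : List A.carrier) :
    cycSum (p + 1) (fun U b M =>
      splitSum (fun P Q => evalDual (A.shiftSign (p + 1) (A.iota P)) (φ Q)) (U ++ b :: M)) b L +
    (-1 : k) ^ p * cycSum (p + 1) (fun U b M =>
      splitSum (fun P Q => evalDual (A.iota Q) (φ (A.tw 1 P))) (U ++ b :: M)) b L = 0 := by
  have ev : Even (p + 1 + 1 - p) := by rw [Int.even_iff]; omega
  have c0 : ∀ X, A.tw (p + 1 + 1) X = A.tw p X := tw_congr ev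
  have c1 : ∀ X, A.shiftSign (p + 1) (A.shiftSign (p + 1) X) = X := fun X => by
    rw [shiftSign_shiftSign, shiftSign_even ⟨p + 1, rfl⟩]
  have c2 : ∀ X, A.shiftSign (p + 1) (A.shiftSign p X) = A.shiftSign 1 X := fun X => by
    rw [shiftSign_shiftSign]
    exact shiftSign_congr (by rw [Int.even_iff]; omega) X
  have c3 : ∀ X, A.tw 1 (A.tw p X) = A.tw (p + 1) X := fun X => by rw [tw_tw, add_comm]
  have c4 : ∀ X : List A.carrier, A.tw 1 (A.tw 1 X) = X := fun X => by
    rw [tw_tw, tw_even (by decide)]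
  -- The argument at which `φ` is evaluated is a letter `Z` of `L` or the letter `b`. The left
  -- action cuts the cyclic word before it, the right action behind it, and both leave the same
  -- rotated word.
  have s1 : cycSum (p + 1) (fun U b M =>
      splitSum (fun P Q => evalDual (A.shiftSign (p + 1) (A.iota P)) (φ Q)) (U ++ b :: M)) b L =
      split3 (fun M Z U => evalDual (A.shiftSign 1 (A.iota Z))
        (φ (A.tw p U ++ A.shiftSign (p + 1) b :: M))) L + evalDual b (φ L) := by
    simp only [cycSum, splitSum_append_cons, splitSum_add, c0, splitSum_tw, iota_tw, c2,
      iota_append_cons]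
    congr 1
    rw [splitSum_eq_left, splitSum_eq_right]
    · simp [c1]
    · intro P Q hP; simp only [hP, if_false, ite_self, map_zero, evalDual_zero]
    · intro P Q hQ
      simp only [tw_eq_nil, hQ, if_false, map_zero, evalDual_zero]
      exact splitSum_zero _
  have s2 : cycSum (p + 1) (fun U b M =>
      splitSum (fun P Q => evalDual (A.iota Q) (φ (A.tw 1 P))) (U ++ b :: M)) b L =
      (-1 : k) ^ (p + 1) * (split3 (fun M Z U => evalDual (A.shiftSign 1 (A.iota Z))
        (φ (A.tw p U ++ A.shiftSign (p + 1) b :: M))) L + evalDual b (φ L)) := by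
    simp only [cycSum, splitSum_append_cons, splitSum_add, c0, splitSum_tw,
      iota_append_cons, mul_add, c3]
    rw [add_comm]
    congr 1
    · rw [splitSum_assoc, mul_split3]
      refine split3_congr fun M Z U _ => ?_
      have := evalDual_tw hφ hp 1 (A.shiftSign 1 (A.iota Z))
        (A.tw p U ++ A.shiftSign (p + 1) b :: M)
      rwa [shiftSign_shiftSign, shiftSign_even (by decide), one_mul] at this
    · rw [splitSum_eq_right, splitSum_eq_left]
      · simp only [tw_nil, if_true, evalDual_tw hφ hp]
        congr 1
        apply neg_one_zpow_congr
        rw [← sub_one_mul, add_sub_cancel_right]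
        exact Int.even_mul_succ_self p
      · intro P Q hQ; simp only [tw_eq_nil, hQ, if_false, evalDual_zero]
      · intro P Q hP
        simp only [hP, if_false, ite_self, evalDual_zero]
        exact splitSum_zero _
  rw [s1, s2, ← mul_assoc, neg_one_zpow_mul, Odd.neg_one_zpow (by rw [Int.odd_iff]; omega)]
  ring

/-- The cochain `φ`, evaluated at `1`, as a function of a word with a marked letter. -/
def connesForm (φ : List A.carrier → A.dual.carrier) (U : List A.carrier) (b : A.carrier)
    (M : List A.carrier) : k := evalDual 1 (φ (U ++ b :: M))

theorem triLinear_connesForm {N : Prop} {φ : List A.carrier → A.dual.carrier}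
    (hφ : A.SlotLinear N φ) : A.TriLinear (connesForm φ) :=
  TriLinear.of_append (hφ.comp (evalDual 1))

theorem hasTriDegree_connesForm {φ : List A.carrier → A.dual.carrier} {p : ℤ}
    (hp : A.HasDegree A.dual.gr p φ) : A.HasTriDegree p (connesForm φ) :=
  fun U e b i M e' hU hb hM h => by
    refine evalDual_eq_zero (hp _ _ (hU.append (hM.cons hb))) SetLike.GradedOne.one_mem ?_
    rw [shiftedDegree_append, shiftedDegree_cons]
    omega

/-- The dual Connes operator on cochains of degree `p`. -/
def connes {N : Prop} {p : ℤ} {φ : List A.carrier → A.dual.carrier} (hφ : A.SlotLinear N φ)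
    (hp : A.HasDegree A.dual.gr p φ) : List A.carrier → A.dual.carrier :=
  cyc (triLinear_connesForm hφ) (hasTriDegree_connesForm hp)

theorem connes_apply {N : Prop} {p : ℤ} {φ : List A.carrier → A.dual.carrier}
    (hφ : A.SlotLinear N φ) (hp : A.HasDegree A.dual.gr p φ) (b : A.carrier)
    (L : List A.carrier) :
    evalDual b (connes hφ hp L) = cycSum p (connesForm φ) b L := rfl

theorem slotLinear_connes {N : Prop} {p : ℤ} {φ : List A.carrier → A.dual.carrier}
    (hφ : A.SlotLinear N φ) (hp : A.HasDegree A.dual.gr p φ) : A.SlotLinear N (connes hφ hp) :=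
  .cyc _ _ (fun b M => (hφ.append_right (b :: M)).comp _) (fun U b => by
    simpa [connesForm] using (hφ.append_left (U ++ [b])).comp (evalDual 1))

theorem hasDegree_connes {N : Prop} {p : ℤ} {φ : List A.carrier → A.dual.carrier}
    (hφ : A.SlotLinear N φ) (hp : A.HasDegree A.dual.gr p φ) :
    A.HasDegree A.dual.gr (p - 1) (connes hφ hp) := .cyc _ _

/-- At the argument `1` the internal term of the dual vanishes because d 1 = 0, and the actions
cancel by `cycSum_ends`. The insertions of `mu` are handled by `dual_diff_cyc`. -/
theorem dual_diff_connes {N : Prop} {p : ℤ} {φ : List A.carrier → A.dual.carrier}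
    (hφ : A.SlotLinear N φ) (hp : A.HasDegree A.dual.gr p φ) (b : A.carrier)
    (L : List A.carrier) :
    evalDual b (A.dual.diff (p - 1) (connes hφ hp) L) =
      -cycSum (p + 1) (connesForm (A.dual.diff p φ)) b L := by
  have e : (-1 : k) ^ (p - 1) = -(-1 : k) ^ p := by
    rw [neg_neg_one_zpow]; exact neg_one_zpow_congr (by rw [Int.even_iff]; omega)
  have h := cycSum_ends hφ hp b L
  rw [connes, dual_diff_cyc, e]
  have h1 : star 1 (connesForm φ) A.mu = fun U b M =>
      ins 1 (fun L => evalDual 1 (φ L)) A.mu (U ++ b :: M) := by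
    funext U b M
    exact star_append 1 (fun L => evalDual 1 (φ L)) A.mu U b M
  rw [h1]
  simp only [cycSum, connesForm, dual_diff_apply hφ, shiftSign_one, map_smul, d_one, smul_zero,
    evalDual_zero, one_mul, mul_one, splitSum_add, ← mul_splitSum, neg_zero, zero_add] at h ⊢
  linear_combination h

/-- The second application puts `1` into the word, where a normalized cochain vanishes. -/
theorem connes_connes {p : ℤ} {φ : List A.carrier → A.dual.carrier}
    (hφ : A.SlotLinear True φ) (hp : A.HasDegree A.dual.gr p φ) :
    connes (slotLinear_connes hφ hp) (hasDegree_connes hφ hp) = 0 := by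
  funext L
  refine evalDual_ext fun b => ?_
  rw [connes_apply]
  refine splitSum_eq_zero fun M U _ => ?_
  rw [connesForm, connes_apply]
  refine splitSum_eq_zero fun M' U' _ => ?_
  rw [connesForm, shiftSign_one, hφ.map_smul, ← hφ.slot_apply, hφ.slot_one _ _ trivial, smul_zero,
    map_zero]

/-- In a nonzero term the suspended degrees satisfy |b| + |M| ≡ p + |U| mod 2, so the rotation sign
with exponent |U|(|b| + |M|) has exponent (p + 1)|U|. This is linear in |U|, which is why `cycSum`
can encode it as a twist. The twist of `b` absorbs the sign of the pairing and that of the dual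
operator. -/
theorem isConnesDual_connes {N : Prop} {p : ℤ} {φ : List A.carrier → A.dual.carrier}
    (hφ : A.SlotLinear N φ) (hp : A.HasDegree A.dual.gr p φ) :
    A.IsConnesDual p φ (connes hφ hp) := by
  intro e₀ a₀ e L ha hL
  change (-1 : k) ^ _ * cycSum p (connesForm φ) a₀ L = _
  rw [cycSum, splitSum_eq_sum, Finset.mul_sum, Finset.mul_sum]
  refine Finset.sum_congr rfl fun i _ => ?_
  obtain ⟨e₁, e₂, h₁, h₂⟩ : ∃ e₁ e₂, e.take i = e₁ ∧ e.drop i = e₂ := ⟨_, _, rfl, rfl⟩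
  have hM : A.HasDegrees (L.take i) e₁ := h₁ ▸ List.forall₂_take i hL
  have hU : A.HasDegrees (L.drop i) e₂ := h₂ ▸ List.forall₂_drop i hL
  have hh := triLinear_connesForm hφ
  have he : e = e₁ ++ e₂ := by rw [← h₁, ← h₂, List.take_append_drop]
  have hs : (e.map fun j => j - 1).sum = shiftedDegree e₁ + shiftedDegree e₂ := by
    rw [← shiftedDegree_append, ← he]; rfl
  rw [(hh.left _ _).apply_tw _ hU, shiftSign_of_mem _ ha, hh.mid_smul, h₁, h₂, hs]
  change _ = (-1 : k) ^ p * ((-1 : k) ^ ((e₀ - 1 + shiftedDegree e₁) * shiftedDegree e₂) *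
    ((-1 : k) ^ (0 * _) * connesForm φ (L.drop i) a₀ (L.take i)))
  by_cases h0 : p + shiftedDegree e₂ + (e₀ - 1) + shiftedDegree e₁ = 0
  · obtain rfl : p = -(shiftedDegree e₂ + (e₀ - 1) + shiftedDegree e₁) := by omega
    generalize shiftedDegree e₁ = x, shiftedDegree e₂ = y
    simp only [smul_eq_mul, ← mul_assoc, neg_one_zpow_mul]
    congr 1
    apply neg_one_zpow_congr
    obtain ⟨u, hu⟩ := Int.even_mul_pred_self y
    obtain ⟨v, hv⟩ := Int.even_mul_pred_self e₀
    exact ⟨-x * y - e₀ * y + y + (y + (e₀ - 1) + x) - u - v, by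
      linear_combination -hu - hv⟩
  · rw [hasTriDegree_connesForm hp _ _ _ _ _ _ hU ha hM h0]
    simp

end DGAlgebra

namespace DGAlgebra

variable {k : Type u} [Field k] {A : DGAlgebra.{u, v} k}

/-! ### Closed traces -/

variable (A) in
/-- A closed graded symmetric functional of degree `n`. -/
structure IsTrace (n : ℤ) (t : A.carrier →ₗ[k] k) : Prop where
  degree : ∀ {i : ℤ} {a : A.carrier}, a ∈ A.gr i → i + n ≠ 0 → t a = 0
  symm : ∀ a x, t (a * x) = t (x * A.parity (n + 1) a)
  closed : ∀ a, t (A.d a) = 0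

namespace IsTrace

variable {n : ℤ} {t : A.carrier →ₗ[k] k}

/-- The functional lives in the single degree `-n`, so a sign depending on the degree is constant on
it. -/
theorem shiftSign (ht : A.IsTrace n t) (s : ℤ) (a : A.carrier) :
    t (A.shiftSign s a) = (-1 : k) ^ (s * (n + 1)) * t a := by
  induction a using induction_homogeneous with
  | h0 => simp
  | add a b ha hb => simp only [map_add, ha, hb, mul_add]
  | hom i a ha =>
    rw [shiftSign_of_mem s ha, map_smul, smul_eq_mul]
    by_cases h : i + n = 0
    · obtain rfl : n = -i := by omega
      congr 1
      exact neg_one_zpow_congr ⟨s * (i - 1), by ring⟩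
    · rw [ht.degree ha h, mul_zero, mul_zero]

theorem symm' (ht : A.IsTrace n t) (a x : A.carrier) :
    t (a * x) = (-1 : k) ^ (n + 1) * t (x * A.shiftSign (n + 1) a) := by
  rw [ht.symm, parity_eq_shiftSign, mul_smul_comm, map_smul, smul_eq_mul]

theorem shiftSign_mul (ht : A.IsTrace n t) (s : ℤ) (a x : A.carrier) :
    t (A.shiftSign s a * A.shiftSign s x) = (-1 : k) ^ (s * n) * t (a * x) := by
  have h := ht.shiftSign s (a * x)
  rw [DGAlgebra.shiftSign_mul, map_smul, smul_eq_mul] at h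
  have hz : (-1 : k) ^ s * (-1 : k) ^ s = 1 := neg_one_zpow_mul_self s
  rw [mul_add, mul_one, ← neg_one_zpow_mul] at h
  linear_combination (-1 : k) ^ s * h + (-t (A.shiftSign s a * A.shiftSign s x) +
    (-1 : k) ^ (s * n) * t (a * x)) * hz

end IsTrace

/-! ### Cyclic sums built from a closed trace. -/

theorem shiftSign_insAfter {N N' : Prop} {x y : List A.carrier → A.carrier}
    (hx : A.SlotLinear N' x) (hy : A.SlotLinear N y) {q r : ℤ}
    (hq : A.HasDegree A.gr q y) (hr : A.HasDegree A.gr r x) (s c : ℤ) (U : List A.carrier)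
    (b : A.carrier) (M : List A.carrier) :
    A.shiftSign s (insAfter c x y U b M) = (-1 : k) ^ (s * (q + r)) •
      insAfter c x y (A.tw s U) (A.shiftSign s b) (A.tw s M) := by
  have hty := hy.twists' hq
  have htx := hx.twists' hr
  have e : Even (s * (q + 1) + s * (r + 1) - s * (q + r)) := ⟨s, by ring⟩
  simp only [insAfter, ins, map_split3, split3_tw]
  rw [← split3_smul]
  refine split3_congr fun P Q R _ => ?_
  rw [hty s]
  simp only [tw_append, tw_cons, tw_tw, shiftSign_shiftSign, htx s]
  have h := hy.map_smul (A.tw (s + c) U ++ A.shiftSign (s + c) b :: A.tw (s + c) P)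
    ((-1 : k) ^ (s * (r + 1))) (x (A.tw s Q)) (A.tw s R)
  simp only [List.append_assoc, List.cons_append] at h
  rw [h, smul_smul, neg_one_zpow_mul, neg_one_zpow_congr e, add_comm s c]

theorem insAfter_iota_cup (s p : ℤ) (x z : List A.carrier → A.carrier) (U : List A.carrier)
    (b : A.carrier) (M : List A.carrier) :
    insAfter s z (A.cupWith (LinearMap.mul k _) p A.iota x) U b M =
      splitSum (fun U₁ U₂ => A.shiftSign (p + s) (A.iota U₁) * insAfter s z x U₂ b M) U +
      if U = [] then A.shiftSign (p + s) b * ins s x z M else 0 := by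
  cases U with
  | nil => simp [insAfter_iota_cup_nil, iota]
  | cons u U =>
    rw [insAfter_iota_cup_cons, splitSum_head _ fun P Q h => by simp [iota_eq_zero h]]
    simp [iota]

/-- The sum of `± t(y(U, b, V) x(W))` over all decompositions `L = V W U`. -/
def cycPair (t : A.carrier →ₗ[k] k) (p r : ℤ) (y x : List A.carrier → A.carrier) (b : A.carrier)
    (L : List A.carrier) : k :=
  split3 (fun V W U => t (y (A.tw (p + 1) U ++ A.shiftSign p b :: A.tw r V) * x W)) L

/-- The terms in which a letter multiplies the value cancel in the cyclic sum. -/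
theorem IsTrace.cycSum_ends {n : ℤ} {t : A.carrier →ₗ[k] k} (ht : A.IsTrace n t) {N N' : Prop}
    {x y : List A.carrier → A.carrier} (hx : A.SlotLinear N' x) (hy : A.SlotLinear N y) {q r : ℤ}
    (hq : A.HasDegree A.gr q y) (hr : A.HasDegree A.gr r x) (c : ℤ)
    (b : A.carrier) (L : List A.carrier) :
    (-1 : k) ^ q * cycSum (q + n + r) (fun U b M => t (splitSum (fun U₁ U₂ =>
      A.shiftSign (q + r + 1) (A.iota U₁) * insAfter c x y U₂ b M) U)) b L =
    (-1 : k) ^ (r + 1) * cycSum (q + n + r) (fun U b M => t (A.cupWith (LinearMap.mul k _) 1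
      (fun M => insAfter c x y (A.tw 1 U) (A.shiftSign 1 b) M) A.iota M)) b L := by
  have c1 : ∀ X, A.shiftSign (q + r + 1) (A.shiftSign (q + n + r + 1) X) = A.shiftSign n X :=
    fun X => by
      rw [shiftSign_shiftSign]
      exact shiftSign_congr (by rw [Int.even_iff]; omega) X
  -- The symmetry of `t` moves a letter from the left of the value to its right; after that both
  -- sums run over the same decompositions M Z U with Z the separated letter.
  have h1 : ∀ M U₁ U₂, t (A.shiftSign n (A.iota U₁) * insAfter c x y
        (A.tw (q + n + r + 1) U₂) (A.shiftSign (q + n + r) b) M) =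
      (-1 : k) ^ (q + r + 1) * t (insAfter c x y (A.tw 1 (A.tw (q + n + r + 1) U₂))
        (A.shiftSign 1 (A.shiftSign (q + n + r) b)) (A.tw 1 M) * A.iota U₁) := fun M U₁ U₂ => by
    have h := shiftSign_insAfter hx hy hq hr 1 c (A.tw (q + n + r + 1) U₂)
      (A.shiftSign (q + n + r) b) M
    have h2 := ht.shiftSign_mul 1 (A.shiftSign 1 (insAfter c x y (A.tw (q + n + r + 1) U₂)
      (A.shiftSign (q + n + r) b) M)) (A.iota U₁)
    rw [shiftSign_shiftSign, shiftSign_even (by decide), h, smul_mul_assoc, map_smul, one_mul,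
      one_mul, smul_eq_mul] at h2
    rw [ht.symm', shiftSign_shiftSign, shiftSign_congr (p := n + 1 + n) (q := 1) (by rw [Int.even_iff]; omega), h2,
      ← mul_assoc, ← mul_assoc, neg_one_zpow_mul, neg_one_zpow_mul]
    congr 1
    exact neg_one_zpow_congr (by rw [Int.even_iff]; omega)
  simp only [cycSum, splitSum_tw, map_splitSum, cupWith_apply, iota_tw, c1, h1, LinearMap.mul_apply',
    ← mul_splitSum]
  rw [← mul_assoc, neg_one_zpow_mul, neg_one_zpow_congr (b := r + 1) (by rw [Int.even_iff]; omega)]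
  congr 1
  exact (splitSum_assoc (fun M Z U => t (insAfter c x y (A.tw 1 (A.tw (q + n + r + 1) U))
    (A.shiftSign 1 (A.shiftSign (q + n + r) b)) (A.tw 1 M) * A.iota Z)) L).symm

/-- The central computation of the BV identity. The cocycle condition for `y` and closedness of `t`
replace the insertion of `mu` into `y` by products with a letter. Those with an original letter
cancel cyclically. There remain the product of `b` with y ∘ x, the product of values of `y` and `x`,
and the terms in which `b` is multiplied by a value of `x` inside `y`. -/
theorem IsTrace.cycSum_star_insAfter {n : ℤ} {t : A.carrier →ₗ[k] k} (ht : A.IsTrace n t)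
    {N N' : Prop} {x y : List A.carrier → A.carrier} (hx : A.SlotLinear N' x)
    (hy : A.SlotLinear N y) {q r : ℤ} (hq : A.HasDegree A.gr q y) (hr : A.HasDegree A.gr r x)
    (dx : A.hochschildDiff r x = 0) (dy : A.hochschildDiff q y = 0) (b : A.carrier)
    (L : List A.carrier) :
    cycSum (q + n + r) (star 1 (insAfter (r + 1) x (t.compLeft _ y)) A.mu) b L =
      (-1 : k) ^ (r + 1) * ((-1 : k) ^ (q + n + 1) * t (ins (r + 1) y x L * b) -
        cycPair t (q + n) r y x b L +
        splitSum (fun N U => splitSum (fun M₁ M₂ => t (y (A.tw (q + n + 1) U ++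
          (A.shiftSign (q + n) b * x M₁) :: M₂))) N) L) := by
  have hty : A.SlotLinear N (t.compLeft _ y) := hy.comp t
  have h1 : ins 1 (t.compLeft _ y) A.mu = t.compLeft _
      ((-1 : k) ^ q • A.cupWith (LinearMap.mul k _) q A.iota y -
        A.cupWith (LinearMap.mul k _) 1 y A.iota) := by
    rw [ins_compLeft]
    funext L
    have h := congrArg t (congrFun (hochschildDiff_eq hy q) L)
    rw [dy] at h
    have hz : (-1 : k) ^ q * (-1 : k) ^ q = 1 := neg_one_zpow_mul_self q
    simp only [Pi.add_apply, Pi.sub_apply, Pi.smul_apply, map_add, map_sub, map_smul, smul_eq_mul,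
      LinearMap.compLeft_apply, Function.comp_apply, ht.closed, Pi.zero_apply, map_zero] at h ⊢
    linear_combination -(-1 : k) ^ q * h + (- t (ins 1 y A.mu L) -
      t (A.cupWith (LinearMap.mul k _) 1 y A.iota L)) * hz
  have h2 := ht.cycSum_ends hx hy hq hr (r + 1) b L
  have e2 : q + (r + 1) = q + r + 1 := by ring
  have e3 : 1 + (r + 1) = r + 2 := by ring
  have c1 : ∀ X, A.tw (r + 2) (A.tw (q + n + r + 1) X) = A.tw (q + n + 1) X := fun X => by
    rw [tw_tw]
    exact tw_congr (by rw [Int.even_iff]; omega) X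
  have c2 : ∀ a, A.shiftSign (r + 2) (A.shiftSign (q + n + r) a) = A.shiftSign (q + n) a :=
    fun a => by
      rw [shiftSign_shiftSign]
      exact shiftSign_congr (by rw [Int.even_iff]; omega) a
  have c3 : ∀ X, A.tw (r + 2) X = A.tw r X := tw_congr (by rw [Int.even_iff]; omega)
  have key : ∀ U b M, star 1 (insAfter (r + 1) x (t.compLeft _ y)) A.mu U b M =
      (-1 : k) ^ (r + 1) * ((-1 : k) ^ q * t (splitSum (fun U₁ U₂ =>
        A.shiftSign (q + r + 1) (A.iota U₁) * insAfter (r + 1) x y U₂ b M) U) +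
      (-1 : k) ^ q * (if U = [] then t (A.shiftSign (q + r + 1) b * ins (r + 1) y x M) else 0) -
      splitSum (fun M₁ M₂ => t (y (A.tw (r + 2) U ++ A.shiftSign (r + 2) b :: A.tw (r + 2) M₁) *
        x M₂)) M -
      (-1 : k) ^ (r + 1) * t (A.cupWith (LinearMap.mul k _) 1
      (fun M => insAfter (r + 1) x y (A.tw 1 U) (A.shiftSign 1 b) M) A.iota M) +
      splitSum (fun M₁ M₂ => t (y (A.tw (r + 2) U ++ (A.shiftSign (r + 2) b * x M₁) :: M₂))) M) := by
    intro U b M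
    rw [star_insAfter_mu hty hx hr dx, h1]
    simp only [insAfter_compLeft, insAfter_sub, insAfter_smul, Pi.smul_apply, Pi.sub_apply,
      insAround_mu _ hty, insAfter_iota_cup, insAfter_cup_iota _ hy (hx.twists' hr), map_sub,
      map_add, map_smul, e2, e3, smul_eq_mul, cupWith_apply, map_splitSum, LinearMap.mul_apply',
      LinearMap.compLeft_apply, Function.comp_apply, apply_ite t, map_zero]
    ring
  -- The letter `b` comes first only for empty `U`; the symmetry of `t` then moves it behind the
  -- value.
  have hU : splitSum (fun M U => if A.tw (q + n + r + 1) U = [] then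
      t (A.shiftSign (q + r + 1) (A.shiftSign (q + n + r) b) * ins (r + 1) y x M) else 0) L =
      (-1 : k) ^ (n + 1) * t (ins (r + 1) y x L * b) := by
    rw [splitSum_eq_left]
    · rw [tw_nil, if_pos rfl, shiftSign_shiftSign, ht.symm', shiftSign_shiftSign, shiftSign_even]
      rw [Int.even_iff]; omega
    · intro P Q hQ
      rw [if_neg (by simpa using hQ)]
  have hQ : splitSum (fun M U => splitSum (fun M₁ M₂ => t (y (A.tw (r + 2)
      (A.tw (q + n + r + 1) U) ++ A.shiftSign (r + 2) (A.shiftSign (q + n + r) b) ::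
        A.tw (r + 2) M₁) * x M₂)) M) L = cycPair t (q + n) r y x b L := by
    rw [cycPair, ← splitSum_assoc]
    simp only [c1, c2, c3]
  have hz : (-1 : k) ^ (r + 1) * (-1 : k) ^ (r + 1) = 1 := neg_one_zpow_mul_self _
  have hz' : (-1 : k) ^ q * (-1 : k) ^ (n + 1) = (-1 : k) ^ (q + n + 1) := by
    rw [neg_one_zpow_mul, add_assoc]
  simp only [cycSum, key, ← mul_splitSum, splitSum_add, splitSum_sub, c1, c2] at h2 hU hQ ⊢
  rw [hU, hQ, ← hz', h2]
  ring

theorem hasTriDegree_insAfter {n : ℤ} {t : A.carrier →ₗ[k] k} (ht : A.IsTrace n t)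
    {x y : List A.carrier → A.carrier} {q r : ℤ} (hq : A.HasDegree A.gr q y)
    (hr : A.HasDegree A.gr r x) (c : ℤ) :
    A.HasTriDegree (q + n + r - 1) (insAfter c x (t.compLeft _ y)) :=
  -- Vanishing is membership in the zero submodule, so `split3_mem` applies with the constant
  -- grading by `⊥`.
  fun U e b i M e' hU hb hM h => (Submodule.mem_bot k).1 <|
      HasDegree.split3_mem (gr := fun _ => ⊥) (j := 0) hM fun P Q R e₁ e₂ e₃ h₁ h₂ h₃ he => by
    refine (Submodule.mem_bot k).2 (ht.degree (hq _ _ ((hU.tw c).append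
      (((h₁.tw c).append (h₃.cons (hr _ _ h₂))).cons (shiftSign_mem c hb)))) ?_)
    rw [he] at h
    simp only [shiftedDegree_append, shiftedDegree_cons] at h ⊢
    omega

/-- The cyclic sum of `t(y ∪ x)` is a sum of two pairings. -/
theorem IsTrace.cycSum_cup {n : ℤ} {t : A.carrier →ₗ[k] k} (ht : A.IsTrace n t)
    {N N' : Prop} {x y : List A.carrier → A.carrier} (hx : A.SlotLinear N' x)
    (hy : A.SlotLinear N y) {q r : ℤ} (hq : A.HasDegree A.gr q y) (hr : A.HasDegree A.gr r x)
    (b : A.carrier) (L : List A.carrier) :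
    cycSum (q + r + n) (fun U b M =>
      t (A.cupWith (LinearMap.mul k _) r y x (U ++ b :: M))) b L =
      cycPair t (q + n) r y x b L + (-1 : k) ^ (q * r) * cycPair t (r + n) q x y b L := by
  have c1 : ∀ X, A.tw r (A.tw (q + r + n + 1) X) = A.tw (q + n + 1) X := fun X => by
    rw [tw_tw]
    exact tw_congr (by rw [Int.even_iff]; omega) X
  have c2 : ∀ a, A.shiftSign r (A.shiftSign (q + r + n) a) = A.shiftSign (q + n) a :=
    fun a => by
      rw [shiftSign_shiftSign]
      exact shiftSign_congr (by rw [Int.even_iff]; omega) a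
  -- When `b` falls into `x`, the symmetry of `t` brings that factor to the front.
  have h : ∀ X Y, t (y (A.tw r (A.tw (q + r + n + 1) X)) * x Y) =
      (-1 : k) ^ (q * r) * t (x (A.tw q Y) * y X) := fun X Y => by
    have h1 := ht.shiftSign_mul q (x Y) (y (A.tw q X))
    rw [hx.twists' hr q, hy.twists' hq q, smul_mul_smul_comm, map_smul, smul_eq_mul, tw_tw,
      tw_even ⟨q, rfl⟩] at h1
    rw [ht.symm', hy.twists' hq (n + 1), tw_tw, tw_tw, mul_smul_comm, map_smul, smul_eq_mul,
      tw_congr (s := n + 1 + r + (q + r + n + 1)) (t := q) (by rw [Int.even_iff]; omega)]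
    obtain ⟨u, hu⟩ := Int.even_mul_pred_self q
    have hz : (-1 : k) ^ (q * n) * (-1 : k) ^ (q * n) = 1 := neg_one_zpow_mul_self _
    have e : (-1 : k) ^ (n + 1) * (-1 : k) ^ ((n + 1) * (q + 1)) * (-1 : k) ^ (q * n) *
        (-1 : k) ^ (q * (r + 1)) * (-1 : k) ^ (q * (q + 1)) = (-1 : k) ^ (q * r) := by
      simp only [neg_one_zpow_mul]
      exact neg_one_zpow_congr ⟨n * q + n + 1 + u + 2 * q, by linear_combination hu⟩
    rw [← e]
    linear_combination -(-1 : k) ^ (n + 1) * (-1 : k) ^ ((n + 1) * (q + 1)) *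
      (-1 : k) ^ (q * n) * h1 -
      (-1 : k) ^ (n + 1) * (-1 : k) ^ ((n + 1) * (q + 1)) * t (x Y * y (A.tw q X)) * hz
  have c3 : ∀ X, A.tw q (A.tw (q + r + n + 1) X) = A.tw (r + n + 1) X := fun X => by
    rw [tw_tw]
    exact tw_congr (by rw [Int.even_iff]; omega) X
  have c4 : ∀ a, A.shiftSign q (A.shiftSign (q + r + n) a) = A.shiftSign (r + n) a :=
    fun a => by
      rw [shiftSign_shiftSign]
      exact shiftSign_congr (by rw [Int.even_iff]; omega) a
  simp only [c1] at h
  simp only [cycSum, cupWith_apply, map_add, map_splitSum, splitSum_append_cons,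
    LinearMap.mul_apply', splitSum_add, splitSum_tw, tw_append, tw_cons, h, c1, c2, c3, c4,
    ← mul_splitSum]
  rw [add_comm, splitSum_assoc, cycPair, cycPair]
  simp only [split3]

end DGAlgebra

open DGAlgebra

namespace DGBimodule

variable {k : Type u} [Field k] {A : DGAlgebra.{u, v} k} {n : ℤ}

/-! ### Morphisms from `A` to the shifted dual -/

/-- A morphism `A → A^∨[n]` as a linear map from `A` to `A^∨`. -/
def Hom.toDual (m : Hom A.regular (A.dual.shift n)) : A.carrier →ₗ[k] A.dual.carrier :=
  m.toLinearMap

/-- The functional `m(1)`. -/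
def Hom.trace (m : Hom A.regular (A.dual.shift n)) : A.carrier →ₗ[k] k :=
  (m.toDual 1 : A.gradedDual).1

variable (m : Hom A.regular (A.dual.shift n))

theorem Hom.toDual_mem {i : ℤ} {a : A.carrier} (ha : a ∈ A.gr i) :
    m.toDual a ∈ A.dual.gr (i + n) := m.map_mem ha

theorem Hom.toDual_d (a : A.carrier) :
    m.toDual (A.d a) = (-1 : k) ^ n • A.dual.d (m.toDual a) := m.map_d a

theorem Hom.toDual_mul_left (a x : A.carrier) :
    m.toDual (a * x) = A.dual.left (A.parity n a) (m.toDual x) := m.map_left a x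

theorem Hom.toDual_mul_right (x a : A.carrier) :
    m.toDual (x * a) = A.dual.right (m.toDual x) a := m.map_right x a

/-- Right linearity gives m(a) = m(1) a, so `m` is determined by the functional m(1). -/
theorem Hom.evalDual_toDual (a x : A.carrier) : evalDual x (m.toDual a) = m.trace (a * x) := by
  conv_lhs => rw [← one_mul a, m.toDual_mul_right]
  rfl

theorem parity_add (p q : ℤ) (a : A.carrier) :
    A.parity p (A.parity q a) = A.parity (p + q) a := by
  rw [parity_eq_shiftSign, parity_eq_shiftSign, parity_eq_shiftSign, map_smul,
    shiftSign_shiftSign, smul_smul, neg_one_zpow_mul]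

/-- Symmetry compares m(a) = a m(1) with m(a) = m(1) a, and closedness is d m(1) = ± m(d 1) = 0. -/
theorem Hom.isTrace : A.IsTrace n m.trace where
  degree {i a} ha h := by
    have := m.toDual_mem (SetLike.GradedOne.one_mem : (1 : A.carrier) ∈ A.gr 0)
    rw [zero_add] at this
    exact evalDual_eq_zero this ha h
  symm a x := by
    rw [← m.evalDual_toDual]
    conv_lhs => rw [← mul_one a, m.toDual_mul_left, evalDual_left, parity_add, add_comm]
    rfl
  closed a := by
    have h := m.toDual_d 1
    rw [d_one, map_zero] at h
    have h2 := congrArg (evalDual (A.parity 1 a)) h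
    rw [map_zero, map_smul, evalDual_d, parity_parity] at h2
    have : (-1 : k) ^ n ≠ 0 := zpow_ne_zero _ (by simp)
    exact ((smul_eq_zero.1 h2.symm).resolve_left this)

theorem Hom.compLeft_cupWith {N : Prop} {r : ℤ} {x : List A.carrier → A.carrier}
    (hx : A.SlotLinear N x) (hr : A.HasDegree A.gr r x) (s : ℤ) (z : List A.carrier → A.carrier) :
    m.toDual.compLeft _ (A.cupWith (LinearMap.mul k _) s x z) =
      (-1 : k) ^ (n * r) • A.cupWith A.dual.left (s + n) x (m.toDual.compLeft _ z) := by
  funext L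
  simp only [LinearMap.compLeft_apply, Function.comp_apply, Pi.smul_apply, cupWith_apply,
    map_splitSum, LinearMap.mul_apply', m.toDual_mul_left, parity_eq_shiftSign,
    hx.twists hr n, tw_tw, add_comm n s, map_smul, LinearMap.smul_apply, smul_smul,
    neg_one_zpow_mul]
  rw [← splitSum_smul]
  refine splitSum_congr fun P Q _ => ?_
  rw [show n + n * (r - 1) = n * r by ring]

theorem Hom.diff_compLeft {N : Prop} {f : List A.carrier → A.carrier} (hf : A.SlotLinear N f)
    (p : ℤ) : A.dual.diff (p + n) (m.toDual.compLeft _ f) =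
      (-1 : k) ^ n • m.toDual.compLeft _ (A.hochschildDiff p f) := by
  have hf' : A.SlotLinear N (m.toDual.compLeft _ f) := hf.comp _
  have hl := m.compLeft_cupWith slotLinear_iota hasDegree_iota p f
  have hr : m.toDual.compLeft _ (A.cupWith (LinearMap.mul k _) 1 f A.iota) =
      A.cupWith A.dual.right 1 (m.toDual.compLeft _ f) A.iota := by
    funext L
    simp only [LinearMap.compLeft_apply, Function.comp_apply, cupWith_apply,
      map_splitSum, LinearMap.mul_apply', m.toDual_mul_right]
  have hd : m.toDual.compLeft _ (A.d.compLeft _ f) =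
      (-1 : k) ^ n • A.dual.d.compLeft _ (m.toDual.compLeft _ f) :=
    funext fun L => m.toDual_d _
  have hz : (-1 : k) ^ n * (-1 : k) ^ n = 1 := neg_one_zpow_mul_self n
  rw [mul_one] at hl
  rw [A.dual.diff_eq hf', hochschildDiff_eq hf, map_add, map_sub, map_add, map_smul, map_smul,
    hl, hr, hd, ins_compLeft]
  simp only [smul_add, smul_sub, smul_smul, hz, one_smul, neg_one_zpow_mul, add_comm n p]

theorem Hom.hasDegree_compLeft {p : ℤ} {f : List A.carrier → A.carrier}
    (hp : A.HasDegree A.gr p f) : A.HasDegree A.dual.gr (p + n) (m.toDual.compLeft _ f) :=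
  fun L e hL => by
    have := m.toDual_mem (hp L e hL)
    rwa [add_right_comm] at this

variable {N : Prop} {x y : List A.carrier → A.carrier} {q r : ℤ}

theorem Hom.connesForm_compLeft (f : List A.carrier → A.carrier) :
    connesForm (m.toDual.compLeft _ f) = fun U b M => m.trace (f (U ++ b :: M)) := by
  funext U b M
  rw [connesForm, LinearMap.compLeft_apply, Function.comp_apply, m.evalDual_toDual, mul_one]

/-- Identifies the last term of `IsTrace.cycSum_star_insAfter`: acting by a value of `x` on a
functional multiplies its argument `b` by that value. -/
theorem Hom.cup_connes_apply (hx : A.SlotLinear N x) (hr : A.HasDegree A.gr r x)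
    (hy : A.SlotLinear N (m.toDual.compLeft _ y))
    (hq : A.HasDegree A.dual.gr (q + n) (m.toDual.compLeft _ y)) (b : A.carrier)
    (L : List A.carrier) :
    evalDual b (A.cupWith A.dual.left (q + n - 1) x (connes hy hq) L) =
      (-1 : k) ^ ((q + n + 1) * r) * splitSum (fun N U => splitSum (fun M₁ M₂ =>
        m.trace (y (A.tw (q + n + 1) U ++ (A.shiftSign (q + n) b * x M₁) :: M₂))) N) L := by
  have hx' : ∀ P, A.shiftSign (q + n) (A.parity 1 (x (A.tw (q + n - 1) P))) =
      (-1 : k) ^ (1 + (q + n + 1) * (r - 1)) • x P := fun P => by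
    have h := hx.twists hr (q + n + 1) (A.tw (q + n - 1) P)
    rw [tw_tw, tw_even (s := q + n + 1 + (q + n - 1)) (by rw [Int.even_iff]; omega)] at h
    rw [parity_eq_shiftSign, map_smul, shiftSign_shiftSign, h, smul_smul, neg_one_zpow_mul]
  have hy0 : A.TriLinear (connesForm (m.toDual.compLeft _ y)) := triLinear_connesForm hy
  have e : (-1 : k) ^ ((q + n + 1) * r) = (-1 : k) ^ (q + n + (1 + (q + n + 1) * (r - 1))) := by
    exact neg_one_zpow_congr (by ring_nf; simp)
  rw [cupWith_apply, map_splitSum]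
  simp only [evalDual_left, connes_apply, cycSum, DGAlgebra.shiftSign_mul, hx', mul_smul_comm,
    hy0.mid_smul, smul_smul, neg_one_zpow_mul, splitSum_smul, ← e]
  rw [smul_eq_mul, splitSum_assoc]
  congr 1
  refine split3_congr fun P M U _ => ?_
  rw [m.connesForm_compLeft]

/-- Up to sign, `S` is the cyclic sum of t(y(U, b, …, x(…), …)). Its differential, known from
`dual_diff_cyc` and `IsTrace.cycSum_star_insAfter`, is solved for the pairing. -/
theorem Hom.exists_cycPair_eq (hx : A.SlotLinear N x) (hy : A.SlotLinear N y)
    (hq : A.HasDegree A.gr q y) (hr : A.HasDegree A.gr r x)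
    (dx : A.hochschildDiff r x = 0) (dy : A.hochschildDiff q y = 0)
    (hmy : A.SlotLinear N (m.toDual.compLeft _ y))
    (hmy' : A.HasDegree A.dual.gr (q + n) (m.toDual.compLeft _ y)) :
    ∃ S, A.SlotLinear N S ∧ A.HasDegree A.dual.gr (q + n + r - 1 - 1) S ∧
      ∀ b L, cycPair m.trace (q + n) r y x b L =
        evalDual b (((-1 : k) ^ (q + n + 1) • m.toDual.compLeft _ (ins (r + 1) y x) +
          (-1 : k) ^ ((q + n + 1) * r) • A.cupWith A.dual.left (q + n - 1) x (connes hmy hmy') +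
          A.dual.diff (q + n + r - 1 - 1) S) L) := by
  have hty : A.SlotLinear N (m.trace.compLeft _ y) := hy.comp m.trace
  have hh := TriLinear.insAfter hx hty (r + 1)
  have hp := hasTriDegree_insAfter m.isTrace hq hr (r + 1)
  have hS : A.SlotLinear N (cyc hh hp) := .cyc hh hp (fun b M => .insAfter_left _ hty _ b M)
    (fun U b => by
      have := (hty.append_left (A.tw (r + 1) U ++ [A.shiftSign (r + 1) b])).ins hx (r + 1)
      simp only [List.append_assoc, List.cons_append, List.nil_append] at this
      exact this)
  refine ⟨-(-1 : k) ^ (q + n + 1) • cyc hh hp, hS.smul _, (HasDegree.cyc hh hp).smul _,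
    fun b L => ?_⟩
  have h1 := dual_diff_cyc hh hp L b
  rw [sub_add_cancel, m.isTrace.cycSum_star_insAfter hx hy hq hr dx dy, ← mul_assoc,
    neg_one_zpow_mul, neg_one_zpow_congr (b := q + n + 1) (by rw [Int.even_iff]; omega)] at h1
  have h2 := m.cup_connes_apply hx hr hmy hmy' b L
  have hz : (-1 : k) ^ (q + n + 1) * (-1 : k) ^ (q + n + 1) = 1 := neg_one_zpow_mul_self _
  have hz' : (-1 : k) ^ ((q + n + 1) * r) * (-1 : k) ^ ((q + n + 1) * r) = 1 :=
    neg_one_zpow_mul_self _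
  simp only [map_smul, Pi.add_apply, Pi.smul_apply, map_add, smul_eq_mul, h1, h2,
    LinearMap.compLeft_apply, Function.comp_apply, m.evalDual_toDual]
  generalize m.trace (ins (r + 1) y x L * b) = u1, cycPair m.trace (q + n) r y x b L = u2
  generalize splitSum (V := k) (α := A.carrier) _ L = u3
  linear_combination ((-1 : k) ^ (q + n + 1) * u1 - u2 + u3) * hz - u3 * hz'

/-- The dual Connes operator on a cup product of cocycles, up to a coboundary. -/
theorem Hom.connes_cup (hx : A.SlotLinear N x) (hy : A.SlotLinear N y)
    (hq : A.HasDegree A.gr q y) (hr : A.HasDegree A.gr r x)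
    (dx : A.hochschildDiff r x = 0) (dy : A.hochschildDiff q y = 0)
    (hmx : A.SlotLinear N (m.toDual.compLeft _ x))
    (hmx' : A.HasDegree A.dual.gr (r + n) (m.toDual.compLeft _ x))
    (hmy : A.SlotLinear N (m.toDual.compLeft _ y))
    (hmy' : A.HasDegree A.dual.gr (q + n) (m.toDual.compLeft _ y))
    (hm : A.SlotLinear N (m.toDual.compLeft _ (A.cupWith (LinearMap.mul k _) r y x)))
    (hm' : A.HasDegree A.dual.gr (q + r + n)
      (m.toDual.compLeft _ (A.cupWith (LinearMap.mul k _) r y x))) :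
    ∃ S, A.SlotLinear N S ∧ A.HasDegree A.dual.gr (q + r + n - 2) S ∧
      connes hm hm' = (-1 : k) ^ (q + n + 1) • m.toDual.compLeft _ (ins (r + 1) y x) +
        (-1 : k) ^ ((q + n + 1) * r) • A.cupWith A.dual.left (q + n - 1) x (connes hmy hmy') +
        (-1 : k) ^ (q * r) • ((-1 : k) ^ (r + n + 1) • m.toDual.compLeft _ (ins (q + 1) x y) +
          (-1 : k) ^ ((r + n + 1) * q) •
            A.cupWith A.dual.left (r + n - 1) y (connes hmx hmx')) +
        A.dual.diff (q + r + n - 2) S := by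
  -- By `IsTrace.cycSum_cup` the operator on the product is a sum of two pairings with exchanged
  -- roles; each is rewritten modulo a coboundary.
  obtain ⟨S, hS, hS', h⟩ := m.exists_cycPair_eq hx hy hq hr dx dy hmy hmy'
  obtain ⟨T, hT, hT', h'⟩ := m.exists_cycPair_eq hy hx hr hq dy dx hmx hmx'
  rw [show q + n + r - 1 - 1 = q + r + n - 2 by ring] at hS' h
  rw [show r + n + q - 1 - 1 = q + r + n - 2 by ring] at hT' h'
  refine ⟨S + (-1 : k) ^ (q * r) • T, hS.add (hT.smul _), hS'.add (hT'.smul _), ?_⟩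
  funext L
  refine evalDual_ext fun b => ?_
  have h1 := m.isTrace.cycSum_cup hx hy hq hr b L
  rw [connes_apply, m.connesForm_compLeft, h1, h, h']
  simp only [map_smul, Pi.add_apply, Pi.smul_apply, map_add, smul_eq_mul]
  ring

end DGBimodule

open DGAlgebra

namespace DGBimodule

variable {k : Type u} [Field k] {A : DGAlgebra.{u, v} k} (M : DGBimodule.{u, v, w} A)

/-! ### The differential of a normalized cochain -/

/-- The letter `1` is absorbed by its right and its left neighbour with opposite signs; at an end of
the word one of the two is missing. -/
theorem ins_mu_append_one {V : Type*} [AddCommGroup V] [Module k V] {f : List A.carrier → V}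
    (hf : A.SlotLinear True f) (l r : List A.carrier) :
    ins 1 f A.mu (l ++ 1 :: r) = (if r = [] then 0 else f (A.tw 1 l ++ r)) -
      (if l = [] then 0 else f (A.tw 1 l ++ r)) := by
  have h0 : ∀ P Q, f (P ++ 1 :: Q) = 0 := fun P Q => by
    rw [← hf.slot_apply, hf.slot_one _ _ trivial]
  have h1 : ∀ P Q, f (P ++ A.shiftSign 1 1 :: Q) = 0 := fun P Q => by
    rw [shiftSign_one, hf.map_smul, h0, smul_zero]
  have hh : A.TriLinear fun U b M => f (U ++ b :: M) := TriLinear.of_append hf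
  have hs := hh.sum_mu 1 l 1 r
  simp only [d_one, hf.map_zero, shiftSign_one] at hs
  rw [ins, split3_append_cons]
  have e1 : split3 (fun P₁ P₂ P₃ => f (A.tw 1 P₁ ++ A.mu P₂ :: (P₃ ++ 1 :: r))) l = 0 :=
    splitSum_eq_zero fun P _ _ => splitSum_eq_zero fun Q R _ => by
      simpa using h0 (A.tw 1 P ++ A.mu Q :: R) r
  have e2 : split3 (fun Q₁ Q₂ Q₃ => f (A.tw 1 (l ++ 1 :: Q₁) ++ A.mu Q₂ :: Q₃)) r = 0 :=
    splitSum_eq_zero fun P _ _ => splitSum_eq_zero fun Q R _ => by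
      simpa using h1 (A.tw 1 l) (A.tw 1 P ++ A.mu Q :: R)
  have e3 : splitSum (fun M₁ M₂ => f (A.tw 1 l ++ A.iota M₁ :: M₂)) r =
      if r = [] then 0 else f (A.tw 1 l ++ r) := by
    cases r with
    | nil => simp [iota, hf.map_zero]
    | cons a r =>
      rw [splitSum_head _ fun P Q h => by rw [iota_eq_zero h, hf.map_zero]]
      simp [iota]
  have e4 : splitSum (fun U₁ U₂ => f (A.tw 1 U₁ ++ A.shiftSign 1 (A.iota U₂) :: r)) l =
      if l = [] then 0 else f (A.tw 1 l ++ r) := by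
    rcases List.eq_nil_or_concat' l with rfl | ⟨l, a, rfl⟩
    · have := hf.map_zero [] r
      simpa [iota] using this
    · rw [splitSum_last _ fun P Q h => by rw [iota_eq_zero h, map_zero, hf.map_zero]]
      simp [iota]
  rw [e1, e2, hs]
  simp only [zpow_one, neg_smul, one_smul, neg_mul, one_mul, mul_one, hf.map_neg, splitSum_neg, e3, e4]
  abel

/-- The terms missing in `ins_mu_append_one` are supplied by the action of `1` on the value. -/
theorem diff_append_one {f : List A.carrier → M.carrier} (hf : A.SlotLinear True f) (p : ℤ)
    (l r : List A.carrier) : M.diff p f (l ++ 1 :: r) = 0 := by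
  have h0 : ∀ P Q, f (P ++ 1 :: Q) = 0 := fun P Q => by
    rw [← hf.slot_apply, hf.slot_one _ _ trivial]
  have h1 : ∀ P Q, f (P ++ A.shiftSign 1 1 :: Q) = 0 := fun P Q => by
    rw [shiftSign_one, hf.map_smul, h0, smul_zero]
  have e1 : A.cupWith M.left p A.iota f (l ++ 1 :: r) =
      if l = [] then (-1 : k) ^ p • f r else 0 := by
    cases l with
    | nil => simp [cupWith_iota_cons, shiftSign_one, M.one_left]
    | cons a l => simp [cupWith_iota_cons, h0]
  have e2 : A.cupWith M.right 1 f A.iota (l ++ 1 :: r) =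
      if r = [] then f (A.tw 1 l) else 0 := by
    rcases List.eq_nil_or_concat' r with rfl | ⟨r, a, rfl⟩
    · simp [cupWith_iota_concat, M.right_one]
    · have := cupWith_iota_concat M.right 1 f (l ++ 1 :: r) a
      simp only [List.append_assoc, List.cons_append] at this
      simp [this, h1]
  rw [M.diff_eq hf]
  simp only [Pi.add_apply, Pi.sub_apply, Pi.smul_apply, e1, e2, ins_mu_append_one hf,
    LinearMap.compLeft_apply, Function.comp_apply, h0, map_zero]
  by_cases hl : l = [] <;> by_cases hr : r = [] <;> simp [hl, hr]

theorem slotLinear_diff' {f : List A.carrier → M.carrier} (hf : A.SlotLinear True f) (p : ℤ) :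
    A.SlotLinear True (M.diff p f) := fun l r => by
  obtain ⟨g, -, hg⟩ := M.slotLinear_diff hf p l r
  exact ⟨g, fun _ => by rw [← hg, M.diff_append_one hf], hg⟩

theorem diff_mem_cochains {f : List A.carrier → M.carrier} {p : ℤ} (hf : f ∈ M.cochains p) :
    M.diff p f ∈ M.cochains (p + 1) := by
  obtain ⟨h, h'⟩ := (M.isCochain_iff p f).1 hf
  exact (M.isCochain_iff _ _).2 ⟨M.slotLinear_diff' h p, M.hasDegree_diff h h'⟩

/-! ### Acyclic bimodules -/

/-- Every cocycle of the underlying complex is a coboundary. -/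
def IsAcyclic : Prop := ∀ j, ∀ x ∈ M.gr j, M.d x = 0 → ∃ z ∈ M.gr (j - 1), M.d z = x

theorem IsAcyclic.exists_section {M : DGBimodule.{u, v, w} A} (hM : M.IsAcyclic) (j : ℤ) :
    ∃ s : M.carrier →ₗ[k] M.carrier, (∀ x, s x ∈ M.gr (j - 1)) ∧
      ∀ x ∈ M.gr j, M.d x = 0 → M.d (s x) = x := by
  let f : M.gr (j - 1) →ₗ[k] M.carrier := M.d ∘ₗ (M.gr (j - 1)).subtype
  -- Over a field the surjection onto the boundaries has a linear section, which extends to the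
  -- whole of `M`.
  obtain ⟨g, hg⟩ := f.rangeRestrict.exists_rightInverse_of_surjective f.range_rangeRestrict
  obtain ⟨s, hs⟩ := g.exists_extend
  refine ⟨(M.gr (j - 1)).subtype ∘ₗ s, fun x => (s x).2, fun x hx dx => ?_⟩
  obtain ⟨z, hz, rfl⟩ := hM j x hx dx
  have h1 := LinearMap.congr_fun hs ⟨M.d z, ⟨⟨z, hz⟩, rfl⟩⟩
  have h2 := congrArg Subtype.val (LinearMap.congr_fun hg ⟨M.d z, ⟨⟨z, hz⟩, rfl⟩⟩)
  simp only [LinearMap.comp_apply, Submodule.subtype_apply] at h1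
  rw [LinearMap.comp_apply, h1]
  exact h2

theorem IsAcyclic.exists_contraction {M : DGBimodule.{u, v, w} A} (hM : M.IsAcyclic) :
    ∃ H : M.carrier →ₗ[k] M.carrier, (∀ j, ∀ x ∈ M.gr j, H x ∈ M.gr (j - 1)) ∧
      ∀ x, M.d (H x) + H (M.d x) = x := by
  choose s hs hs' using hM.exists_section
  let e := LinearEquiv.ofBijective (DirectSum.coeLinearMap M.gr) M.isInternal
  -- With H x = s(x - s(dx)), the element x - s(dx) is a cocycle, so d(H x) = x - s(dx); and H(dx) =
  -- s(dx) since d² = 0.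
  let H : M.carrier →ₗ[k] M.carrier :=
    DirectSum.toModule k ℤ M.carrier (fun j =>
      (s j ∘ₗ (LinearMap.id - s (j + 1) ∘ₗ M.d)) ∘ₗ (M.gr j).subtype) ∘ₗ e.symm.toLinearMap
  have hH : ∀ j, ∀ x ∈ M.gr j, H x = s j (x - s (j + 1) (M.d x)) := fun j x hx => by
    have he : e.symm x = DirectSum.lof k ℤ (fun j => M.gr j) j ⟨x, hx⟩ := by
      rw [LinearEquiv.symm_apply_eq]
      exact (DirectSum.coeLinearMap_lof M.gr j ⟨x, hx⟩).symm
    simp only [H, LinearMap.comp_apply, LinearEquiv.coe_coe, he, DirectSum.toModule_lof]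
    rfl
  refine ⟨H, fun j x hx => by rw [hH j x hx]; exact hs _ _, fun x => ?_⟩
  have key : ∀ j, ∀ x ∈ M.gr j, M.d (H x) + H (M.d x) = x := fun j x hx => by
    have hdx := M.d_mem hx
    have hd := hs' (j + 1) _ hdx (M.d_d x)
    have hm : s (j + 1) (M.d x) ∈ M.gr j := by
      have := hs (j + 1) (M.d x)
      rwa [add_sub_cancel_right] at this
    rw [hH j x hx, hH (j + 1) _ hdx, M.d_d, map_zero, sub_zero,
      hs' j _ (sub_mem hx hm) (by rw [map_sub, hd, sub_self])]
    abel
  have hx : x ∈ (⨆ j, M.gr j) := by rw [M.isInternal.submodule_iSup_eq_top]; trivial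
  refine Submodule.iSup_induction M.gr (motive := fun x => M.d (H x) + H (M.d x) = x) hx key
    (by simp) fun x y hx hy => ?_
  rw [map_add, map_add, map_add, map_add, add_add_add_comm, hx, hy]

/-! ### The Hochschild complex of an acyclic bimodule -/

theorem ins_mu_eq_zero {V : Type*} [AddCommGroup V] [Module k V] {N : Prop}
    {f : List A.carrier → V} (hf : A.SlotLinear N f) {L : List A.carrier}
    (h : ∀ L' : List A.carrier, L'.length ≤ L.length → f L' = 0) : ins 1 f A.mu L = 0 :=
  splitSum_eq_zero fun P T hT => splitSum_eq_zero fun Q R hR => by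
    cases Q with
    | nil => simp only [mu_nil, hf.map_zero]
    | cons a Q =>
      refine h _ ?_
      rw [← hT, ← hR]
      simp only [List.length_append, length_tw, List.length_cons]
      omega

theorem cupWith_iota_left_eq_zero (p : ℤ) {f : List A.carrier → M.carrier} {L : List A.carrier}
    (h : ∀ L' : List A.carrier, L'.length < L.length → f L' = 0) :
    A.cupWith M.left p A.iota f L = 0 :=
  splitSum_eq_zero fun P Q hL => by
    by_cases hP : P.length = 1
    · rw [h Q (by rw [← hL, List.length_append]; omega), map_zero]
    · rw [iota_eq_zero (by rwa [length_tw]), map_zero, LinearMap.zero_apply]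

theorem cupWith_iota_right_eq_zero {f : List A.carrier → M.carrier} {L : List A.carrier}
    (h : ∀ L' : List A.carrier, L'.length < L.length → f L' = 0) :
    A.cupWith M.right 1 f A.iota L = 0 :=
  splitSum_eq_zero fun P Q hL => by
    by_cases hQ : Q.length = 1
    · rw [h (A.tw 1 P) (by rw [← hL, List.length_append, length_tw]; omega), map_zero,
        LinearMap.zero_apply]
    · rw [iota_eq_zero hQ, map_zero]

/-- On a word `L` the differential evaluates `f` only on words that are not longer than `L`. -/
theorem diff_eq_zero_of_length {N : Prop} {f : List A.carrier → M.carrier}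
    (hf : A.SlotLinear N f) (p : ℤ) {L : List A.carrier}
    (h : ∀ L' : List A.carrier, L'.length ≤ L.length → f L' = 0) : M.diff p f L = 0 := by
  rw [M.diff_eq hf]
  simp only [Pi.add_apply, Pi.sub_apply, Pi.smul_apply, LinearMap.compLeft_apply,
    Function.comp_apply, ins_mu_eq_zero hf h, h L le_rfl, map_zero, smul_zero,
    M.cupWith_iota_left_eq_zero p fun L' h' => h L' h'.le,
    M.cupWith_iota_right_eq_zero fun L' h' => h L' h'.le, add_zero, sub_zero]

section Contraction

variable {M} {H : M.carrier →ₗ[k] M.carrier} {p : ℤ}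

theorem contraction_mem (hH : ∀ j, ∀ x ∈ M.gr j, H x ∈ M.gr (j - 1)) {f : List A.carrier → M.carrier} (hf : f ∈ M.cochains p) :
    H.compLeft _ f ∈ M.cochains (p - 1) := by
  obtain ⟨h, h'⟩ := (M.isCochain_iff p f).1 hf
  refine (M.isCochain_iff _ _).2 ⟨h.comp H, fun L e hL => ?_⟩
  have := hH _ _ (h' L e hL)
  rwa [add_sub_right_comm] at this

/-- The actions evaluate `f` on shorter words and vanish. The cocycle condition turns the remaining
insertion term into H d f, and dH + Hd is the identity. -/
theorem diff_contraction_of_length (hd : ∀ x, M.d (H x) + H (M.d x) = x) {f : List A.carrier → M.carrier} (hf : f ∈ M.cochains p)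
    (df : M.diff p f = 0) {L : List A.carrier}
    (h : ∀ L' : List A.carrier, L'.length < L.length → f L' = 0) :
    M.diff (p - 1) (H.compLeft _ f) L = f L := by
  obtain ⟨hs, -⟩ := (M.isCochain_iff p f).1 hf
  have h' : ∀ L' : List A.carrier, L'.length < L.length → H.compLeft _ f L' = 0 :=
    fun L' hL' => by rw [LinearMap.compLeft_apply, Function.comp_apply, h L' hL', map_zero]
  have e : (-1 : k) ^ (p - 1) = -(-1 : k) ^ p := by
    rw [neg_neg_one_zpow]; exact neg_one_zpow_congr (by rw [Int.even_iff]; omega)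
  have h1 := congrArg H (congrFun df L)
  have hs' : A.SlotLinear True (H.compLeft _ f) := hs.comp H
  rw [M.diff_eq hs] at h1
  rw [M.diff_eq hs', ins_compLeft]
  simp only [Pi.add_apply, Pi.sub_apply, Pi.smul_apply, LinearMap.compLeft_apply,
    Function.comp_apply, M.cupWith_iota_left_eq_zero _ h, M.cupWith_iota_right_eq_zero h,
    M.cupWith_iota_left_eq_zero _ h', M.cupWith_iota_right_eq_zero h', map_add, map_smul,
    map_zero, smul_zero, sub_zero, add_zero, Pi.zero_apply, Pi.neg_apply, e, neg_smul, neg_zero] at h1 ⊢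
  have h2 := hd (f L)
  rwa [eq_neg_of_add_eq_zero_left h1] at h2

/-- The remainders of the successive approximations of a primitive of `f`. -/
def remainder (H : M.carrier →ₗ[k] M.carrier) (p : ℤ) (f : List A.carrier → M.carrier) :
    ℕ → List A.carrier → M.carrier
  | 0 => f
  | i + 1 => remainder H p f i - M.diff (p - 1) (H.compLeft _ (remainder H p f i))

theorem remainder_spec (hH : ∀ j, ∀ x ∈ M.gr j, H x ∈ M.gr (j - 1))
    (hd : ∀ x, M.d (H x) + H (M.d x) = x) {f : List A.carrier → M.carrier}
    (hf : f ∈ M.cochains p) (df : M.diff p f = 0) (i : ℕ) :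
    remainder H p f i ∈ M.cochains p ∧ M.diff p (remainder H p f i) = 0 ∧
      ∀ L : List A.carrier, L.length < i → remainder H p f i L = 0 := by
  induction i with
  | zero => exact ⟨hf, df, by simp⟩
  | succ i ih =>
    obtain ⟨h1, h2, h3⟩ := ih
    have h4 := contraction_mem hH h1
    obtain ⟨h5, h6⟩ := (M.isCochain_iff _ _).1 h4
    have h7 := M.diff_mem_cochains h4
    have h8 := M.diff_diff h5 h6
    rw [sub_add_cancel] at h7 h8
    refine ⟨sub_mem h1 h7, ?_, fun L hL => ?_⟩
    · rw [remainder, map_sub, h2, h8, sub_zero]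
    · rw [remainder, Pi.sub_apply, diff_contraction_of_length hd h1 h2, sub_self]
      exact fun L' hL' => h3 L' (by omega)

/-- Each correction kills the remainder on one more word length. The infinite sum of the corrections
is a primitive; it is finite on every word. -/
theorem exists_diff_eq_of_contraction (hH : ∀ j, ∀ x ∈ M.gr j, H x ∈ M.gr (j - 1))
    (hd : ∀ x, M.d (H x) + H (M.d x) = x) {f : List A.carrier → M.carrier}
    (hf : f ∈ M.cochains p) (df : M.diff p f = 0) :
    ∃ g ∈ M.cochains (p - 1), M.diff (p - 1) g = f := by
  have hr := remainder_spec hH hd hf df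
  let g : ℕ → List A.carrier → M.carrier := fun l =>
    ∑ i ∈ Finset.range l, H.compLeft _ (remainder H p f i)
  have hg : ∀ l, g l ∈ M.cochains (p - 1) := fun l =>
    sum_mem fun i _ => contraction_mem hH (hr i).1
  have hgl : ∀ l (L : List A.carrier), L.length < l → g l L = g (L.length + 1) L := by
    intro l L hL
    induction l, hL using Nat.le_induction with
    | base => rfl
    | succ l hl ih =>
      rw [← ih]
      simp only [g, Finset.sum_range_succ, Pi.add_apply, LinearMap.compLeft_apply,
        Function.comp_apply, (hr l).2.2 L hl, map_zero, add_zero]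
  have hdg : ∀ l, M.diff (p - 1) (g l) = f - remainder H p f l := by
    intro l
    induction l with
    | zero => simp [g, remainder]
    | succ l ih =>
      have : g (l + 1) = g l + H.compLeft _ (remainder H p f l) := Finset.sum_range_succ _ _
      rw [this, map_add, ih, remainder]
      abel
  -- The remainder with index `i` vanishes on words shorter than `i`, so exactly the indices up to
  -- the length of `L` matter.
  let G : List A.carrier → M.carrier := fun L => g (L.length + 1) L
  have hG : M.IsCochain (p - 1) G := by
    refine ⟨fun l a b r => ?_, fun l c a r => ?_, fun l r => ?_, fun L e h => ?_⟩
    · simpa [G] using (hg _).map_add l a b r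
    · simpa [G] using (hg _).map_smul l c a r
    · simpa [G] using (hg _).normalized l r
    · exact (hg _).homogeneous L e h
  refine ⟨G, hG, funext fun L => ?_⟩
  -- On words not longer than `L`, `G` agrees with one partial sum, and the differential at `L` sees
  -- no other words.
  have h1 : M.diff (p - 1) (G - g (L.length + 1)) L = 0 := by
    refine M.diff_eq_zero_of_length ((M.isCochain_iff _ _).1 (sub_mem hG (hg _))).1 _
      fun L' hL' => ?_
    rw [Pi.sub_apply, hgl _ L' (by omega), sub_self]
  rw [map_sub, hdg, Pi.sub_apply, Pi.sub_apply, (hr _).2.2 L (by omega), sub_zero,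
    sub_eq_zero] at h1
  exact h1

end Contraction

theorem IsAcyclic.exists_diff_eq {M : DGBimodule.{u, v, w} A} (hM : M.IsAcyclic) {p : ℤ}
    {f : List A.carrier → M.carrier} (hf : f ∈ M.cochains p) (df : M.diff p f = 0) :
    ∃ g ∈ M.cochains (p - 1), M.diff (p - 1) g = f := by
  obtain ⟨H, hH, hd⟩ := hM.exists_contraction
  exact exists_diff_eq_of_contraction hH hd hf df

end DGBimodule

open DGAlgebra

namespace DGBimodule

variable {k : Type u} [Field k] {A : DGAlgebra.{u, v} k}

/-! ### The cone of a morphism of bimodules -/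

theorem isInternal_prod {V : Type*} [AddCommGroup V] [Module k V] {W : Type*} [AddCommGroup W]
    [Module k W] {S : ℤ → Submodule k V} {T : ℤ → Submodule k W} (hS : DirectSum.IsInternal S)
    (hT : DirectSum.IsInternal T) : DirectSum.IsInternal fun j => (S j).prod (T j) := by
  refine DirectSum.isInternal_submodule_of_iSupIndep_of_iSup_eq_top (fun j => ?_) ?_
  · rw [Submodule.disjoint_def]
    intro x hx hx'
    have hle : (⨆ l, ⨆ (_ : l ≠ j), (S l).prod (T l)) ≤
        (⨆ l, ⨆ (_ : l ≠ j), S l).prod (⨆ l, ⨆ (_ : l ≠ j), T l) :=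
      iSup₂_le fun l hl => Submodule.prod_mono (le_iSup₂_of_le l hl le_rfl)
        (le_iSup₂_of_le l hl le_rfl)
    exact Prod.ext
      (Submodule.disjoint_def.1 (hS.submodule_iSupIndep j) _ hx.1 (hle hx').1)
      (Submodule.disjoint_def.1 (hT.submodule_iSupIndep j) _ hx.2 (hle hx').2)
  · rw [eq_top_iff]
    have h1 : LinearMap.range (LinearMap.inl k V W) ≤ ⨆ j, (S j).prod (T j) := by
      rw [LinearMap.range_eq_map, ← hS.submodule_iSup_eq_top, Submodule.map_iSup]
      exact iSup_mono fun j => by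
        rintro _ ⟨x, hx, rfl⟩
        exact ⟨hx, zero_mem _⟩
    have h2 : LinearMap.range (LinearMap.inr k V W) ≤ ⨆ j, (S j).prod (T j) := by
      rw [LinearMap.range_eq_map, ← hT.submodule_iSup_eq_top, Submodule.map_iSup]
      exact iSup_mono fun j => by
        rintro _ ⟨x, hx, rfl⟩
        exact ⟨zero_mem _, hx⟩
    rintro ⟨x, y⟩ -
    have := add_mem (h1 ⟨x, rfl⟩) (h2 ⟨y, rfl⟩)
    simpa using this

variable {N : DGBimodule.{u, v, w} A} {M : DGBimodule.{u, v, w'} A}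

/-- The mapping cone of a morphism of bimodules. -/
def Hom.cone (f : Hom N M) : DGBimodule.{u, v, max w w'} A where
  carrier := N.carrier × M.carrier
  gr j := (N.gr (j + 1)).prod (M.gr j)
  isInternal := isInternal_prod (N.shift 1).isInternal M.isInternal
  d := { toFun := fun x => (-N.d x.1, f.toLinearMap x.1 + M.d x.2)
         map_add' := fun x y => Prod.ext (by simp; abel) (by simp; abel)
         map_smul' := fun c x => by simp }
  left := LinearMap.mk₂ k (fun a x => (N.left (A.parity 1 a) x.1, M.left a x.2))
    (by intros; simp) (by intros; simp) (by intros; simp) (by intros; simp)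
  right := LinearMap.mk₂ k (fun x a => (N.right x.1 a, M.right x.2 a))
    (by intros; simp) (by intros; simp) (by intros; simp) (by intros; simp)
  d_mem {i x} hx := ⟨neg_mem (N.d_mem hx.1), add_mem (f.map_mem hx.1) (M.d_mem hx.2)⟩
  left_mem {i j a x} ha hx := ⟨by
    have := N.left_mem (parity_mem 1 ha) hx.1
    rwa [← add_assoc] at this, M.left_mem ha hx.2⟩
  right_mem {i j x a} hx ha := ⟨by
    have := N.right_mem hx.1 ha
    rwa [add_right_comm] at this, M.right_mem hx.2 ha⟩
  one_left x := by simp [parity_one, N.one_left, M.one_left]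
  right_one x := by simp [N.right_one, M.right_one]
  mul_left a b x := by simp [parity_mul, N.mul_left, M.mul_left]
  right_mul x a b := by simp [N.right_mul, M.right_mul]
  left_right a x b := by simp [N.left_right, M.left_right]
  d_d x := by simp [f.map_d, M.d_d, N.d_d]
  leibniz_left {i a} ha x := by
    have h1 := N.leibniz_left (parity_mem 1 ha) x.1
    have h2 := M.leibniz_left ha x.2
    refine Prod.ext ?_ ?_
    · change -N.d (N.left (A.parity 1 a) x.1) = N.left (A.parity 1 (A.d a)) x.1 +
        (-1 : k) ^ i • N.left (A.parity 1 a) (-N.d x.1)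
      rw [h1, parity_d]
      simp only [zpow_one, neg_smul, one_smul, map_neg, smul_neg, LinearMap.neg_apply]
      abel
    · change f.toLinearMap (N.left (A.parity 1 a) x.1) + M.d (M.left a x.2) =
        M.left (A.d a) x.2 + (-1 : k) ^ i • M.left a (f.toLinearMap x.1 + M.d x.2)
      rw [h2, f.map_left, parity_of_mem 1 ha, one_mul, map_smul, LinearMap.smul_apply, map_add,
        smul_add]
      abel
  leibniz_right {i x} hx a := by
    have h1 := N.leibniz_right hx.1 a
    have h2 := M.leibniz_right hx.2 a
    refine Prod.ext ?_ ?_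
    · change -N.d (N.right x.1 a) = N.right (-N.d x.1) a + (-1 : k) ^ i • N.right x.1 (A.d a)
      rw [h1, ← neg_neg_one_zpow, map_neg, LinearMap.neg_apply, neg_smul]
      abel
    · change f.toLinearMap (N.right x.1 a) + M.d (M.right x.2 a) =
        M.right (f.toLinearMap x.1 + M.d x.2) a + (-1 : k) ^ i • M.right x.2 (A.d a)
      rw [h2, f.map_right, map_add, LinearMap.add_apply]
      abel

/-- A cocycle (y, x) satisfies dy = 0 and f(y) = -dx. Injectivity on cohomology gives y = dz, and
surjectivity is then applied to the cocycle f(z) + x. -/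
theorem Hom.IsQuasiIso.isAcyclic_cone {f : Hom N M} (hf : f.IsQuasiIso) : f.cone.IsAcyclic := by
  rintro j ⟨y, x⟩ ⟨hy, hx⟩ hd
  have hd1 : N.d y = 0 := neg_eq_zero.1 (congrArg Prod.fst hd)
  have hd2 : f.toLinearMap y + M.d x = 0 := congrArg Prod.snd hd
  dsimp only at hy hx
  obtain ⟨z, hz, rfl⟩ := (hf (j + 1)).1 y hy hd1 ⟨-x, by
    rw [add_sub_cancel_right]; exact neg_mem hx, by
    rw [map_neg, eq_neg_of_add_eq_zero_left hd2]⟩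
  rw [add_sub_cancel_right] at hz
  rw [f.map_d, ← map_add] at hd2
  obtain ⟨x', hx', dx', w, hw, dw⟩ := (hf j).2 _ (add_mem (f.map_mem hz) hx) hd2
  refine ⟨(x' - z, w), ⟨?_, hw⟩, Prod.ext ?_ ?_⟩
  · change _ ∈ N.gr _
    rw [sub_add_cancel]
    exact sub_mem hx' hz
  · change -N.d (x' - z) = N.d z
    rw [map_sub, dx', zero_sub, neg_neg]
  · change f.toLinearMap (x' - z) + M.d w = x
    rw [dw, map_sub]
    abel

/-- A pair of functions with values in the cone. -/
def Hom.pair (f : Hom N M) (φ : List A.carrier → N.carrier) (ψ : List A.carrier → M.carrier) :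
    List A.carrier → f.cone.carrier := fun L => (φ L, ψ L)

theorem Hom.pair_mem (f : Hom N M) {φ : List A.carrier → N.carrier}
    {ψ : List A.carrier → M.carrier} {p : ℤ} (hφ : φ ∈ N.cochains (p + 1))
    (hψ : ψ ∈ M.cochains p) : f.pair φ ψ ∈ f.cone.cochains p where
  map_add l a b r := Prod.ext (hφ.map_add l a b r) (hψ.map_add l a b r)
  map_smul l c a r := Prod.ext (hφ.map_smul l c a r) (hψ.map_smul l c a r)
  normalized l r := Prod.ext (hφ.normalized l r) (hψ.normalized l r)
  homogeneous L e h := ⟨by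
    have := hφ.homogeneous L e h
    rwa [add_right_comm] at this, hψ.homogeneous L e h⟩

theorem Hom.exists_pair (f : Hom N M) {p : ℤ} {F : List A.carrier → f.cone.carrier}
    (hF : F ∈ f.cone.cochains p) : ∃ φ ∈ N.cochains (p + 1), ∃ ψ ∈ M.cochains p,
      F = f.pair φ ψ := by
  refine ⟨fun L => (F L).1, ⟨fun l a b r => congrArg Prod.fst (hF.map_add l a b r),
    fun l c a r => congrArg Prod.fst (hF.map_smul l c a r),
    fun l r => congrArg Prod.fst (hF.normalized l r), fun L e h => ?_⟩, fun L => (F L).2,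
    ⟨fun l a b r => congrArg Prod.snd (hF.map_add l a b r),
    fun l c a r => congrArg Prod.snd (hF.map_smul l c a r),
    fun l r => congrArg Prod.snd (hF.normalized l r), fun L e h => (hF.homogeneous L e h).2⟩, rfl⟩
  have := (hF.homogeneous L e h).1
  rwa [add_right_comm] at this

theorem Hom.diff_pair (f : Hom N M) {φ : List A.carrier → N.carrier}
    {ψ : List A.carrier → M.carrier} {p : ℤ} (hφ : φ ∈ N.cochains (p + 1))
    (hψ : ψ ∈ M.cochains p) : f.cone.diff p (f.pair φ ψ) =
      f.pair (-N.diff (p + 1) φ) (f.toLinearMap.compLeft _ φ + M.diff p ψ) := by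
  obtain ⟨h1, -⟩ := (N.isCochain_iff _ _).1 hφ
  obtain ⟨h2, -⟩ := (M.isCochain_iff _ _).1 hψ
  obtain ⟨h3, -⟩ := (f.cone.isCochain_iff _ _).1 (f.pair_mem hφ hψ)
  have e : (-1 : k) ^ (p + 1) = -(-1 : k) ^ p := (neg_neg_one_zpow p).symm
  have l1 : ∀ L, (f.cone.d.compLeft _ (f.pair φ ψ) L).1 = -N.d (φ L) := fun _ => rfl
  have l2 : ∀ L, (ins 1 (f.pair φ ψ) A.mu L).1 = ins 1 φ A.mu L := fun L =>
    map_split3 (LinearMap.fst k N.carrier M.carrier) _ L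
  have l3 : ∀ L, (A.cupWith f.cone.left p A.iota (f.pair φ ψ) L).1 =
      -A.cupWith N.left (p + 1) A.iota φ L := fun L => by
    refine (map_splitSum (LinearMap.fst k N.carrier M.carrier) _ L).trans ?_
    rw [cupWith_apply, ← splitSum_neg]
    refine splitSum_congr fun P Q _ => ?_
    change N.left (A.parity 1 (A.iota (A.tw p P))) (φ Q) = _
    rw [parity_eq_shiftSign, iota_tw, iota_tw, shiftSign_shiftSign, add_comm]
    simp
  have l4 : ∀ L, (A.cupWith f.cone.right 1 (f.pair φ ψ) A.iota L).1 =
      A.cupWith N.right 1 φ A.iota L := fun L =>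
    map_splitSum (LinearMap.fst k N.carrier M.carrier) _ L
  have r2 : ∀ L, (ins 1 (f.pair φ ψ) A.mu L).2 = ins 1 ψ A.mu L := fun L =>
    map_split3 (LinearMap.snd k N.carrier M.carrier) _ L
  have r3 : ∀ L, (A.cupWith f.cone.left p A.iota (f.pair φ ψ) L).2 =
      A.cupWith M.left p A.iota ψ L := fun L =>
    map_splitSum (LinearMap.snd k N.carrier M.carrier) _ L
  have r4 : ∀ L, (A.cupWith f.cone.right 1 (f.pair φ ψ) A.iota L).2 =
      A.cupWith M.right 1 ψ A.iota L := fun L =>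
    map_splitSum (LinearMap.snd k N.carrier M.carrier) _ L
  rw [f.cone.diff_eq h3, N.diff_eq h1, M.diff_eq h2]
  funext L
  refine Prod.ext ?_ ?_
  · change (f.cone.d.compLeft _ (f.pair φ ψ) L).1 + (-1 : k) ^ p • (ins 1 (f.pair φ ψ) A.mu L).1 -
      (A.cupWith f.cone.left p A.iota (f.pair φ ψ) L).1 +
      (-1 : k) ^ p • (A.cupWith f.cone.right 1 (f.pair φ ψ) A.iota L).1 =
      -(N.d (φ L) + (-1 : k) ^ (p + 1) • ins 1 φ A.mu L - A.cupWith N.left (p + 1) A.iota φ L +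
        (-1 : k) ^ (p + 1) • A.cupWith N.right 1 φ A.iota L)
    rw [l1, l2, l3, l4, e, neg_smul, neg_smul]
    abel
  · change f.toLinearMap (φ L) + M.d (ψ L) + (-1 : k) ^ p • (ins 1 (f.pair φ ψ) A.mu L).2 -
      (A.cupWith f.cone.left p A.iota (f.pair φ ψ) L).2 +
      (-1 : k) ^ p • (A.cupWith f.cone.right 1 (f.pair φ ψ) A.iota L).2 =
      f.toLinearMap (φ L) + (M.d (ψ L) + (-1 : k) ^ p • ins 1 ψ A.mu L -
        A.cupWith M.left p A.iota ψ L + (-1 : k) ^ p • A.cupWith M.right 1 ψ A.iota L)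
    rw [r2, r3, r4]
    abel

/-- A quasi-isomorphism is surjective on Hochschild cohomology. -/
theorem Hom.IsQuasiIso.exists_cocycle {f : Hom N M} (hf : f.IsQuasiIso) {p : ℤ}
    {ψ : List A.carrier → M.carrier} (hψ : ψ ∈ M.cochains p) (dψ : M.diff p ψ = 0) :
    ∃ φ ∈ N.cochains p, N.diff p φ = 0 ∧ ∃ χ ∈ M.cochains (p - 1),
      ψ = f.toLinearMap.compLeft _ φ + M.diff (p - 1) χ := by
  -- A primitive of `(0, ψ)` in the cone consists of the desired cocycle and the correction.
  have h0 : f.pair 0 ψ ∈ f.cone.cochains p := f.pair_mem (zero_mem _) hψ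
  have h1 : f.cone.diff p (f.pair 0 ψ) = 0 := by
    rw [f.diff_pair (zero_mem _) hψ, dψ, map_zero, map_zero, neg_zero, add_zero]
    rfl
  obtain ⟨F, hF, dF⟩ := hf.isAcyclic_cone.exists_diff_eq h0 h1
  obtain ⟨φ, hφ, χ, hχ, rfl⟩ := f.exists_pair hF
  rw [f.diff_pair hφ hχ] at dF
  have e1 : -N.diff (p - 1 + 1) φ = 0 := funext fun L => congrArg Prod.fst (congrFun dF L)
  have e2 : f.toLinearMap.compLeft _ φ + M.diff (p - 1) χ = ψ :=
    funext fun L => congrArg Prod.snd (congrFun dF L)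
  rw [sub_add_cancel] at hφ e1
  exact ⟨φ, hφ, neg_eq_zero.1 e1, χ, hχ, e2.symm⟩

/-- A quasi-isomorphism is injective on Hochschild cohomology. -/
theorem Hom.IsQuasiIso.exists_diff_eq {f : Hom N M} (hf : f.IsQuasiIso) {p : ℤ}
    {φ : List A.carrier → N.carrier} (hφ : φ ∈ N.cochains p) (dφ : N.diff p φ = 0)
    {ψ : List A.carrier → M.carrier} (hψ : ψ ∈ M.cochains (p - 1))
    (h : M.diff (p - 1) ψ = f.toLinearMap.compLeft _ φ) :
    ∃ χ ∈ N.cochains (p - 1), N.diff (p - 1) χ = φ := by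
  have hφ' : φ ∈ N.cochains (p - 1 + 1) := by rwa [sub_add_cancel]
  -- The hypothesis on `ψ` says that `(φ, -ψ)` is a cocycle of the cone; up to sign, the first
  -- component of a primitive bounds `φ`.
  have h0 : f.pair φ (-ψ) ∈ f.cone.cochains (p - 1) := f.pair_mem hφ' (neg_mem hψ)
  have h1 : f.cone.diff (p - 1) (f.pair φ (-ψ)) = 0 := by
    rw [f.diff_pair hφ' (neg_mem hψ), map_neg, h, sub_add_cancel, dφ, neg_zero, add_neg_cancel]
    rfl
  obtain ⟨F, hF, dF⟩ := hf.isAcyclic_cone.exists_diff_eq h0 h1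
  obtain ⟨χ, hχ, χ', hχ', rfl⟩ := f.exists_pair hF
  rw [f.diff_pair hχ hχ'] at dF
  have e1 : -N.diff (p - 1 - 1 + 1) χ = φ := funext fun L => congrArg Prod.fst (congrFun dF L)
  rw [sub_add_cancel] at hχ e1
  exact ⟨-χ, neg_mem hχ, by rw [map_neg, e1]⟩

/-! ### The Hochschild complex of a shift -/

theorem mem_cochains_shift {n p : ℤ} {f : List A.carrier → M.carrier} :
    f ∈ (M.shift n).cochains p ↔ f ∈ M.cochains (p + n) := by
  constructor <;> intro h <;> refine ⟨h.map_add, h.map_smul, h.normalized, fun L e hL => ?_⟩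
  · have := h.homogeneous L e hL
    change f L ∈ M.gr _ at this
    rwa [add_right_comm] at this
  · have := h.homogeneous L e hL
    change f L ∈ M.gr _
    rwa [add_right_comm]

theorem diff_shift {n p : ℤ} {f : List A.carrier → M.carrier} (hf : f ∈ M.cochains (p + n)) :
    (M.shift n).diff p f = (-1 : k) ^ n • M.diff (p + n) f := by
  obtain ⟨h1, -⟩ := (M.isCochain_iff _ _).1 hf
  obtain ⟨h2, -⟩ := ((M.shift n).isCochain_iff _ _).1 (mem_cochains_shift.2 hf)
  have hl : A.cupWith (M.shift n).left p A.iota f =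
      (-1 : k) ^ n • A.cupWith M.left (p + n) A.iota f := by
    funext L
    rw [Pi.smul_apply]
    refine Eq.trans ?_ (splitSum_smul (V := M.carrier) ((-1 : k) ^ n)
      (fun P Q => M.left (A.iota (A.tw (p + n) P)) (f Q)) L)
    refine splitSum_congr fun P Q _ => ?_
    change M.left (A.parity n (A.iota (A.tw p P))) (f Q) = _
    rw [parity_eq_shiftSign, iota_tw, iota_tw, shiftSign_shiftSign, add_comm n, map_smul]
    rfl
  have hz : (-1 : k) ^ n * (-1 : k) ^ (p + n) = (-1 : k) ^ p := by
    rw [neg_one_zpow_mul]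
    exact neg_one_zpow_congr (by rw [Int.even_iff]; omega)
  rw [(M.shift n).diff_eq h2, hl, M.diff_eq h1]
  simp only [smul_add, smul_sub, smul_smul, hz]
  rfl

end DGBimodule

open DGAlgebra

namespace DGBimodule

variable {k : Type u} [Field k] {A : DGAlgebra.{u, v} k}

/-! ### Maps on Hochschild cohomology -/

section Maps

variable {M₁ : DGBimodule.{u, v, w} A} {M₂ : DGBimodule.{u, v, w'} A}
  {p q r : ℤ}

theorem cls_surjective (M : DGBimodule.{u, v, w} A) (p : ℤ) :
    Function.Surjective (M.cls (p := p)) := Submodule.Quotient.mk_surjective _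

theorem cls_eq_iff {M : DGBimodule.{u, v, w} A} {f g : M.cocycles p} :
    M.cls f = M.cls g ↔ f.1 - g.1 ∈ M.coboundaries p := Submodule.Quotient.eq _

theorem cls_add {M : DGBimodule.{u, v, w} A} (f g : M.cocycles p) :
    M.cls (f + g) = M.cls f + M.cls g := rfl

theorem cls_smul {M : DGBimodule.{u, v, w} A} (c : k) (f : M.cocycles p) :
    M.cls (c • f) = c • M.cls f := rfl

theorem diff_mem_coboundaries (M : DGBimodule.{u, v, w} A) {f : List A.carrier → M.carrier}
    (hf : f ∈ M.cochains q) (h : q + 1 = p) : M.diff q f ∈ M.coboundaries p := by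
  obtain rfl : q = p - 1 := by omega
  exact ⟨f, hf, rfl⟩

theorem exists_of_mem_coboundaries {M : DGBimodule.{u, v, w} A} {f : List A.carrier → M.carrier}
    (hf : f ∈ M.coboundaries p) (h : q + 1 = p) : ∃ g ∈ M.cochains q, f = M.diff q g := by
  obtain rfl : q = p - 1 := by omega
  obtain ⟨g, hg, rfl⟩ := hf
  exact ⟨g, hg, rfl⟩

theorem cls_eq {M : DGBimodule.{u, v, w} A} {f g : M.cocycles p} {S : List A.carrier → M.carrier}
    (hS : S ∈ M.cochains q) (h : q + 1 = p) (e : f.1 = g.1 + M.diff q S) :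
    M.cls f = M.cls g := by
  rw [cls_eq_iff, e, add_sub_cancel_left]
  exact M.diff_mem_coboundaries hS h

/-- The map on cohomology induced by a map of cocycles. -/
def mapHH (φ : M₁.cocycles p →ₗ[k] M₂.cocycles q)
    (h : ∀ x, x.1 ∈ M₁.coboundaries p → (φ x).1 ∈ M₂.coboundaries q) : M₁.HH p →ₗ[k] M₂.HH q :=
  Submodule.mapQ _ _ φ h

theorem mapHH_cls (φ : M₁.cocycles p →ₗ[k] M₂.cocycles q)
    (h : ∀ x, x.1 ∈ M₁.coboundaries p → (φ x).1 ∈ M₂.coboundaries q) (x : M₁.cocycles p) :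
    mapHH φ h (M₁.cls x) = M₂.cls (φ x) := rfl

/-- The bilinear map on cohomology induced by a bilinear map of cocycles. -/
def map₂HH {M : DGBimodule.{u, v, w} A} (φ : M.cocycles p →ₗ[k] M.cocycles q →ₗ[k] M.cocycles r)
    (h₁ : ∀ x y, x.1 ∈ M.coboundaries p → (φ x y).1 ∈ M.coboundaries r)
    (h₂ : ∀ x y, y.1 ∈ M.coboundaries q → (φ x y).1 ∈ M.coboundaries r) :
    M.HH p →ₗ[k] M.HH q →ₗ[k] M.HH r :=
  Submodule.liftQ _
    { toFun := fun x => mapHH (φ x) (h₂ x)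
      map_add' := fun x x' => LinearMap.ext fun y => by
        obtain ⟨y, rfl⟩ := cls_surjective _ _ y
        rw [LinearMap.add_apply, mapHH_cls, mapHH_cls, mapHH_cls, map_add, LinearMap.add_apply,
          cls_add]
      map_smul' := fun c x => LinearMap.ext fun y => by
        obtain ⟨y, rfl⟩ := cls_surjective _ _ y
        rw [RingHom.id_apply, LinearMap.smul_apply, mapHH_cls, mapHH_cls, map_smul,
          LinearMap.smul_apply, cls_smul] }
    fun x hx => LinearMap.ext fun y => by
      obtain ⟨y, rfl⟩ := cls_surjective _ _ y
      exact cls_eq_iff.2 (by simpa using h₁ x y hx)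

end Maps

end DGBimodule

namespace DGAlgebra

open DGBimodule

variable {k : Type u} [Field k] {A : DGAlgebra.{u, v} k} {p q r : ℤ}

/-! ### The cup product and the bracket of cocycles -/

theorem mem_regular_cochains {f : List A.carrier → A.carrier} :
    f ∈ A.regular.cochains p ↔ A.SlotLinear True f ∧ A.HasDegree A.gr p f :=
  A.regular.isCochain_iff p f

theorem mem_regular_cocycles {f : List A.carrier → A.carrier} :
    f ∈ A.regular.cocycles p ↔
      (A.SlotLinear True f ∧ A.HasDegree A.gr p f) ∧ A.hochschildDiff p f = 0 :=
  and_congr mem_regular_cochains Iff.rfl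

theorem exists_of_mem_regular_coboundaries {f : List A.carrier → A.carrier}
    (hf : f ∈ A.regular.coboundaries p) : ∃ g : List A.carrier → A.carrier,
      g ∈ A.regular.cochains (p - 1) ∧ f = A.hochschildDiff (p - 1) g := by
  obtain ⟨g, hg, rfl⟩ := hf
  exact ⟨g, hg, rfl⟩

theorem ins_zero_left (s : ℤ) (y : List A.carrier → A.carrier) :
    ins s (0 : List A.carrier → A.carrier) y = 0 := by
  simpa using ins_smul s (0 : k) (0 : List A.carrier → A.carrier) y

theorem SlotLinear.ins_zero_right {N : Prop} {x : List A.carrier → A.carrier}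
    (hx : A.SlotLinear N x) (s : ℤ) : DGAlgebra.ins s x 0 = 0 := by
  simpa using hx.ins_smul_right s (0 : k) 0

theorem cup_assoc (q r : ℤ) (x y z : List A.carrier → A.carrier) :
    A.cup r (A.cup q x y) z = A.cup (q + r) x (A.cup r y z) := by
  simp only [cup_eq]
  exact cupWith_assoc _ _ _ _ mul_assoc q r x y z

theorem cup_mem_cochains {x y : List A.carrier → A.carrier} (hx : x ∈ A.regular.cochains p)
    (hy : y ∈ A.regular.cochains q) (h : p + q = r) :
    A.cup q x y ∈ A.regular.cochains r := by
  subst h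
  rw [mem_regular_cochains] at *
  rw [cup_eq]
  exact ⟨.cupWith _ _ hx.1 hy.1,
    HasDegree.cupWith (fun ha hb => SetLike.GradedMul.mul_mem ha hb) hx.2 hy.2 _⟩

theorem hochschildDiff_cup {x y : List A.carrier → A.carrier} (hx : x ∈ A.regular.cochains p)
    (hy : y ∈ A.regular.cochains q) (h : p + q = r) :
    A.hochschildDiff r (A.cup q x y) = A.cup q (A.hochschildDiff p x) y +
      (-1 : k) ^ p • A.cup (q + 1) x (A.hochschildDiff q y) := by
  subst h
  rw [mem_regular_cochains] at *
  simp only [cup_eq]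
  exact A.regular.diff_cupWith hx.1 hx.2 hy.1

theorem cup_add_left (q : ℤ) (x x' y : List A.carrier → A.carrier) :
    A.cup q (x + x') y = A.cup q x y + A.cup q x' y := by
  simp only [cup_eq, map_add, LinearMap.add_apply]

theorem cup_smul_left (q : ℤ) (c : k) (x y : List A.carrier → A.carrier) :
    A.cup q (c • x) y = c • A.cup q x y := by
  simp only [cup_eq, map_smul, LinearMap.smul_apply]

theorem cup_add_right (q : ℤ) (x y y' : List A.carrier → A.carrier) :
    A.cup q x (y + y') = A.cup q x y + A.cup q x y' := by
  simp only [cup_eq, map_add]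

theorem cup_smul_right (q : ℤ) (c : k) (x y : List A.carrier → A.carrier) :
    A.cup q x (c • y) = c • A.cup q x y := by
  simp only [cup_eq, map_smul]

theorem cup_zero_left (q : ℤ) (y : List A.carrier → A.carrier) : A.cup q 0 y = 0 := by
  rw [cup_eq, map_zero, LinearMap.zero_apply]

theorem cup_zero_right (q : ℤ) (x : List A.carrier → A.carrier) : A.cup q x 0 = 0 := by
  rw [cup_eq, map_zero]

theorem cup_mem_cocycles {x y : List A.carrier → A.carrier} (hx : x ∈ A.regular.cocycles p)
    (hy : y ∈ A.regular.cocycles q) (h : p + q = r) : A.cup q x y ∈ A.regular.cocycles r := by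
  refine ⟨cup_mem_cochains hx.1 hy.1 h, ?_⟩
  have dx : A.hochschildDiff p x = 0 := hx.2
  have dy : A.hochschildDiff q y = 0 := hy.2
  have := hochschildDiff_cup hx.1 hy.1 h
  rwa [dx, dy, cup_zero_left, cup_zero_right, smul_zero, add_zero] at this

theorem cup_mem_coboundaries_left {x y : List A.carrier → A.carrier}
    (hx : x ∈ A.regular.coboundaries p) (hy : y ∈ A.regular.cocycles q) (h : p + q = r) :
    A.cup q x y ∈ A.regular.coboundaries r := by
  obtain ⟨g, hg, rfl⟩ := exists_of_mem_regular_coboundaries hx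
  have dy : A.hochschildDiff q y = 0 := hy.2
  have := hochschildDiff_cup (p := p - 1) (r := r - 1) hg hy.1 (by omega)
  rw [dy, cup_zero_right, smul_zero, add_zero] at this
  exact ⟨A.cup q g y, cup_mem_cochains (p := p - 1) hg hy.1 (by omega), this⟩

theorem cup_mem_coboundaries_right {x y : List A.carrier → A.carrier}
    (hx : x ∈ A.regular.cocycles p) (hy : y ∈ A.regular.coboundaries q) (h : p + q = r) :
    A.cup q x y ∈ A.regular.coboundaries r := by
  obtain ⟨g, hg, rfl⟩ := exists_of_mem_regular_coboundaries hy
  have dx : A.hochschildDiff p x = 0 := hx.2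
  have := hochschildDiff_cup (q := q - 1) (r := r - 1) hx.1 hg (by omega)
  rw [dx, cup_zero_left, zero_add, sub_add_cancel] at this
  refine ⟨(-1 : k) ^ p • A.cup (q - 1) x g,
    Submodule.smul_mem _ _ (cup_mem_cochains (q := q - 1) hx.1 hg (by omega)), ?_⟩
  have e := A.hochschildDiff (r - 1) |>.map_smul ((-1 : k) ^ p) (A.cup (q - 1) x g)
  rw [this, smul_smul, neg_one_zpow_mul_self, one_smul] at e
  exact e

/-- The cup product of cocycles. -/
def cupCocycles (h : p + q = r) :
    A.regular.cocycles p →ₗ[k] A.regular.cocycles q →ₗ[k] A.regular.cocycles r :=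
  LinearMap.mk₂ k (fun x y => ⟨A.cup q x.1 y.1, cup_mem_cocycles x.2 y.2 h⟩)
    (fun x x' y => Subtype.ext (cup_add_left q x.1 x'.1 y.1))
    (fun c x y => Subtype.ext (cup_smul_left q c x.1 y.1))
    (fun x y y' => Subtype.ext (cup_add_right q x.1 y.1 y'.1))
    (fun c x y => Subtype.ext (cup_smul_right q c x.1 y.1))

/-- The cup product on Hochschild cohomology. -/
def hhMul (h : p + q = r) : A.regular.HH p →ₗ[k] A.regular.HH q →ₗ[k] A.regular.HH r :=
  map₂HH (cupCocycles h) (fun _ y hx => cup_mem_coboundaries_left hx y.2 h)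
    fun x _ hy => cup_mem_coboundaries_right x.2 hy h

/-! ### Descent of the bracket to cohomology. -/

theorem gerstenhaberBracket_add_left {x x' y : List A.carrier → A.carrier}
    (hy : y ∈ A.regular.cochains q) : A.gerstenhaberBracket p q (x + x') y =
      A.gerstenhaberBracket p q x y + A.gerstenhaberBracket p q x' y := by
  have hy := (mem_regular_cochains.1 hy).1
  simp only [gerstenhaberBracket_eq, ins_add, hy.ins_add_right, smul_add]
  abel

theorem gerstenhaberBracket_smul_left (c : k) {x y : List A.carrier → A.carrier}
    (hy : y ∈ A.regular.cochains q) : A.gerstenhaberBracket p q (c • x) y =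
      c • A.gerstenhaberBracket p q x y := by
  have hy := (mem_regular_cochains.1 hy).1
  simp only [gerstenhaberBracket_eq, ins_smul, hy.ins_smul_right, smul_sub, smul_comm _ c]

theorem gerstenhaberBracket_add_right {x y y' : List A.carrier → A.carrier}
    (hx : x ∈ A.regular.cochains p) : A.gerstenhaberBracket p q x (y + y') =
      A.gerstenhaberBracket p q x y + A.gerstenhaberBracket p q x y' := by
  have hx := (mem_regular_cochains.1 hx).1
  simp only [gerstenhaberBracket_eq, ins_add, hx.ins_add_right, smul_add]
  abel

theorem gerstenhaberBracket_smul_right (c : k) {x y : List A.carrier → A.carrier}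
    (hx : x ∈ A.regular.cochains p) : A.gerstenhaberBracket p q x (c • y) =
      c • A.gerstenhaberBracket p q x y := by
  have hx := (mem_regular_cochains.1 hx).1
  simp only [gerstenhaberBracket_eq, ins_smul, hx.ins_smul_right, smul_sub, smul_comm _ c]

theorem gerstenhaberBracket_mem_cochains {x y : List A.carrier → A.carrier}
    (hx : x ∈ A.regular.cochains p) (hy : y ∈ A.regular.cochains q) (h : p + q = r + 1) :
    A.gerstenhaberBracket p q x y ∈ A.regular.cochains r := by
  obtain rfl : r = p + q - 1 := by omega
  rw [mem_regular_cochains] at *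
  exact ⟨hx.1.gerstenhaberBracket hy.1 p q, hx.2.gerstenhaberBracket hy.2⟩

theorem hochschildDiff_gerstenhaberBracket' {x y : List A.carrier → A.carrier}
    (hx : x ∈ A.regular.cochains p) (hy : y ∈ A.regular.cochains q) (h : p + q = r + 1) :
    A.hochschildDiff r (A.gerstenhaberBracket p q x y) =
      A.gerstenhaberBracket (p + 1) q (A.hochschildDiff p x) y -
      (-1 : k) ^ p • A.gerstenhaberBracket p (q + 1) x (A.hochschildDiff q y) := by
  obtain rfl : r = p + q - 1 := by omega
  rw [mem_regular_cochains] at *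
  exact hochschildDiff_gerstenhaberBracket hx.1 hy.1 hx.2 hy.2

theorem gerstenhaberBracket_zero_left {y : List A.carrier → A.carrier}
    (hy : y ∈ A.regular.cochains q) : A.gerstenhaberBracket p q 0 y = 0 := by
  simpa using gerstenhaberBracket_smul_left (p := p) (0 : k) (x := 0) hy

theorem gerstenhaberBracket_zero_right {x : List A.carrier → A.carrier}
    (hx : x ∈ A.regular.cochains p) : A.gerstenhaberBracket p q x 0 = 0 := by
  simpa using gerstenhaberBracket_smul_right (q := q) (0 : k) (y := 0) hx

theorem gerstenhaberBracket_mem_cocycles {x y : List A.carrier → A.carrier}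
    (hx : x ∈ A.regular.cocycles p) (hy : y ∈ A.regular.cocycles q) (h : p + q = r + 1) :
    A.gerstenhaberBracket p q x y ∈ A.regular.cocycles r := by
  refine ⟨gerstenhaberBracket_mem_cochains hx.1 hy.1 h, ?_⟩
  have dx : A.hochschildDiff p x = 0 := hx.2
  have dy : A.hochschildDiff q y = 0 := hy.2
  have := hochschildDiff_gerstenhaberBracket' hx.1 hy.1 h
  rwa [dx, dy, gerstenhaberBracket_zero_left hy.1, gerstenhaberBracket_zero_right hx.1, smul_zero,
    sub_zero] at this

theorem gerstenhaberBracket_mem_coboundaries_left {x y : List A.carrier → A.carrier}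
    (hx : x ∈ A.regular.coboundaries p) (hy : y ∈ A.regular.cocycles q) (h : p + q = r + 1) :
    A.gerstenhaberBracket p q x y ∈ A.regular.coboundaries r := by
  obtain ⟨g, hg, rfl⟩ := exists_of_mem_regular_coboundaries hx
  have dy : A.hochschildDiff q y = 0 := hy.2
  have := hochschildDiff_gerstenhaberBracket' (p := p - 1) (r := r - 1) hg hy.1 (by omega)
  rw [dy, gerstenhaberBracket_zero_right hg, smul_zero, sub_zero, sub_add_cancel] at this
  exact ⟨A.gerstenhaberBracket (p - 1) q g y,
    gerstenhaberBracket_mem_cochains (p := p - 1) hg hy.1 (by omega), this⟩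

theorem gerstenhaberBracket_mem_coboundaries_right {x y : List A.carrier → A.carrier}
    (hx : x ∈ A.regular.cocycles p) (hy : y ∈ A.regular.coboundaries q) (h : p + q = r + 1) :
    A.gerstenhaberBracket p q x y ∈ A.regular.coboundaries r := by
  rw [gerstenhaberBracket_antisymm, ← neg_smul]
  exact Submodule.smul_mem _ _ (gerstenhaberBracket_mem_coboundaries_left hy hx (by omega))

/-- The Gerstenhaber bracket of cocycles. -/
def bracketCocycles (h : p + q = r + 1) :
    A.regular.cocycles p →ₗ[k] A.regular.cocycles q →ₗ[k] A.regular.cocycles r :=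
  LinearMap.mk₂ k
    (fun x y => ⟨A.gerstenhaberBracket p q x.1 y.1, gerstenhaberBracket_mem_cocycles x.2 y.2 h⟩)
    (fun x x' y => Subtype.ext (gerstenhaberBracket_add_left (x := x.1) (x' := x'.1) y.2.1))
    (fun c x y => Subtype.ext (gerstenhaberBracket_smul_left c (x := x.1) y.2.1))
    (fun x y y' => Subtype.ext (gerstenhaberBracket_add_right (y := y.1) (y' := y'.1) x.2.1))
    (fun c x y => Subtype.ext (gerstenhaberBracket_smul_right c (y := y.1) x.2.1))

/-- The Gerstenhaber bracket on Hochschild cohomology. -/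
def hhBracket (h : p + q = r + 1) : A.regular.HH p →ₗ[k] A.regular.HH q →ₗ[k] A.regular.HH r :=
  map₂HH (bracketCocycles h) (fun _ y hx => gerstenhaberBracket_mem_coboundaries_left hx y.2 h)
    fun x _ hy => gerstenhaberBracket_mem_coboundaries_right x.2 hy h

/-! ### The Gerstenhaber identities up to coboundaries. -/

theorem cup_comm {x y : List A.carrier → A.carrier} (hx : x ∈ A.regular.cocycles p)
    (hy : y ∈ A.regular.cocycles q) :
    A.cup q x y = (-1 : k) ^ (p * q) • A.cup p y x +
      A.hochschildDiff (p + q - 1) (-(-1 : k) ^ p • ins (q + 1) x y) := by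
  rw [mem_regular_cocycles] at hx hy
  rw [map_smul, hochschildDiff_ins hx.1.1 hy.1.1 hy.1.2, hx.2, hy.2, ins_zero_left,
    hx.1.1.ins_zero_right, cup_eq, cup_eq]
  by_cases hp : Even p <;> by_cases hq : Even q <;>
    simp [neg_one_zpow_eq_ite, Int.even_mul, -Int.not_even_iff_odd,
      ← Int.not_even_iff_odd, hp, hq]

/-- Inserting `x` into y ∪ z obeys the Leibniz rule exactly, by `ins_cupWith`. Inserting y ∪ z into
`x` does so only up to the coboundary of x{y, z}. -/
theorem gerstenhaberBracket_cup {x y z : List A.carrier → A.carrier}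
    (hx : x ∈ A.regular.cocycles p) (hy : y ∈ A.regular.cocycles q)
    (hz : z ∈ A.regular.cocycles r) :
    A.gerstenhaberBracket p (q + r) x (A.cup r y z) =
      A.cup r (A.gerstenhaberBracket p q x y) z +
        (-1 : k) ^ ((p - 1) * q) • A.cup (p + r - 1) y (A.gerstenhaberBracket p r x z) +
      A.hochschildDiff (p + q + r - 2) ((-1 : k) ^ (p + r * (q + 1)) •
        insMid (q + 1) (insAfter (r + 1) z x) y) := by
  rw [mem_regular_cocycles] at hx hy hz
  have h1 := ins_cupWith (LinearMap.mul k A.carrier) r (p + 1) hy.1.1 z (hx.1.1.twists' hx.1.2)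
  rw [map_smul, hochschildDiff_insMid_insAfter hx.1.1 hy.1.1 hz.1.1 hy.1.2 hz.1.2 hx.2 hy.2 hz.2]
  simp only [gerstenhaberBracket_eq, cup_eq, h1, map_sub, map_smul, LinearMap.sub_apply,
    LinearMap.smul_apply]
  rw [cupWith_congr _ (show Even (r + (p + 1) - (p + r + 1)) by
      rw [show r + (p + 1) - (p + r + 1) = 0 by ring]; decide),
    cupWith_congr _ (show Even (p + r - 1 - (p + r + 1)) by
      rw [show p + r - 1 - (p + r + 1) = -2 by ring]; decide)]
  by_cases hp : Even p <;> by_cases hq : Even q <;> by_cases hr : Even r <;>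
    simp [neg_one_zpow_eq_ite, Int.even_add, Int.even_mul, -Int.not_even_iff_odd,
      ← Int.not_even_iff_odd, hp, hq, hr] <;> abel

/-- The Gerstenhaber algebra `HH^*(A, A)`. -/
def gerstenhaberHH : GerstenhaberAlgebra k A.regular.HH where
  mul _ _ _ h := hhMul h
  bracket _ _ _ h := hhBracket h
  mul_assoc p q r pq qr pqr h₁ h₂ h₃ h₄ x y z := by
    obtain ⟨x, rfl⟩ := cls_surjective _ _ x
    obtain ⟨y, rfl⟩ := cls_surjective _ _ y
    obtain ⟨z, rfl⟩ := cls_surjective _ _ z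
    subst h₃
    exact congrArg A.regular.cls (Subtype.ext (cup_assoc q r x.1 y.1 z.1))
  mul_comm p q r h h' x y := by
    obtain ⟨x, rfl⟩ := cls_surjective _ _ x
    obtain ⟨y, rfl⟩ := cls_surjective _ _ y
    subst h
    refine cls_eq (f := cupCocycles rfl x y) (g := (-1 : k) ^ (p * q) • cupCocycles h' y x)
      (q := p + q - 1) ?_ (by omega) (cup_comm x.2 y.2)
    obtain ⟨⟨hx, hx'⟩, -⟩ := mem_regular_cocycles.1 x.2
    obtain ⟨⟨hy, hy'⟩, -⟩ := mem_regular_cocycles.1 y.2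
    exact mem_regular_cochains.2 ⟨(hx.ins hy _).smul _, (hx'.ins hy' _).smul _⟩
  bracket_mul p q r qr pq pr s h₁ h₂ h₃ h₄ h₅ h₆ x y z := by
    obtain ⟨x, rfl⟩ := cls_surjective _ _ x
    obtain ⟨y, rfl⟩ := cls_surjective _ _ y
    obtain ⟨z, rfl⟩ := cls_surjective _ _ z
    obtain rfl := h₁
    obtain rfl : pr = p + r - 1 := by omega
    refine cls_eq (f := bracketCocycles h₂ x (cupCocycles rfl y z))
      (g := cupCocycles h₄ (bracketCocycles h₃ x y) z +
        (-1 : k) ^ ((p - 1) * q) • cupCocycles h₆ y (bracketCocycles h₅ x z))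
      (q := p + q + r - 2) ?_ (by omega) (gerstenhaberBracket_cup x.2 y.2 z.2)
    obtain ⟨⟨hx, hx'⟩, -⟩ := mem_regular_cocycles.1 x.2
    obtain ⟨⟨hy, hy'⟩, -⟩ := mem_regular_cocycles.1 y.2
    obtain ⟨⟨hz, hz'⟩, -⟩ := mem_regular_cocycles.1 z.2
    exact mem_regular_cochains.2 ⟨(hx.insMid_insAfter hy hz _ _).smul _,
      (hx'.insMid_insAfter hy' hz' _ _).smul _⟩
  bracket_antisymm p q r h h' x y := by
    obtain ⟨x, rfl⟩ := cls_surjective _ _ x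
    obtain ⟨y, rfl⟩ := cls_surjective _ _ y
    exact congrArg A.regular.cls (a₁ := bracketCocycles h x y)
      (a₂ := -((-1 : k) ^ ((p - 1) * (q - 1)) • bracketCocycles h' y x))
      (Subtype.ext (gerstenhaberBracket_antisymm p q x.1 y.1))
  jacobi p q r pq qr pr s h₁ h₂ h₃ h₄ h₅ h₆ x y z := by
    obtain ⟨x, rfl⟩ := cls_surjective _ _ x
    obtain ⟨y, rfl⟩ := cls_surjective _ _ y
    obtain ⟨z, rfl⟩ := cls_surjective _ _ z
    obtain ⟨⟨hx, hx'⟩, -⟩ := mem_regular_cocycles.1 x.2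
    obtain ⟨⟨hy, hy'⟩, -⟩ := mem_regular_cocycles.1 y.2
    obtain ⟨⟨hz, hz'⟩, -⟩ := mem_regular_cocycles.1 z.2
    obtain rfl : pq = p + q - 1 := by omega
    obtain rfl : qr = q + r - 1 := by omega
    obtain rfl : pr = p + r - 1 := by omega
    exact congrArg A.regular.cls
      (a₁ := bracketCocycles h₂ (bracketCocycles h₁ x y) z)
      (a₂ := bracketCocycles h₄ x (bracketCocycles h₃ y z) -
        (-1 : k) ^ ((p - 1) * (q - 1)) • bracketCocycles h₆ y (bracketCocycles h₅ x z))
      (Subtype.ext (gerstenhaberBracket_jacobi hx hy hz hx' hy' hz'))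

theorem isHochschild_gerstenhaberHH : (gerstenhaberHH (A := A)).IsHochschild :=
  ⟨fun _ _ _ h x y => ⟨cupCocycles h x y, rfl, rfl⟩,
    fun _ _ _ h x y => ⟨bracketCocycles h x y, rfl, rfl⟩⟩

end DGAlgebra

open DGAlgebra

namespace DGBimodule

variable {k : Type u} [Field k] {A : DGAlgebra.{u, v} k} {n p q : ℤ}

/-! ### The isomorphism with the cohomology of the dual -/

theorem mem_dual_cochains {f : List A.carrier → A.dual.carrier} :
    f ∈ A.dual.cochains p ↔ A.SlotLinear True f ∧ A.HasDegree A.dual.gr p f :=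
  A.dual.isCochain_iff p f

section

variable (m : Hom A.regular (A.dual.shift n))

theorem Hom.compLeft_mem_cochains {f : List A.carrier → A.carrier}
    (hf : f ∈ A.regular.cochains p) (h : p + n = q) :
    m.toDual.compLeft _ f ∈ A.dual.cochains q := by
  subst h
  obtain ⟨h1, h2⟩ := mem_regular_cochains.1 hf
  exact mem_dual_cochains.2 ⟨h1.comp _, m.hasDegree_compLeft h2⟩

theorem Hom.diff_compLeft' {f : List A.carrier → A.carrier} (hf : f ∈ A.regular.cochains p)
    (h : p + n = q) : A.dual.diff q (m.toDual.compLeft _ f) =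
      (-1 : k) ^ n • m.toDual.compLeft _ (A.hochschildDiff p f) := by
  subst h
  exact m.diff_compLeft (mem_regular_cochains.1 hf).1 p

theorem Hom.compLeft_mem_cocycles {f : List A.carrier → A.carrier}
    (hf : f ∈ A.regular.cocycles p) (h : p + n = q) :
    m.toDual.compLeft _ f ∈ A.dual.cocycles q := by
  refine ⟨m.compLeft_mem_cochains hf.1 h, ?_⟩
  have df : A.hochschildDiff p f = 0 := hf.2
  exact (m.diff_compLeft' hf.1 h).trans (by rw [df, map_zero, smul_zero])

theorem Hom.compLeft_hochschildDiff {f : List A.carrier → A.carrier}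
    (hf : f ∈ A.regular.cochains p) (h : p + n = q) :
    m.toDual.compLeft _ (A.hochschildDiff p f) =
      A.dual.diff q ((-1 : k) ^ n • m.toDual.compLeft _ f) := by
  rw [map_smul, m.diff_compLeft' hf h, smul_smul, neg_one_zpow_mul_self, one_smul]

theorem Hom.compLeft_mem_coboundaries {f : List A.carrier → A.carrier}
    (hf : f ∈ A.regular.coboundaries p) (h : p + n = q) :
    m.toDual.compLeft _ f ∈ A.dual.coboundaries q := by
  obtain ⟨g, hg, rfl⟩ := exists_of_mem_regular_coboundaries hf
  have h' : p - 1 + n = q - 1 := by omega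
  rw [m.compLeft_hochschildDiff hg h']
  exact ⟨_, Submodule.smul_mem _ _ (m.compLeft_mem_cochains hg h'), rfl⟩

variable {m}

theorem Hom.IsQuasiIso.exists_eq_compLeft_add_diff (hm : m.IsQuasiIso)
    {ψ : List A.carrier → A.dual.carrier} (hψ : ψ ∈ A.dual.cocycles q) (h : p + n = q) :
    ∃ φ : List A.carrier → A.carrier, φ ∈ A.regular.cocycles p ∧
      ∃ χ ∈ A.dual.cochains (q - 1), ψ = m.toDual.compLeft _ φ + A.dual.diff (q - 1) χ := by
  subst h
  have dψ : A.dual.diff (p + n) ψ = 0 := hψ.2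
  obtain ⟨(φ : List A.carrier → A.carrier), hφ, dφ, (χ : List A.carrier → A.dual.carrier), hχ, e⟩ :=
    hm.exists_cocycle (mem_cochains_shift.2 hψ.1)
    ((diff_shift hψ.1).trans (by rw [dψ, smul_zero]; rfl))
  have hχ' := mem_cochains_shift.1 hχ
  rw [diff_shift hχ'] at e
  rw [show p - 1 + n = p + n - 1 by ring] at hχ' e
  exact ⟨φ, ⟨hφ, dφ⟩, (-1 : k) ^ n • χ, Submodule.smul_mem _ _ hχ',
    e.trans (congrArg (m.toDual.compLeft _ φ + ·) (map_smul _ _ _).symm)⟩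

theorem Hom.IsQuasiIso.mem_coboundaries (hm : m.IsQuasiIso) {φ : List A.carrier → A.carrier}
    (hφ : φ ∈ A.regular.cocycles p) (h : p + n = q)
    (hmφ : m.toDual.compLeft _ φ ∈ A.dual.coboundaries q) : φ ∈ A.regular.coboundaries p := by
  subst h
  obtain ⟨ψ, hψ, e⟩ := exists_of_mem_coboundaries (q := p - 1 + n) hmφ (by omega)
  have hψ' : (-1 : k) ^ n • ψ ∈ A.dual.cochains (p - 1 + n) := Submodule.smul_mem _ _ hψ
  obtain ⟨χ, hχ, rfl⟩ := hm.exists_diff_eq hφ.1 hφ.2 (mem_cochains_shift.2 hψ')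
    ((diff_shift hψ').trans (by
      rw [map_smul, smul_smul, neg_one_zpow_mul_self, one_smul]; exact e.symm))
  exact ⟨χ, hχ, rfl⟩

variable (m)

/-- The map `f ↦ (-1) ^ ((n + 1) p) m ∘ f` on cocycles of degree `p`. -/
def Hom.capCocycles (h : p + n = q) : A.regular.cocycles p →ₗ[k] A.dual.cocycles q where
  toFun f := ⟨(-1 : k) ^ ((n + 1) * p) • m.toDual.compLeft _ f.1,
    Submodule.smul_mem _ _ (m.compLeft_mem_cocycles f.2 h)⟩
  map_add' f g := Subtype.ext
    (map_add ((-1 : k) ^ ((n + 1) * p) • m.toDual.compLeft (List A.carrier)) f.1 g.1)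
  map_smul' c f := Subtype.ext
    (map_smul ((-1 : k) ^ ((n + 1) * p) • m.toDual.compLeft (List A.carrier)) c f.1)

/-- The map on Hochschild cohomology induced by a morphism from `A` to a shift of its dual. -/
def Hom.capHH (h : p + n = q) : A.regular.HH p →ₗ[k] A.dual.HH q :=
  mapHH (m.capCocycles h) fun _ hf =>
    Submodule.smul_mem _ _ (m.compLeft_mem_coboundaries hf h)

theorem Hom.capHH_cls (h : p + n = q) (f : A.regular.cocycles p) :
    m.capHH h (A.regular.cls f) = A.dual.cls (m.capCocycles h f) := rfl

variable {m}

theorem Hom.IsQuasiIso.bijective_capHH (hm : m.IsQuasiIso) (h : p + n = q) :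
    Function.Bijective (m.capHH h) := by
  have hz : (-1 : k) ^ ((n + 1) * p) * (-1 : k) ^ ((n + 1) * p) = 1 := neg_one_zpow_mul_self _
  constructor
  · rw [injective_iff_map_eq_zero]
    intro f hf
    obtain ⟨f, rfl⟩ := cls_surjective _ _ f
    have h1 : (-1 : k) ^ ((n + 1) * p) • m.toDual.compLeft _ f.1 ∈ A.dual.coboundaries q := by
      have := (cls_eq_iff (g := 0)).1 hf
      rwa [ZeroMemClass.coe_zero, sub_zero] at this
    have h2 := Submodule.smul_mem _ ((-1 : k) ^ ((n + 1) * p)) h1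
    rw [smul_smul, hz, one_smul] at h2
    refine (cls_eq_iff (g := 0)).2 ?_
    rw [ZeroMemClass.coe_zero, sub_zero]
    exact hm.mem_coboundaries f.2 h h2
  · intro ψ
    obtain ⟨ψ, rfl⟩ := cls_surjective _ _ ψ
    obtain ⟨φ, hφ, χ, hχ, e⟩ := hm.exists_eq_compLeft_add_diff ψ.2 h
    refine ⟨A.regular.cls ((-1 : k) ^ ((n + 1) * p) • ⟨φ, hφ⟩), ?_⟩
    rw [cls_smul, map_smul, m.capHH_cls, ← cls_smul]
    refine (cls_eq hχ (by omega) ?_).symm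
    refine e.trans (congrArg (· + _) ?_)
    change _ = (-1 : k) ^ ((n + 1) * p) • (-1 : k) ^ ((n + 1) * p) • m.toDual.compLeft _ φ
    rw [smul_smul, hz, one_smul]

/-- The isomorphism `HH^(p+n)(A, A^∨) → HH^p(A, A)` induced by a quasi-isomorphism
`A → A^∨[n]`. -/
def Hom.IsQuasiIso.dualityEquiv (hm : m.IsQuasiIso) (p q : ℤ) (h : p + n = q) :
    A.dual.HH q ≃ₗ[k] A.regular.HH p :=
  (LinearEquiv.ofBijective (m.capHH h) (hm.bijective_capHH h)).symm

theorem Hom.IsQuasiIso.dualityEquiv_symm_cls (hm : m.IsQuasiIso) (h : p + n = q)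
    (f : A.regular.cocycles p) :
    (hm.dualityEquiv p q h).symm (A.regular.cls f) = A.dual.cls (m.capCocycles h f) := rfl

theorem Hom.IsQuasiIso.isInducedBy_dualityEquiv (hm : m.IsQuasiIso) :
    IsInducedBy m hm.dualityEquiv :=
  fun _ _ h f => ⟨m.capCocycles h f, rfl, rfl⟩

end

/-! ### The dual Connes operator on cohomology -/

section

theorem connesForm_add (φ ψ : List A.carrier → A.dual.carrier) :
    connesForm (φ + ψ) = connesForm φ + connesForm ψ := by
  funext U b M
  simp only [connesForm, Pi.add_apply, map_add]

theorem connesForm_smul (c : k) (φ : List A.carrier → A.dual.carrier) :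
    connesForm (c • φ) = c • connesForm φ := by
  funext U b M
  simp only [connesForm, Pi.smul_apply, map_smul]

variable {N : Prop} {φ ψ : List A.carrier → A.dual.carrier}

theorem connes_add (hφ : A.SlotLinear N φ) (hp : A.HasDegree A.dual.gr p φ)
    (hψ : A.SlotLinear N ψ) (hp' : A.HasDegree A.dual.gr p ψ) (h : A.SlotLinear N (φ + ψ))
    (hp'' : A.HasDegree A.dual.gr p (φ + ψ)) :
    connes h hp'' = connes hφ hp + connes hψ hp' := by
  funext L
  refine evalDual_ext fun b => ?_
  rw [Pi.add_apply, map_add, connes_apply, connes_apply, connes_apply, connesForm_add]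
  simp only [cycSum, Pi.add_apply, splitSum_add]

theorem connes_smul (c : k) (hφ : A.SlotLinear N φ) (hp : A.HasDegree A.dual.gr p φ)
    (h : A.SlotLinear N (c • φ)) (hp' : A.HasDegree A.dual.gr p (c • φ)) :
    connes h hp' = c • connes hφ hp := by
  funext L
  refine evalDual_ext fun b => ?_
  rw [Pi.smul_apply, map_smul, connes_apply, connes_apply, connesForm_smul]
  simp only [cycSum, Pi.smul_apply, splitSum_smul]

/-- The dual Connes operator anticommutes with the differential. -/
theorem diff_connes (hφ : A.SlotLinear N φ) (hp : A.HasDegree A.dual.gr p φ)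
    (h : A.SlotLinear N (A.dual.diff p φ)) (hp' : A.HasDegree A.dual.gr (p + 1) (A.dual.diff p φ)) :
    A.dual.diff (p - 1) (connes hφ hp) = -connes h hp' := by
  funext L
  refine evalDual_ext fun b => ?_
  rw [dual_diff_connes, Pi.neg_apply, map_neg, connes_apply]

theorem connes_congr (e : φ = ψ) (hφ : A.SlotLinear N φ) (hp : A.HasDegree A.dual.gr p φ)
    (hψ : A.SlotLinear N ψ) (hp' : A.HasDegree A.dual.gr p ψ) : connes hφ hp = connes hψ hp' := by
  subst e; rfl

/-- The dual Connes operator on the space of cochains of degree `p`. -/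
def connesCochains (p : ℤ) : A.dual.cochains p →ₗ[k] (List A.carrier → A.dual.carrier) where
  toFun φ := connes (mem_dual_cochains.1 φ.2).1 (mem_dual_cochains.1 φ.2).2
  map_add' _ _ := connes_add _ _ _ _ _ _
  map_smul' c _ := connes_smul c _ _ _ _

theorem connesCochains_mem (φ : A.dual.cochains p) (h : q + 1 = p) :
    connesCochains p φ ∈ A.dual.cochains q := by
  obtain rfl : q = p - 1 := by omega
  obtain ⟨h1, h2⟩ := mem_dual_cochains.1 φ.2
  exact mem_dual_cochains.2 ⟨slotLinear_connes h1 h2, hasDegree_connes h1 h2⟩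

theorem diff_connesCochains (φ : A.dual.cochains p) (h : q + 1 = p) :
    A.dual.diff q (connesCochains p φ) =
      -connesCochains (p + 1) ⟨A.dual.diff p φ.1, A.dual.diff_mem_cochains φ.2⟩ := by
  obtain rfl : q = p - 1 := by omega
  obtain ⟨h1, h2⟩ := mem_dual_cochains.1 φ.2
  obtain ⟨h3, h4⟩ := mem_dual_cochains.1 (A.dual.diff_mem_cochains φ.2)
  exact diff_connes h1 h2 h3 h4

/-- The dual Connes operator on cocycles. -/
def connesCocycles (h : q + 1 = p) : A.dual.cocycles p →ₗ[k] A.dual.cocycles q :=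
  LinearMap.codRestrict _ (connesCochains p ∘ₗ Submodule.inclusion inf_le_left) fun φ => by
    have e : (⟨A.dual.diff p φ.1, A.dual.diff_mem_cochains φ.2.1⟩ : A.dual.cochains (p + 1)) = 0 :=
      Subtype.ext φ.2.2
    have h1 := diff_connesCochains ⟨φ.1, φ.2.1⟩ h
    rw [e, map_zero, neg_zero] at h1
    exact ⟨connesCochains_mem _ h, h1⟩

/-- The dual Connes operator on Hochschild cohomology. -/
def connesHH (p q : ℤ) (h : q + 1 = p) : A.dual.HH p →ₗ[k] A.dual.HH q :=
  mapHH (connesCocycles h) fun φ hφ => by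
    subst h
    obtain ⟨χ, hχ, e⟩ := exists_of_mem_coboundaries hφ rfl
    have h1 := diff_connesCochains (q := q - 1) ⟨χ, hχ⟩ (by omega)
    refine ⟨-connesCochains q ⟨χ, hχ⟩, neg_mem (connesCochains_mem _ (by omega)), ?_⟩
    rw [map_neg, h1, neg_neg]
    have e' : (⟨A.dual.diff q χ, A.dual.diff_mem_cochains hχ⟩ : A.dual.cochains (q + 1)) =
        ⟨φ.1, φ.2.1⟩ := Subtype.ext e.symm
    exact congrArg (connesCochains (q + 1)) e'

theorem connesHH_cls (h : q + 1 = p) (φ : A.dual.cocycles p) :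
    connesHH p q h (A.dual.cls φ) = A.dual.cls (connesCocycles h φ) := rfl

theorem isConnesOnHH_connesHH : IsConnesOnHH (connesHH (A := A)) :=
  fun _ _ h φ => ⟨connesCocycles h φ, isConnesDual_connes
    (mem_dual_cochains.1 φ.2.1).1 (mem_dual_cochains.1 φ.2.1).2, rfl⟩

theorem connesHH_connesHH {r : ℤ} (h : q + 1 = p) (h' : r + 1 = q) (φ : A.dual.HH p) :
    connesHH q r h' (connesHH p q h φ) = 0 := by
  obtain ⟨φ, rfl⟩ := cls_surjective _ _ φ
  obtain rfl : q = p - 1 := by omega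
  rw [connesHH_cls, connesHH_cls]
  obtain ⟨h1, h2⟩ := mem_dual_cochains.1 φ.2.1
  exact congrArg A.dual.cls (Subtype.ext (connes_connes h1 h2) :
    connesCocycles h' (connesCocycles h φ) = 0)

end

end DGBimodule

open DGAlgebra

namespace DGBimodule

variable {k : Type u} [Field k] {A : DGAlgebra.{u, v} k} {n p q : ℤ}
  {m : Hom A.regular (A.dual.shift n)}

/-! ### The Batalin–Vilkovisky operator -/

/-- The operator on `HH^*(A, A)` which corresponds to the dual Connes operator. -/
def Hom.IsQuasiIso.bvOperator (hm : m.IsQuasiIso) (p q : ℤ) (h : q + 1 = p) :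
    A.regular.HH p →ₗ[k] A.regular.HH q :=
  (hm.dualityEquiv q (q + n) rfl).toLinearMap ∘ₗ connesHH (p + n) (q + n) (by omega) ∘ₗ
    (hm.dualityEquiv p (p + n) rfl).symm.toLinearMap

theorem Hom.IsQuasiIso.bvOperator_apply (hm : m.IsQuasiIso) {p' q' : ℤ} (h : q + 1 = p)
    (hp : p + n = p') (hq : q + n = q') (h' : q' + 1 = p') (x : A.regular.HH p) :
    hm.bvOperator p q h x =
      hm.dualityEquiv q q' hq (connesHH p' q' h' ((hm.dualityEquiv p p' hp).symm x)) := by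
  subst hp hq
  rfl

theorem Hom.IsQuasiIso.bvOperator_bvOperator (hm : m.IsQuasiIso) {r : ℤ} (h : q + 1 = p)
    (h' : r + 1 = q) (x : A.regular.HH p) :
    hm.bvOperator q r h' (hm.bvOperator p q h x) = 0 := by
  rw [hm.bvOperator_apply h rfl rfl (by omega), hm.bvOperator_apply h' rfl rfl (by omega),
    LinearEquiv.symm_apply_apply, connesHH_connesHH, map_zero]

/-- Describes the operator on cochains. The sign `(-1) ^ (n + 1)` is the ratio of the normalizations
of the duality map in degrees `p` and `p - 1`. -/
theorem Hom.IsQuasiIso.exists_bvOperator_cls (hm : m.IsQuasiIso) (h : q + 1 = p)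
    (x : A.regular.cocycles p) :
    ∃ a : A.regular.cocycles q, hm.bvOperator p q h (A.regular.cls x) = A.regular.cls a ∧
      ∀ (h1 : A.SlotLinear True (m.toDual.compLeft _ x.1))
        (h2 : A.HasDegree A.dual.gr (p + n) (m.toDual.compLeft _ x.1)),
        ∃ S ∈ A.dual.cochains (q + n - 1),
          connes h1 h2 = (-1 : k) ^ (n + 1) • m.toDual.compLeft _ a.1 +
            A.dual.diff (q + n - 1) S := by
  have hpq : q + n + 1 = p + n := by omega
  let ξ : A.dual.cocycles (p + n) := ⟨m.toDual.compLeft _ x.1, m.compLeft_mem_cocycles x.2 rfl⟩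
  obtain ⟨φ, hφ, S, hS, e⟩ := hm.exists_eq_compLeft_add_diff (connesCocycles hpq ξ).2 rfl
  have e' : (connesCocycles hpq ξ).1 =
      (-1 : k) ^ (n + 1) • m.toDual.compLeft _ ((-1 : k) ^ (n + 1) • φ) +
        A.dual.diff (q + n - 1) S := by
    rw [e, map_smul, smul_smul, neg_one_zpow_mul_self, one_smul]
  refine ⟨⟨(-1 : k) ^ (n + 1) • φ, Submodule.smul_mem _ _ hφ⟩, ?_, fun h1 h2 => ⟨S, hS, e'⟩⟩
  rw [hm.bvOperator_apply h rfl rfl hpq, ← LinearEquiv.eq_symm_apply, hm.dualityEquiv_symm_cls,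
    hm.dualityEquiv_symm_cls, connesHH_cls]
  have hξ : m.capCocycles rfl x = (-1 : k) ^ ((n + 1) * p) • ξ := rfl
  rw [hξ, map_smul]
  refine cls_eq (S := (-1 : k) ^ ((n + 1) * p) • S) (Submodule.smul_mem _ _ hS) (by omega) ?_
  change (-1 : k) ^ ((n + 1) * p) • (connesCocycles hpq ξ).1 =
    (-1 : k) ^ ((n + 1) * q) • m.toDual.compLeft _ ((-1 : k) ^ (n + 1) • φ) + _
  rw [e', smul_add, map_smul _ _ S, smul_smul, neg_one_zpow_mul,
    neg_one_zpow_congr (b := (n + 1) * q) ⟨n + 1, by rw [← h]; ring⟩]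

/-- Cup product with a cocycle carries coboundaries to coboundaries, so a representative of the dual
Connes operator may be replaced inside a product. -/
theorem Hom.cupWith_add_diff (m : Hom A.regular (A.dual.shift n)) {s t : ℤ}
    {y a : List A.carrier → A.carrier} (hy : y ∈ A.regular.cocycles q)
    {S w : List A.carrier → A.dual.carrier} (hS : S ∈ A.dual.cochains t) (h : s + n = t + 1) (c : k)
    (hw : w = c • m.toDual.compLeft _ a + A.dual.diff t S) :
    A.cupWith A.dual.left (t + 1) y w =
      (c * (-1 : k) ^ (n * q)) • m.toDual.compLeft _ (A.cup s y a) +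
        A.dual.diff (q + t) ((-1 : k) ^ q • A.cupWith A.dual.left t y S) := by
  obtain ⟨⟨h1, h2⟩, h3⟩ := mem_regular_cocycles.1 hy
  have hz : (-1 : k) ^ (n * q) * (-1 : k) ^ (n * q) = 1 := neg_one_zpow_mul_self _
  rw [map_smul, A.dual.diff_cupWith h1 h2 (mem_dual_cochains.1 hS).1, h3, map_zero,
    LinearMap.zero_apply, zero_add, smul_smul, neg_one_zpow_mul_self, one_smul, cup_eq,
    m.compLeft_cupWith h1 h2, smul_smul, mul_assoc, hz, mul_one, h, hw, map_add, map_smul]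

theorem cupWith_left_mem_cochains {y : List A.carrier → A.carrier} (hy : y ∈ A.regular.cochains q)
    {S : List A.carrier → A.dual.carrier} (hS : S ∈ A.dual.cochains p) (r : ℤ) :
    A.cupWith A.dual.left r y S ∈ A.dual.cochains (q + p) := by
  obtain ⟨h1, h2⟩ := mem_regular_cochains.1 hy
  obtain ⟨h3, h4⟩ := mem_dual_cochains.1 hS
  exact mem_dual_cochains.2 ⟨.cupWith _ _ h1 h3, .cupWith A.dual.left_mem h2 h4 _⟩

/-- The Batalin–Vilkovisky identity for cocycles, up to a coboundary. -/
theorem Hom.IsQuasiIso.bracket_sub_mem_coboundaries (hm : m.IsQuasiIso)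
    {x y a b c : List A.carrier → A.carrier} (hx : x ∈ A.regular.cocycles p)
    (hy : y ∈ A.regular.cocycles q) (ha : a ∈ A.regular.cocycles (p - 1))
    (hb : b ∈ A.regular.cocycles (q - 1)) (hc : c ∈ A.regular.cocycles (p + q - 1))
    (ea : ∀ (h1 : A.SlotLinear True (m.toDual.compLeft _ x))
      (h2 : A.HasDegree A.dual.gr (p + n) (m.toDual.compLeft _ x)),
      ∃ S ∈ A.dual.cochains (p - 1 + n - 1),
        connes h1 h2 = (-1 : k) ^ (n + 1) • m.toDual.compLeft _ a +
          A.dual.diff (p - 1 + n - 1) S)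
    (eb : ∀ (h1 : A.SlotLinear True (m.toDual.compLeft _ y))
      (h2 : A.HasDegree A.dual.gr (q + n) (m.toDual.compLeft _ y)),
      ∃ S ∈ A.dual.cochains (q - 1 + n - 1),
        connes h1 h2 = (-1 : k) ^ (n + 1) • m.toDual.compLeft _ b +
          A.dual.diff (q - 1 + n - 1) S)
    (ec : ∀ (h1 : A.SlotLinear True (m.toDual.compLeft _ (A.cup q x y)))
      (h2 : A.HasDegree A.dual.gr (p + q + n) (m.toDual.compLeft _ (A.cup q x y))),
      ∃ S ∈ A.dual.cochains (p + q - 1 + n - 1),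
        connes h1 h2 = (-1 : k) ^ (n + 1) • m.toDual.compLeft _ c +
          A.dual.diff (p + q - 1 + n - 1) S) :
    A.gerstenhaberBracket p q x y - ((-1 : k) ^ p • c - (-1 : k) ^ p • A.cup q a y -
      A.cup (q - 1) x b) ∈ A.regular.coboundaries (p + q - 1) := by
  have hxy : A.cup q x y ∈ A.regular.cocycles (p + q) := cup_mem_cocycles hx hy rfl
  -- Since `m` is injective on cohomology, the identity may be checked after applying `m`.
  refine hm.mem_coboundaries (q := p + q - 1 + n) ?_ rfl ?_
  · exact sub_mem (gerstenhaberBracket_mem_cocycles hx hy (by omega))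
      (sub_mem (sub_mem (Submodule.smul_mem _ _ hc)
        (Submodule.smul_mem _ _ (cup_mem_cocycles ha hy (by omega))))
        (cup_mem_cocycles hx hb (by omega)))
  obtain ⟨h1x, h2x⟩ := mem_dual_cochains.1 (m.compLeft_mem_cochains hx.1 rfl)
  obtain ⟨h1y, h2y⟩ := mem_dual_cochains.1 (m.compLeft_mem_cochains hy.1 rfl)
  obtain ⟨h1, h2⟩ := mem_dual_cochains.1 (m.compLeft_mem_cochains hxy.1 rfl)
  obtain ⟨⟨sx, dx⟩, cx⟩ := mem_regular_cocycles.1 hx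
  obtain ⟨⟨sy, dy⟩, cy⟩ := mem_regular_cocycles.1 hy
  obtain ⟨S₁, hS₁, ea⟩ := ea h1x h2x
  obtain ⟨S₂, hS₂, eb⟩ := eb h1y h2y
  obtain ⟨S₃, hS₃, ec⟩ := ec h1 h2
  -- the quotient by the coboundaries
  let π := (A.dual.coboundaries (p + q - 1 + n)).mkQ
  let l := π ∘ₗ m.toDual.compLeft (List A.carrier)
  have hπ : ∀ {s : ℤ} {S : List A.carrier → A.dual.carrier}, s + 1 = p + q - 1 + n →
      S ∈ A.dual.cochains s → π (A.dual.diff s S) = 0 := fun hs hS =>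
    (Submodule.Quotient.mk_eq_zero _).2 (A.dual.diff_mem_coboundaries hS hs)
  have ha' := m.cupWith_add_diff hy hS₁ (s := p - 1) (by omega) _ ea
  have hb' := m.cupWith_add_diff hx hS₂ (s := q - 1) (by omega) _ eb
  have la := congrArg π ha'
  have lb := congrArg π hb'
  rw [map_add, map_smul, hπ (by omega) (Submodule.smul_mem _ _
    (cupWith_left_mem_cochains hy.1 hS₁ _)), add_zero] at la
  rw [map_add, map_smul, hπ (by omega) (Submodule.smul_mem _ _
    (cupWith_left_mem_cochains hx.1 hS₂ _)), add_zero] at lb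
  -- commutativity of the cup product
  have lc := congrArg l (cup_comm hy ha)
  have hT : -(-1 : k) ^ q • ins (p - 1 + 1) y a ∈ A.regular.cochains (q + (p - 1) - 1) :=
    have ha := (mem_regular_cocycles.1 ha).1
    mem_regular_cochains.2 ⟨(sy.ins ha.1 _).smul _, (dy.ins ha.2 _).smul _⟩
  have hT' : l (A.hochschildDiff (q + (p - 1) - 1) (-(-1 : k) ^ q • ins (p - 1 + 1) y a)) = 0 := by
    change π _ = 0
    rw [m.compLeft_hochschildDiff hT rfl]
    exact hπ (by omega) (Submodule.smul_mem _ _ (m.compLeft_mem_cochains hT rfl))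
  rw [map_add, hT', add_zero, map_smul] at lc
  -- the dual Connes operator on the product
  obtain ⟨S, hS, hS', e⟩ := m.connes_cup sy sx dx dy cy cx h1y h2y h1x h2x
    (by rwa [← cup_eq]) (by rwa [← cup_eq])
  have le := congrArg π ((connes_congr (by rw [cup_eq]) h1 h2 _ _).trans e)
  have lS : π (A.dual.diff (p + q + n - 2) S) = 0 :=
    hπ (by omega) (mem_dual_cochains.2 ⟨hS, hS'⟩)
  have lS₃ : π (A.dual.diff (p + q - 1 + n - 1) S₃) = 0 := hπ (by omega) hS₃
  rw [ec] at le
  simp only [map_add, map_smul, lS, lS₃, add_zero] at le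
  rw [show p + n - 1 = p - 1 + n - 1 + 1 by ring, show q + n - 1 = q - 1 + n - 1 + 1 by ring, la,
    lb] at le
  rw [← Submodule.Quotient.mk_eq_zero]
  change l (A.gerstenhaberBracket p q x y - ((-1 : k) ^ p • c - (-1 : k) ^ p • A.cup q a y -
    A.cup (q - 1) x b)) = 0
  change (-1 : k) ^ (n + 1) • l c = (-1 : k) ^ (p + n + 1) • l _ + _ • (_ • l (A.cup (p - 1) y a)) +
    _ • (_ • l _ + _ • _ • l (A.cup (q - 1) x b)) at le
  rw [lc] at le
  simp only [gerstenhaberBracket_eq, map_sub, map_smul]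
  generalize l c = u₁, l (ins (q + 1) x y) = u₂, l (ins (p + 1) y x) = u₃, l (A.cup q a y) = u₄,
    l (A.cup (q - 1) x b) = u₅ at le ⊢
  clear * - le
  -- A linear relation among five classes remains, with signs depending only on the parities of `p`,
  -- `q`, `n`. It agrees with the goal up to a global sign, whence the two closing alternatives.
  by_cases hp : Even p <;> by_cases hq : Even q <;> by_cases hn : Even n <;>
    simp [neg_one_zpow_eq_ite, Int.even_add, Int.even_mul, -Int.not_even_iff_odd,
      ← Int.not_even_iff_odd, hp, hq, hn] at le ⊢ <;>
    rw [← sub_eq_zero] at le <;>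
    first
    | rw [← le]; abel1
    | rw [← neg_eq_zero, ← le]; abel1

/-- The Batalin–Vilkovisky algebra `HH^*(A, A)`. -/
def Hom.IsQuasiIso.bvAlgebra (hm : m.IsQuasiIso) : BVAlgebra k A.regular.HH where
  toGerstenhaberAlgebra := gerstenhaberHH
  Δ := hm.bvOperator
  Δ_Δ _ _ _ h h' x := hm.bvOperator_bvOperator h h' x
  bracket_eq p q pq p' q' r h₁ h₂ h₃ h₄ h₅ h₆ h₇ x y := by
    obtain ⟨x, rfl⟩ := cls_surjective _ _ x
    obtain ⟨y, rfl⟩ := cls_surjective _ _ y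
    subst h₂
    obtain rfl : p' = p - 1 := by omega
    obtain rfl : q' = q - 1 := by omega
    obtain rfl : r = p + q - 1 := by omega
    obtain ⟨a, ha, ea⟩ := hm.exists_bvOperator_cls h₄ x
    obtain ⟨b, hb, eb⟩ := hm.exists_bvOperator_cls h₆ y
    obtain ⟨c, hc, ec⟩ := hm.exists_bvOperator_cls h₃ (cupCocycles rfl x y)
    rw [ha, hb]
    refine Eq.trans ?_ (congrArg (fun z => (-1 : k) ^ p • z -
      (-1 : k) ^ p • hhMul h₅ (A.regular.cls a) (A.regular.cls y) -
      hhMul h₇ (A.regular.cls x) (A.regular.cls b)) hc.symm)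
    exact (cls_eq_iff (f := bracketCocycles h₁ x y) (g := (-1 : k) ^ p • c -
      (-1 : k) ^ p • cupCocycles h₅ a y - cupCocycles h₇ x b)).2
      (hm.bracket_sub_mem_coboundaries x.2 y.2 a.2 b.2 c.2 ea eb ec)

end DGBimodule

end HochschildBV

end

theorem mainTheorem3 {k : Type u} [Field k] (A : HochschildBV.DGAlgebra.{u, v} k) (n : ℤ)
    (m : HochschildBV.DGBimodule.Hom A.regular (A.dual.shift n)) (hm : m.IsQuasiIso) :
    ∃ (D : ∀ p q : ℤ, p + n = q → (A.dual.HH q ≃ₗ[k] A.regular.HH p))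
      (B : ∀ p q : ℤ, q + 1 = p → (A.dual.HH p →ₗ[k] A.dual.HH q))
      (V : HochschildBV.BVAlgebra k A.regular.HH),
      HochschildBV.IsInducedBy m D ∧ HochschildBV.IsConnesOnHH B ∧
      V.toGerstenhaberAlgebra.IsHochschild ∧
      ∀ (p q p' q' : ℤ) (h : q + 1 = p) (hp : p + n = p') (hq : q + n = q')
        (h' : q' + 1 = p') (x : A.regular.HH p),
        V.Δ p q h x = D q q' hq (B p' q' h' ((D p p' hp).symm x)) :=
  ⟨hm.dualityEquiv, HochschildBV.DGBimodule.connesHH, hm.bvAlgebra, hm.isInducedBy_dualityEquiv,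
    HochschildBV.DGBimodule.isConnesOnHH_connesHH, HochschildBV.DGAlgebra.isHochschild_gerstenhaberHH,
    fun _ _ _ _ h hp hq h' x => hm.bvOperator_apply h hp hq h' x⟩
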